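/- Let $d_L,d_R\in\mathbb C^\times$. Let $\mathcal O_{d_L,d_R}$ be the strict $\mathbb C$-linear tensor category of oriented Kauffman diagrams. Its objects are the words in two letters $X,X^*$, with concatenation as tensor product and the empty word as unit object $I$. The space $\mathrm{Hom}(X^w,X^{w'})$ is the free complex vector space on the set of isotopy classes of systems of pairwise disjoint oriented planar strings in a rectangle, without closed loops, that have the word $w$ on the upper and $w'$ on the lower bounding line; here the letter $X$ (resp. $X^*$) means that the string starts (resp. ends) at the point on the upper line, and that it ends (resp. starts) at the point on the lower line. Composition is concatenation of diagrams (the diagram applied first on top), each clockwise loop being replaced by $d_R$ and each anticlockwise loop by $d_L$; the tensor product of morphisms is horizontal juxtaposition. Let $\epsilon_X: X\otimes X^*\to I$ and $\epsilon_{X^*}:X^*\otimes X\to I$ be the basic arcs, and write $\mathcal O_d=\mathcal O_{d,d}$. Write $\cong$ for the existence of a $\mathbb C$-linear (strong) monoidal functor that is fully faithful and essentially surjective. **Proposition.** (1) For $d_L,d_R,d_L',d_R'\in\mathbb C^\times$, $$\mathcal O_{d_L,d_R}\cong\mathcal O_{d_L',d_R'}\iff d_Ld_R=d_L'd_R'.$$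 (2) In particular, $\mathcal O_{d_L,d_R}\cong\mathcal O_d$ whenever $d\in\mathbb C^\times$ satisfies $d^2=d_Ld_R$; and for $d,d'\in\mathbb C^\times$, $\mathcal O_d\cong\mathcal O_{d'}$ if and only if $d=\pm d'$. (3) Let $d\in\mathbb C^\times$. For every $\mathbb C$-linear monoidal self-equivalence $F$ of $\mathcal O_d$ there is $\lambda\in\mathbb C^\times$ such that either $F(X)=X$, $F(X^*)=X^*$ and $$F(\epsilon_X)=\lambda\,\epsilon_X,\qquad F(\epsilon_{X^*})=\lambda\,\epsilon_{X^*},$$ or $F(X)=X^*$, $F(X^*)=X$ and $$F(\epsilon_X)=\lambda\,\epsilon_{X^*},\qquad F(\epsilon_{X^*})=\lambda\,\epsilon_X,$$ where $F(\epsilon_X)$ and $F(\epsilon_{X^*})$ are regarded as morphisms $F(X)\otimes F(X^*)\to I$ and $F(X^*)\otimes F(X)\to I$ by means of the structure isomorphisms of $F$. Conversely, for every $\lambda\in\mathbb C^\times$ and each of the two forms there is exactly one strictly monoidal $\mathbb C$-linear functor $F:\mathcal O_d\to\mathcal O_d$ of that form, and it is an equivalence. -/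

import Mathlib

/-
The strict tensor category `OCat dL dR` of oriented Kauffman diagrams.

* Diagrams: `Letter`, `Pt`, `before`, `IsPlanar`, `dir`, `Diagram`.
* Concatenation: `join`, `glueStep`, `glue`, `stack`, `relevel`, `Diagram.glued`, `Diagram.comp`,
  and `weight` for the values of closed loops; vertical strings: `Diagram.id`.
* Juxtaposition: `juxt`, `Diagram.tensor`.
* The category: `OCat` and its instances; the basic arcs `epsX` and `epsXs`.

All the lemmas in between only serve to show that concatenation and juxtaposition yield planar
diagrams and satisfy the axioms of a linear tensor category.
-/

open CategoryTheory MonoidalCategory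

namespace OrientedKauffman

/-- The two letters of the words: `X` and `Xs`, the latter standing for `X^*`. -/
inductive Letter where
  | X
  | Xs
  deriving DecidableEq

/-- Points at which strings may end, arranged on horizontal lines ("levels"): `(l, i)` is the `i`-th
point from the left (counting from `0`) of level `l`.  In a diagram, level `0` is the upper and level
`1` the lower bounding line.  When a second diagram is put below, its two lines are the levels `2`
and `3`, so that the levels `1` and `2` face each other and have to be glued. -/
abbrev Pt := ℕ × ℕ

/-- The boundary order: even levels are read from left to right and odd levels from right to left, as
when running once around the rectangle, starting in the upper left corner. -/
def before (x y : Pt) : Prop :=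
  x.1 < y.1 ∨ (x.1 = y.1 ∧ if x.1 % 2 = 0 then x.2 < y.2 else y.2 < x.2)

/-- A system of pairwise disjoint oriented planar strings, recorded as the map `σ` that sends every
string end to the other end of the same string and fixes all the other points.  `dir x` tells what
happens at `x`: `some true` if a string starts there, `some false` if a string ends there, `none` if
`x` is not the end of a string. -/
structure IsPlanar (dir : Pt → Option Bool) (σ : Pt → Pt) : Prop where
  /-- `σ` exchanges the two ends of a string -/
  invol : ∀ x, σ (σ x) = x
  /-- strings end at the prescribed points only -/
  fixed : ∀ x, dir x = none → σ x = x
  /-- each string runs from a starting point to an end point -/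
  orient : ∀ x, dir (σ x) = (dir x).map not
  /-- the strings do not cross -/
  noncross : ∀ x y, before x y → before y (σ x) → ¬ before (σ x) (σ y)

/-- Join two string ends `p` and `q` (which cease to be string ends). -/
def join (p q : Pt) (σ : Pt → Pt) : Pt → Pt := fun x =>
  if x = p ∨ x = q then x
  else if σ x = p then σ q
  else if σ x = q then σ p
  else σ x

theorem before_trans {x y z : Pt} (h : before x y) (h' : before y z) : before x z := by
  unfold before at *
  grind
theorem before_irrefl (x : Pt) : ¬ before x x := by
  unfold before
  grind
theorem before_total {x y : Pt} (h : x ≠ y)  : before x y ∨ before y x := by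
  rcases x with ⟨a, b⟩
  rcases y with ⟨c, d⟩
  unfold before
  grind

theorem ncr {σ : Pt → Pt} (inv : ∀ x, σ (σ x) = x)
    (nc : ∀ x y, before x y → before y (σ x) → ¬ before (σ x) (σ y))
    {x u : Pt} (_h : before x (σ x)) (h1 : before x u) (h2 : before u (σ x)) :
    before x (σ u) ∧ before (σ u) (σ x) := by
  have a1 := nc x u h1 h2
  have a2 := nc u (σ x)
  have a3 := nc (σ u) x
  have a4 := @before_total (σ u) x
  have a5 := @before_total (σ u) (σ x)
  have := @before_irrefl
  have := @before_trans
  grind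

theorem sep {σ : Pt → Pt} (inv : ∀ x, σ (σ x) = x)
    (nc : ∀ x y, before x y → before y (σ x) → ¬ before (σ x) (σ y)) {p q : Pt}
    (hpq : before p q) (hb : ∀ z, before p z → before z q → σ z = z)
    {u : Pt} (h : before u (σ u)) (h1 : u ≠ p) (h2 : u ≠ q) (h3 : σ u ≠ p) (h4 : σ u ≠ q) :
    (before u (σ p) ∧ before (σ p) (σ u)) ↔ (before u (σ q) ∧ before (σ q) (σ u)) := by
  have e1 : (before u (σ p) ∧ before (σ p) (σ u)) ↔ (before u p ∧ before p (σ u)) := by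
    constructor
    · intro ⟨a, b⟩
      simpa [inv] using ncr inv nc h a b
    · intro ⟨a, b⟩
      simpa [inv] using ncr inv nc h a b
  have e2 : (before u (σ q) ∧ before (σ q) (σ u)) ↔ (before u q ∧ before q (σ u)) := by
    constructor
    · intro ⟨a, b⟩
      simpa [inv] using ncr inv nc h a b
    · intro ⟨a, b⟩
      simpa [inv] using ncr inv nc h a b
  rw [e1, e2]
  have t1 := before_total h1
  have t2 := before_total h2
  have t3 := before_total h3
  have t4 := before_total h4
  have b1 := hb u
  have b2 := hb (σ u)
  have := @before_irrefl
  have := @before_trans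
  grind

theorem join_nc {σ : Pt → Pt} (inv : ∀ x, σ (σ x) = x)
    (nc : ∀ x y, before x y → before y (σ x) → ¬ before (σ x) (σ y)) {p q : Pt}
    (hpq : before p q) (hb : ∀ z, before p z → before z q → σ z = z) (x y : Pt)
    (h1 : before x y) (h2 : before y (join p q σ x)) :
    ¬ before (join p q σ x) (join p q σ y) := by
  intro h3
  have hx : x ≠ join p q σ x := by rintro h; exact before_irrefl _ (before_trans h1 (h ▸ h2))
  have hy : y ≠ join p q σ y := by rintro h; exact before_irrefl _ (before_trans h2 (h ▸ h3))
  have sx := @sep σ inv nc p q hpq hb x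
  have sy := @sep σ inv nc p q hpq hb y
  have n1 := nc x y
  have i := @before_irrefl
  have t := @before_trans
  unfold join at *
  grind

theorem IsPlanar.ne {dir : Pt → Option Bool} {σ : Pt → Pt} (h : IsPlanar dir σ) (x : Pt)
    (hx : dir x ≠ none) : σ x ≠ x := by
  intro hx'
  have e := h.orient x
  rw [hx'] at e
  rcases hh : dir x with _ | _ | _ <;> simp [hh] at e hx

theorem IsPlanar.join {dir : Pt → Option Bool} {σ : Pt → Pt} (h : IsPlanar dir σ) {p q : Pt}
    (hpq : before p q) (hp : dir p ≠ none) (hd : dir q = (dir p).map not)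
    (hb : ∀ z, before p z → before z q → dir z = none) :
    IsPlanar (fun x => if x = p ∨ x = q then none else dir x) (join p q σ) := by
  have np := h.ne
  have h1 := h.invol
  have h2 := h.fixed
  have h3 := h.orient
  have hne : p ≠ q := by rintro rfl; exact before_irrefl _ hpq
  have hq : dir q ≠ none := by cases hh : dir p <;> simp_all
  have np1 := np p hp
  have np2 := np q hq
  refine ⟨?_, ?_, ?_, join_nc h.invol h.noncross hpq fun z a b => h.fixed z (hb z a b)⟩
  · intro x
    unfold OrientedKauffman.join
    grind
  · intro x
    unfold OrientedKauffman.join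
    grind
  · intro x
    have e : ∀ z : Option Bool, (z.map not).map not = z := by rintro (_ | _ | _) <;> rfl
    unfold OrientedKauffman.join
    grind

/-- Strings together with the closed loops that have been split off; a loop is recorded by the letter
carried by its rightmost point on the line along which it has been closed. -/
structure Tangle where
  σ : Pt → Pt
  loops : Multiset Letter

/-- Join the point `(l, i)` of a lower line to the point `(l + 1, i)` of the upper line below it, both
carrying the letter `c`.  If they are the two ends of one string, this closes a loop. -/
def glueStep (l i : ℕ) (c : Letter) (T : Tangle) : Tangle where
  σ := join (l, i) (l + 1, i) T.σ
  loops := if T.σ (l, i) = (l + 1, i) then c ::ₘ T.loops else T.loops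

/-- Glue the level `l` to the level `l + 1` along the points number `i`, `i + 1`, …, which carry the
letters of the given list; the points are joined from left to right. -/
def glue (l : ℕ) : List Letter → ℕ → Tangle → Tangle
  | [], _, T => T
  | c :: cs, i, T => glue l cs (i + 1) (glueStep l i c T)

/-- The levels `l` and `l + 1` carry the letters `cs` at the points `i`, `i + 1`, …, and nothing else. -/
structure Ready (dir : Pt → Option Bool) (l i : ℕ) (cs : List Letter) : Prop where
  odd : l % 2 = 1
  done : ∀ j < i, dir (l, j) = none ∧ dir (l + 1, j) = none
  left : ∀ j, dir (l, i + j) = cs[j]?.map (fun c => decide (c ≠ .X))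
  right : ∀ j, dir (l + 1, i + j) = cs[j]?.map (fun c => decide (c = .X))

/-- Directions after the points `(l, i)` and `(l + 1, i)` have been joined. -/
def erase (dir : Pt → Option Bool) (l i : ℕ) : Pt → Option Bool :=
  fun x => if x = (l, i) ∨ x = (l + 1, i) then none else dir x

theorem Ready.step {dir : Pt → Option Bool} {l i : ℕ} {c : Letter} {cs : List Letter}
    (h : Ready dir l i (c :: cs)) : Ready (erase dir l i) l (i + 1) cs := by
  refine ⟨h.odd, ?_, ?_, ?_⟩
  · intro j hj
    have := h.done j
    unfold erase
    grind
  · intro j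
    have := h.left (j + 1)
    unfold erase
    grind
  · intro j
    have := h.right (j + 1)
    unfold erase
    grind

theorem Ready.other {dir : Pt → Option Bool} {l i l' i' : ℕ} {cs' : List Letter}
    (h : Ready dir l' i' cs') (hl : l' + 1 < l ∨ l + 1 < l') : Ready (erase dir l i) l' i' cs' := by
  have h1 := h.done
  have h2 := h.left
  have h3 := h.right
  refine ⟨h.odd, ?_, ?_, ?_⟩ <;> unfold erase <;> grind

theorem Ready.dirs {dir : Pt → Option Bool} {l i : ℕ} {c : Letter} {cs : List Letter}
    (h : Ready dir l i (c :: cs)) :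
    dir (l, i) = some (decide (c ≠ .X)) ∧ dir (l + 1, i) = some (decide (c = .X)) :=
  ⟨h.left 0, h.right 0⟩

theorem IsPlanar.glueStep {dir : Pt → Option Bool} {T : Tangle} {l i : ℕ} {c : Letter}
    {cs : List Letter} (h : IsPlanar dir T.σ) (hr : Ready dir l i (c :: cs)) :
    IsPlanar (erase dir l i) (glueStep l i c T).σ := by
  obtain ⟨d1, d2⟩ := hr.dirs
  refine h.join (Or.inl (Nat.lt_succ_self l)) (by simp [d1]) (by simp [d1, d2]) ?_
  rintro ⟨a, b⟩ h1 h2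
  have := hr.done b
  have := hr.odd
  unfold before at *
  grind

theorem IsPlanar.glue {l : ℕ} {cs : List Letter} {dir : Pt → Option Bool} {T : Tangle} {i : ℕ}
    (h : IsPlanar dir T.σ) (hr : Ready dir l i cs) :
    IsPlanar (fun x => if x.1 = l ∨ x.1 = l + 1 then none else dir x) (glue l cs i T).σ := by
  induction cs generalizing dir T i with
  | nil =>
    suffices e : (fun x => if x.1 = l ∨ x.1 = l + 1 then none else dir x) = dir by
      rw [e]; exact h
    funext ⟨a, b⟩
    have h1 := hr.done b
    have h2 := hr.left (b - i)
    have h3 := hr.right (b - i)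
    grind
  | cons c cs ih =>
    have h1 := ih (h.glueStep hr) hr.step
    suffices e : (fun x => if x.1 = l ∨ x.1 = l + 1 then none else dir x) =
        fun x => if x.1 = l ∨ x.1 = l + 1 then none else erase dir l i x by
      rw [e]; exact h1
    funext ⟨a, b⟩
    unfold erase
    grind

theorem glueStep_comm {dir : Pt → Option Bool} {T : Tangle} {l i l' i' : ℕ} {c c' : Letter}
    {cs cs' : List Letter} (h : IsPlanar dir T.σ) (hr : Ready dir l i (c :: cs))
    (hr' : Ready dir l' i' (c' :: cs')) (hl : l + 1 < l') :
    OrientedKauffman.glueStep l' i' c' (OrientedKauffman.glueStep l i c T) = OrientedKauffman.glueStep l i c (OrientedKauffman.glueStep l' i' c' T) := by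
  obtain ⟨d1, d2⟩ := hr.dirs
  obtain ⟨d1', d2'⟩ := hr'.dirs
  have inv := h.invol
  have o1 := h.orient (l, i)
  have o2 := h.orient (l + 1, i)
  have nc : ¬ (T.σ (l, i) = (l', i') ∧ T.σ (l + 1, i) = (l' + 1, i')) := by
    rintro ⟨e1, e2⟩
    have := h.noncross (l, i) (l + 1, i)
    simp [e1, e2, before] at this
    omega
  have hc : T.σ (l, i) = (l' + 1, i') → c = c' := by
    intro e
    rw [e, d1, d2'] at o1
    cases c <;> cases c' <;> simp_all
  unfold OrientedKauffman.glueStep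
  congr 1
  · funext x
    unfold join
    grind
  · have := Multiset.cons_swap c c' T.loops
    unfold join
    grind

theorem glue_glueStep {l l' i' : ℕ} {c' : Letter} {cs cs' : List Letter}
    {dir : Pt → Option Bool} {T : Tangle} {i : ℕ} (h : IsPlanar dir T.σ) (hr : Ready dir l i cs)
    (hr' : Ready dir l' i' (c' :: cs')) (hl : l + 1 < l') :
    glue l cs i (OrientedKauffman.glueStep l' i' c' T) = OrientedKauffman.glueStep l' i' c' (glue l cs i T) := by
  induction cs generalizing dir T i with
  | nil => rfl
  | cons c cs ih =>
    simp only [glue]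
    rw [← glueStep_comm h hr hr' hl]
    exact ih (h.glueStep hr) hr.step (hr'.other (by omega))

theorem glue_comm {l l' : ℕ} {cs cs' : List Letter}
    {dir : Pt → Option Bool} {T : Tangle} {i i' : ℕ} (h : IsPlanar dir T.σ) (hr : Ready dir l i cs)
    (hr' : Ready dir l' i' cs') (hl : l + 1 < l') :
    glue l' cs' i' (glue l cs i T) = glue l cs i (glue l' cs' i' T) := by
  induction cs' generalizing dir T i' with
  | nil => rfl
  | cons c cs' ih =>
    simp only [glue]
    rw [← glue_glueStep h hr hr' hl]
    exact ih (h.glueStep hr') (hr.other (by omega)) hr'.step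

theorem glue_loops (l : ℕ) (cs : List Letter) (i : ℕ) (T : Tangle) :
    glue l cs i T = ⟨(glue l cs i ⟨T.σ, 0⟩).σ, (glue l cs i ⟨T.σ, 0⟩).loops + T.loops⟩ := by
  induction cs generalizing i T with
  | nil => simp [glue]
  | cons c cs ih =>
    simp only [glue]
    rw [ih, ih (T := OrientedKauffman.glueStep l i c ⟨T.σ, 0⟩)]
    simp only [OrientedKauffman.glueStep]
    split_ifs <;> simp [add_assoc, add_comm, ← Multiset.singleton_add]

/-- The strings `σ` on the levels below `m`, and the strings `τ` moved down by `m` levels. -/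
def stack (m : ℕ) (σ τ : Pt → Pt) : Pt → Pt := fun x =>
  if x.1 < m then σ x else ((τ (x.1 - m, x.2)).1 + m, (τ (x.1 - m, x.2)).2)

/-- Directions of stacked strings. -/
def stackDir (m : ℕ) (d e : Pt → Option Bool) : Pt → Option Bool := fun x =>
  if x.1 < m then d x else e (x.1 - m, x.2)

theorem IsPlanar.stack {d e : Pt → Option Bool} {σ τ : Pt → Pt} {m : ℕ} (hm : m % 2 = 0)
    (h : IsPlanar d σ) (h' : IsPlanar e τ) (hd : ∀ x : Pt, m ≤ x.1 → d x = none) :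
    IsPlanar (stackDir m d e) (stack m σ τ) := by
  have i1 := h.invol
  have i2 := h'.invol
  have f1 := fun x hx => h.fixed x (hd x hx)
  have lv : ∀ x : Pt, x.1 < m → (σ x).1 < m := by grind
  refine ⟨?_, ?_, ?_, ?_⟩
  · intro x
    unfold OrientedKauffman.stack
    grind
  · intro x
    have := h.fixed x
    have := h'.fixed (x.1 - m, x.2)
    unfold OrientedKauffman.stack stackDir
    grind
  · intro x
    have := h.orient x
    have := h'.orient (x.1 - m, x.2)
    unfold OrientedKauffman.stack stackDir
    grind
  · intro x y b1 b2 b3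
    have sh : ∀ x y : Pt, m ≤ x.1 → (before x (y.1 + m, y.2) ↔ before (x.1 - m, x.2) y) := by
      intro x y hx
      unfold before
      grind
    have sh' : ∀ x y : Pt, m ≤ y.1 → (before (x.1 + m, x.2) y ↔ before x (y.1 - m, y.2)) := by
      intro x y hx
      unfold before
      grind
    have lt : ∀ x y : Pt, before x y → x.1 ≤ y.1 := by
      intro x y hx
      unfold before at hx
      grind
    have l1 := lt _ _ b1
    have l2 := lt _ _ b2
    have l3 := lt _ _ b3
    unfold OrientedKauffman.stack at *
    by_cases hx : x.1 < m
    · have := lv x hx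
      rw [if_pos hx] at *
      have hy : y.1 < m := by omega
      rw [if_pos hy] at *
      exact h.noncross x y b1 b2 b3
    · have hy : ¬ y.1 < m := by omega
      rw [if_neg hx] at *
      rw [if_neg hy] at *
      refine h'.noncross (x.1 - m, x.2) (y.1 - m, y.2) ?_ ((sh _ _ (by omega)).1 b2) ?_
      · unfold before at *
        grind
      · simpa [sh'] using b3

theorem stack_assoc (σ τ ρ : Pt → Pt) (m k : ℕ) :
    stack m σ (stack k τ ρ) = stack (m + k) (stack m σ τ) ρ := by
  funext x
  unfold stack
  grind

theorem glueStep_stack_left {m l i : ℕ} {c : Letter} {T : Tangle} {τ : Pt → Pt}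
    (hl : l + 1 < m) (hT : ∀ x : Pt, x.1 < m → (T.σ x).1 < m) :
    glueStep l i c ⟨stack m T.σ τ, T.loops⟩ =
      ⟨stack m (glueStep l i c T).σ τ, (glueStep l i c T).loops⟩ := by
  unfold glueStep
  congr 1
  · funext x
    have := hT x
    have := hT (l, i)
    have := hT (l + 1, i)
    unfold stack join
    grind
  · unfold stack
    grind

theorem glue_stack_left {m l i : ℕ} {cs : List Letter} {T : Tangle} {τ : Pt → Pt}
    (hl : l + 1 < m) (hT : ∀ x : Pt, x.1 < m → (T.σ x).1 < m) :
    glue l cs i ⟨stack m T.σ τ, T.loops⟩ =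
      ⟨stack m (glue l cs i T).σ τ, (glue l cs i T).loops⟩ := by
  induction cs generalizing i T with
  | nil => rfl
  | cons c cs ih =>
    simp only [glue]
    rw [glueStep_stack_left hl hT]
    apply ih
    intro x hx
    have := hT x
    have := hT (l, i)
    have := hT (l + 1, i)
    unfold OrientedKauffman.glueStep join
    grind

theorem glueStep_stack_right {m l i : ℕ} {c : Letter} {T : Tangle} {σ : Pt → Pt}
    (hσ : ∀ x : Pt, x.1 < m → (σ x).1 < m) :
    glueStep (m + l) i c ⟨stack m σ T.σ, T.loops⟩ =
      ⟨stack m σ (glueStep l i c T).σ, (glueStep l i c T).loops⟩ := by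
  unfold glueStep
  congr 1
  · funext x
    have := hσ x
    have := hσ (m + l, i)
    have : m + l - m = l := by omega
    have : m + l + 1 - m = l + 1 := by omega
    unfold stack join
    grind
  · have : m + l - m = l := by omega
    unfold stack
    grind

theorem glue_stack_right {m l i : ℕ} {cs : List Letter} {T : Tangle} {σ : Pt → Pt}
    (hσ : ∀ x : Pt, x.1 < m → (σ x).1 < m) :
    glue (m + l) cs i ⟨stack m σ T.σ, T.loops⟩ =
      ⟨stack m σ (glue l cs i T).σ, (glue l cs i T).loops⟩ := by
  induction cs generalizing i T with
  | nil => rfl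
  | cons c cs ih =>
    simp only [glue]
    rw [glueStep_stack_right hσ]
    apply ih

/-- Renumbering of the levels. -/
def relevel (π : Equiv.Perm ℕ) (σ : Pt → Pt) : Pt → Pt := fun x =>
  (π (σ (π.symm x.1, x.2)).1, (σ (π.symm x.1, x.2)).2)

theorem relevel_relevel (π ρ : Equiv.Perm ℕ) (σ : Pt → Pt) :
    relevel π (relevel ρ σ) = relevel (π * ρ) σ := by
  funext x
  simp [relevel, Equiv.Perm.mul_def]

theorem glueStep_relevel (π : Equiv.Perm ℕ) {l l' i : ℕ} {c : Letter} {T : Tangle}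
    (h1 : π l = l') (h2 : π (l + 1) = l' + 1) :
    glueStep l' i c ⟨relevel π T.σ, T.loops⟩ =
      ⟨relevel π (glueStep l i c T).σ, (glueStep l i c T).loops⟩ := by
  have e1 : π.symm l' = l := by simp [← h1]
  have e2 : π.symm (l' + 1) = l + 1 := by simp [← h2]
  have a1 : ∀ a, π.symm (π a) = a := π.symm_apply_apply
  have a2 : ∀ a, π (π.symm a) = a := π.apply_symm_apply
  unfold glueStep
  congr 1
  · funext x
    unfold relevel join
    grind
  · unfold relevel
    grind

theorem glue_relevel (π : Equiv.Perm ℕ) {l l' i : ℕ} {cs : List Letter} {T : Tangle}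
    (h1 : π l = l') (h2 : π (l + 1) = l' + 1) :
    glue l' cs i ⟨relevel π T.σ, T.loops⟩ =
      ⟨relevel π (glue l cs i T).σ, (glue l cs i T).loops⟩ := by
  induction cs generalizing i T with
  | nil => rfl
  | cons c cs ih =>
    simp only [glue]
    rw [glueStep_relevel π h1 h2]
    apply ih

theorem IsPlanar.relevel {d d' : Pt → Option Bool} {σ : Pt → Pt} (π : Equiv.Perm ℕ)
    (h : IsPlanar d σ) (hd : ∀ x : Pt, d' (π x.1, x.2) = d x)
    (hπ : ∀ x y : Pt, d x ≠ none → d y ≠ none → before (π x.1, x.2) (π y.1, y.2) → before x y) :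
    IsPlanar d' (relevel π σ) := by
  have a1 : ∀ a, π.symm (π a) = a := π.symm_apply_apply
  have a2 : ∀ a, π (π.symm a) = a := π.apply_symm_apply
  have hd' : ∀ x : Pt, d' x = d (π.symm x.1, x.2) := fun x => by rw [← hd]; simp
  have i1 := h.invol
  refine ⟨?_, ?_, ?_, ?_⟩
  · intro x
    unfold OrientedKauffman.relevel
    grind
  · intro x
    have := h.fixed (π.symm x.1, x.2)
    unfold OrientedKauffman.relevel
    grind
  · intro x
    have := h.orient (π.symm x.1, x.2)
    unfold OrientedKauffman.relevel
    grind
  · intro x y u1 u2 u3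
    have ns : ∀ z, d z ≠ none → d (σ z) ≠ none := by
      intro z hz
      rw [h.orient]
      simpa using hz
    have t1 : d (π.symm x.1, x.2) ≠ none := by
      intro hh
      have := before_irrefl x
      have := @before_trans
      have := h.fixed _ hh
      unfold OrientedKauffman.relevel at *
      grind
    have t2 : d (π.symm y.1, y.2) ≠ none := by
      intro hh
      have := before_irrefl y
      have := @before_trans
      have := h.fixed _ hh
      unfold OrientedKauffman.relevel at *
      grind
    have s1 := ns _ t1
    have s2 := ns _ t2
    refine h.noncross (π.symm x.1, x.2) (π.symm y.1, y.2) ?_ ?_ ?_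
    · exact hπ _ _ t1 t2 (by simpa using u1)
    · exact hπ _ _ t2 s1 (by simpa [OrientedKauffman.relevel] using u2)
    · exact hπ _ _ s1 s2 u3

theorem relevel_congr (π π' : Equiv.Perm ℕ) {σ : Pt → Pt} {S : Set ℕ}
    (hσ : ∀ x : Pt, x.1 ∉ S → σ x = x) (hσ' : ∀ x : Pt, x.1 ∈ S → (σ x).1 ∈ S)
    (h : ∀ a ∈ S, π a = π' a) : relevel π σ = relevel π' σ := by
  funext x
  unfold relevel
  by_cases hx : π.symm x.1 ∈ S
  · have e : π'.symm x.1 = π.symm x.1 := by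
      rw [Equiv.symm_apply_eq, ← h _ hx]; simp
    rw [e, h _ (hσ' _ hx)]
  · have hx' : π'.symm x.1 ∉ S := by
      intro hh
      apply hx
      have : π.symm x.1 = π'.symm x.1 := by
        rw [Equiv.symm_apply_eq, h _ hh]; simp
      rwa [this]
    rw [hσ _ hx, hσ _ hx']
    simp

/-- Directions prescribed by a type `(w, w')`: the letter `X` stands for a starting point on the upper
line and for an end point on the lower line, `X^*` for the opposite. -/
def dir (w w' : List Letter) (x : Pt) : Option Bool :=
  if x.1 = 0 then w[x.2]?.map (fun c => decide (c = .X))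
  else if x.1 = 1 then w'[x.2]?.map (fun c => decide (c ≠ .X))
  else none

/-- Oriented Kauffman diagrams of type `(w, w')`, the word `w` being on the upper and `w'` on the lower
bounding line.  An isotopy class of oriented planar strings is given by telling which points are
joined. -/
@[ext]
structure Diagram (w w' : List Letter) where
  σ : Pt → Pt
  planar : IsPlanar (dir w w') σ

theorem dir_of_ge {w w' : List Letter} (x : Pt) (h : 2 ≤ x.1) : dir w w' x = none := by
  unfold dir
  grind

theorem Diagram.lt_two {w w' : List Letter} (D : Diagram w w') (x : Pt) (h : x.1 < 2) :
    (D.σ x).1 < 2 := by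
  have i1 := D.planar.invol
  have := D.planar.fixed (D.σ x)
  have := @dir_of_ge w w' (D.σ x)
  grind

theorem ready_stack (w w' w'' : List Letter) :
    Ready (stackDir 2 (dir w w') (dir w' w'')) 1 0 w' := by
  refine ⟨rfl, by simp, ?_, ?_⟩ <;> intro j <;> simp [stackDir, dir]

/-- Put `E` below `D` and glue; the strings of the result end on the levels `0` and `3`. -/
def Diagram.glued {w w' w'' : List Letter} (D : Diagram w w') (E : Diagram w' w'') : Tangle :=
  glue 1 w' 0 ⟨stack 2 D.σ E.σ, 0⟩

theorem Diagram.planar_stack {w w' w'' : List Letter} (D : Diagram w w') (E : Diagram w' w'') :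
    IsPlanar (stackDir 2 (dir w w') (dir w' w'')) (stack 2 D.σ E.σ) :=
  D.planar.stack rfl E.planar dir_of_ge

theorem Diagram.planar_glued {w w' w'' : List Letter} (D : Diagram w w') (E : Diagram w' w'') :
    IsPlanar (fun x => if x.1 = 1 ∨ x.1 = 1 + 1 then none else
      stackDir 2 (dir w w') (dir w' w'') x) (D.glued E).σ :=
  IsPlanar.glue (T := ⟨stack 2 D.σ E.σ, 0⟩) (D.planar_stack E) (ready_stack w w' w'')

/-- The diagram obtained by concatenation, closed loops being removed. -/
def Diagram.comp {w w' w'' : List Letter} (D : Diagram w w') (E : Diagram w' w'') :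
    Diagram w w'' :=
  ⟨relevel (Equiv.swap 1 3) (D.glued E).σ, by
    refine (D.planar_glued E).relevel _ ?_ ?_
    · rintro ⟨_ | _ | _ | _ | a, b⟩
      · simp [stackDir, dir, Equiv.swap_apply_def]
      · simp [dir, Equiv.swap_apply_def]
      · simp [dir, Equiv.swap_apply_def]
      · simp [stackDir, dir, Equiv.swap_apply_def]
      · simp [stackDir, dir, Equiv.swap_apply_def]
    · rintro ⟨_ | _ | _ | _ | a, b⟩ ⟨_ | _ | _ | _ | a', b'⟩ <;>
        simp [stackDir, dir, Equiv.swap_apply_def, before]⟩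

/-- The vertical strings. -/
def idMap (n : ℕ) (x : Pt) : Pt :=
  if x.2 < n then (if x.1 = 0 then (1, x.2) else if x.1 = 1 then (0, x.2) else x) else x

/-- The identity diagram: vertical strings. -/
def Diagram.id (w : List Letter) : Diagram w w :=
  ⟨idMap w.length, by
    refine ⟨?_, ?_, ?_, ?_⟩
    · intro x
      unfold idMap
      grind
    · intro x
      unfold idMap dir
      grind
    · intro x
      unfold idMap dir
      grind
    · intro x y
      unfold idMap before
      grind⟩

/-- Exchange of the first `i` points of the levels `a` and `b`. -/
def swp (a b i : ℕ) (x : Pt) : Pt :=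
  if x.2 < i then (if x.1 = a then (b, x.2) else if x.1 = b then (a, x.2) else x) else x

/-- What becomes of strings `σ` after gluing vertical strings to the first `i` points. -/
def after (a b i : ℕ) (σ : Pt → Pt) : Pt → Pt := fun x =>
  if (x.1 = 1 ∨ x.1 = 2) ∧ x.2 < i then x else swp a b i (σ (swp a b i x))

theorem swp_swp (a b i : ℕ) (x : Pt) : swp a b i (swp a b i x) = x := by
  unfold swp
  grind

theorem swp_succ (a b i : ℕ) (x : Pt) : swp a b (i + 1) x =
    swp a b i (if x = (a, i) then (b, i) else if x = (b, i) then (a, i) else x) := by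
  unfold swp
  grind

theorem swp_succ' (a b i : ℕ) (x : Pt) : swp a b (i + 1) x =
    (fun x => if x = (a, i) then (b, i) else if x = (b, i) then (a, i) else x) (swp a b i x) := by
  unfold swp
  grind

theorem join_comm {σ : Pt → Pt} (_hσ : ∀ x, σ (σ x) = x) (p q : Pt) :
    join p q σ = join q p σ := by
  funext x
  unfold join
  grind

theorem join_rename {σ : Pt → Pt} (hσ : ∀ x, σ (σ x) = x) {a p q : Pt} (h : σ a = p)
    (hpq : p ≠ q) (haq : a ≠ q) (_hap : a ≠ p) (hq : σ q ≠ q) :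
    join p q σ = fun x => if x = p ∨ x = q then x else
      (fun x => if x = a then q else if x = q then a else x)
        (σ (if x = a then q else if x = q then a else x)) := by
  funext x
  have := hσ a
  unfold join
  grind

theorem glueStep_after {a b P i : ℕ} {σ : Pt → Pt} (hσ : ∀ x, σ (σ x) = x)
    (hab : a = 0 ∧ b = 2 ∧ P = 1 ∨ a = 3 ∧ b = 1 ∧ P = 2)
    (h1 : ∀ j ≤ i, σ (a, j) = (P, j)) (h2 : σ (b, i) ≠ (b, i)) {c : Letter} {L : Multiset Letter} :
    glueStep 1 i c ⟨after a b i σ, L⟩ = ⟨after a b (i + 1) σ, L⟩ := by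
  have h1' : ∀ j ≤ i, σ (P, j) = (a, j) := fun j hj => by rw [← h1 j hj, hσ]
  have ne : a ≠ P ∧ b ≠ P ∧ a ≠ b := by omega
  have hb : ∀ l : ℕ, (l = 1 ∨ l = 2) ↔ (l = P ∨ l = b) := by omega
  have inv : ∀ x, after a b i σ (after a b i σ x) = x := by
    intro x
    unfold after
    simp only [hb]
    by_cases hx : (x.1 = P ∨ x.1 = b) ∧ x.2 < i
    · simp [hx]
    · rw [if_neg hx, if_neg, swp_swp, hσ, swp_swp]
      rintro ⟨k1, k2⟩
      set y := swp a b i (σ (swp a b i x)) with hy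
      have e : swp a b i (σ (swp a b i y)) = x := by rw [hy, swp_swp, hσ, swp_swp]
      apply hx
      rcases k1 with k1 | k1
      · have : swp a b i y = (P, y.2) := by unfold swp; grind
        rw [this, h1' _ k2.le] at e
        rw [← e]
        simp [swp, k2]
      · have : swp a b i y = (a, y.2) := by unfold swp; grind
        rw [this, h1 _ k2.le] at e
        rw [← e]
        simp [swp, k2]
        grind
  have e1 : after a b i σ (a, i) = (P, i) := by
    simp [after, swp, h1 i le_rfl]
  have e3 : after a b i σ (b, i) ≠ (b, i) := by
    have : swp a b i (b, i) = (b, i) := by simp [swp]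
    intro hh
    apply h2
    rw [← swp_swp a b i (σ (b, i))]
    simpa [after, this] using congrArg (swp a b i) hh
  have key : join (P, i) (b, i) (after a b i σ) = after a b (i + 1) σ := by
    rw [join_rename inv e1 (by grind) (by grind) (by grind) e3]
    funext x
    unfold after
    simp only [hb]
    by_cases hx : x = (P, i) ∨ x = (b, i)
    · rw [if_pos hx, if_pos]
      rcases hx with rfl | rfl <;> simp
    · rw [if_neg hx]
      by_cases hx' : (x.1 = P ∨ x.1 = b) ∧ x.2 < i
      · grind
      · have hx2 : ¬ ((x.1 = P ∨ x.1 = b) ∧ x.2 < i + 1) := by grind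
        have hx3 : ¬ (((if x = (a, i) then (b, i) else if x = (b, i) then (a, i) else x).1 = P ∨
            (if x = (a, i) then (b, i) else if x = (b, i) then (a, i) else x).1 = b) ∧
            (if x = (a, i) then (b, i) else if x = (b, i) then (a, i) else x).2 < i) := by
          grind
        rw [if_neg hx2, swp_succ' (x := σ _), swp_succ (x := x), if_neg hx3]
  have key' : join (1, i) (1 + 1, i) (after a b i σ) = after a b (i + 1) σ := by
    rcases hab with ⟨rfl, rfl, rfl⟩ | ⟨rfl, rfl, rfl⟩
    · exact key
    · rw [join_comm inv]; exact key
  unfold glueStep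
  rw [key']
  congr 1
  apply if_neg
  have e2 := inv (a, i)
  rw [e1] at e2
  rcases hab with ⟨rfl, rfl, rfl⟩ | ⟨rfl, rfl, rfl⟩
  · simp [e2]
  · intro hh
    simp at hh
    have := inv (1, i)
    rw [hh, e2] at this
    simp at this

theorem glue_after {a b P n : ℕ} {σ : Pt → Pt} (hσ : ∀ x, σ (σ x) = x)
    (hab : a = 0 ∧ b = 2 ∧ P = 1 ∨ a = 3 ∧ b = 1 ∧ P = 2)
    (h1 : ∀ j < n, σ (a, j) = (P, j)) (h2 : ∀ j < n, σ (b, j) ≠ (b, j)) {cs : List Letter} {i : ℕ} (hi : i + cs.length = n)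
    {L : Multiset Letter} : glue 1 cs i ⟨after a b i σ, L⟩ = ⟨after a b n σ, L⟩ := by
  induction cs generalizing i with
  | nil => simp at hi; subst hi; rfl
  | cons c cs ih =>
    simp only [glue]
    simp at hi
    rw [glueStep_after hσ hab (fun j hj => h1 j (by omega)) (h2 i (by omega)), ih (by omega)]

theorem after_zero (a b : ℕ) (σ : Pt → Pt) : after a b 0 σ = σ := by
  funext x
  simp [after, swp]

theorem dir_of_length {w w' : List Letter} (x : Pt)
    (h : (if x.1 = 0 then w.length else w'.length) ≤ x.2) : dir w w' x = none := by
  unfold dir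
  grind

theorem Diagram.id_glued {w w' : List Letter} (D : Diagram w w') :
    (Diagram.id w).glued D = ⟨after 0 2 w.length (stack 2 (idMap w.length) D.σ), 0⟩ := by
  have key := glue_after (i := 0) (cs := w) (P := 1) (a := 0) (b := 2) (L := 0)
    ((Diagram.id w).planar_stack D).invol (by simp) ?_ ?_ (Nat.zero_add _)
  · rw [after_zero] at key
    exact key
  · intro j hj
    simp [stack, Diagram.id, idMap, hj]
  · intro j hj
    apply IsPlanar.ne (Diagram.planar_stack _ _)
    simp [stackDir, dir, hj]

theorem Diagram.glued_id {w w' : List Letter} (D : Diagram w w') :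
    D.glued (Diagram.id w') = ⟨after 3 1 w'.length (stack 2 D.σ (idMap w'.length)), 0⟩ := by
  have key := glue_after (i := 0) (cs := w') (P := 2) (a := 3) (b := 1) (L := 0)
    (D.planar_stack (Diagram.id w')).invol (by simp) ?_ ?_ (Nat.zero_add _)
  · rw [after_zero] at key
    exact key
  · intro j hj
    simp [stack, Diagram.id, idMap, hj]
  · intro j hj
    apply IsPlanar.ne (Diagram.planar_stack _ _)
    simp [stackDir, dir, hj]

theorem Diagram.cases {w w' : List Letter} (D : Diagram w w') (x : Pt) :
    (∃ y : Pt, D.σ x = y ∧ (y.1 = 0 ∧ y.2 < w.length ∨ y.1 = 1 ∧ y.2 < w'.length) ∧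
      (x.1 = 0 ∧ x.2 < w.length ∨ x.1 = 1 ∧ x.2 < w'.length)) ∨
    (D.σ x = x ∧ ¬ (x.1 = 0 ∧ x.2 < w.length ∨ x.1 = 1 ∧ x.2 < w'.length)) := by
  have h1 := D.planar.fixed x
  have h2 := D.planar.orient x
  unfold dir at h1 h2
  grind

theorem Diagram.id_comp {w w' : List Letter} (D : Diagram w w') : (Diagram.id w).comp D = D := by
  apply Diagram.ext
  simp only [Diagram.comp, Diagram.id_glued]
  funext ⟨l, j⟩
  have c1 := D.cases (0, j)
  have c2 := D.cases (1, j)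
  have c3 := D.cases (l, j)
  have c4 := D.cases (l - 2, j)
  rcases l with _ | _ | _ | _ | l <;>
  simp [relevel, after, swp, Equiv.swap_apply_def, stack, idMap] <;> grind

theorem Diagram.comp_id {w w' : List Letter} (D : Diagram w w') : D.comp (Diagram.id w') = D := by
  apply Diagram.ext
  simp only [Diagram.comp, Diagram.glued_id]
  funext ⟨l, j⟩
  have c1 := D.cases (0, j)
  have c2 := D.cases (1, j)
  have c3 := D.cases (l, j)
  rcases l with _ | _ | _ | _ | l <;>
  simp [relevel, after, swp, Equiv.swap_apply_def, stack, idMap] <;> grind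

/-- An auxiliary renumbering of levels. -/
def permL : Equiv.Perm ℕ where
  toFun n := if n = 1 then 4 else if n = 2 then 5 else if n = 3 then 1 else if n = 4 then 2
    else if n = 5 then 3 else n
  invFun n := if n = 4 then 1 else if n = 5 then 2 else if n = 1 then 3 else if n = 2 then 4
    else if n = 3 then 5 else n
  left_inv n := by grind
  right_inv n := by grind

theorem Diagram.stack_preserves {w w' w'' : List Letter} (D : Diagram w w') (E : Diagram w' w'')
    (x : Pt) (hx : x.1 < 4) : (stack 2 D.σ E.σ x).1 < 4 := by
  have := D.lt_two x
  have := E.lt_two (x.1 - 2, x.2)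
  unfold stack
  grind

theorem Diagram.glued_spec {w w' w'' : List Letter} (D : Diagram w w') (E : Diagram w' w'')
    (x : Pt) : ((D.glued E).σ x = x ∧ x.1 ≠ 0 ∧ x.1 ≠ 3 ) ∨
      ((x.1 = 0 ∨ x.1 = 3) ∧ (((D.glued E).σ x).1 = 0 ∨ ((D.glued E).σ x).1 = 3)) := by
  have h := D.planar_glued E
  have h1 := h.invol
  have h2 : ∀ x : Pt, x.1 ≠ 0 → x.1 ≠ 3 → (D.glued E).σ x = x := by
    intro x h0 h3
    apply h.fixed
    have := @dir_of_ge w' w'' (x.1 - 2, x.2)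
    unfold stackDir
    grind
  have := h2 x
  have := h2 ((D.glued E).σ x)
  grind

theorem Diagram.comp_assoc_left {w₁ w₂ w₃ w₄ : List Letter} (D : Diagram w₁ w₂)
    (E : Diagram w₂ w₃) (F : Diagram w₃ w₄) :
    ((D.comp E).comp F).σ = relevel (Equiv.swap 1 3 * permL)
      (glue 3 w₃ 0 (glue 1 w₂ 0 ⟨stack 2 D.σ (stack 2 E.σ F.σ), 0⟩)).σ ∧
    (D.glued E).loops + ((D.comp E).glued F).loops =
      (glue 3 w₃ 0 (glue 1 w₂ 0 ⟨stack 2 D.σ (stack 2 E.σ F.σ), 0⟩)).loops := by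
  have e1 := glue_stack_left (m := 4) (l := 1) (i := 0) (cs := w₂) (T := ⟨stack 2 D.σ E.σ, 0⟩)
    (τ := F.σ) (by simp) (D.stack_preserves E)
  have e2 : stack 2 (D.comp E).σ F.σ = relevel permL (stack 4 (D.glued E).σ F.σ) := by
    funext ⟨l, j⟩
    have c1 := D.glued_spec E (0, j)
    have c2 := D.glued_spec E (3, j)
    have c3 := D.glued_spec E (1, j)
    have c4 := D.glued_spec E (2, j)
    have c5 := F.cases (0, j)
    have c6 := F.cases (1, j)
    have c7 := F.cases (l - 2, j)
    have c8 := F.cases (l - 4, j)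
    rcases l with _ | _ | _ | _ | _ | _ | l <;>
    simp [stack, relevel, Diagram.comp, Equiv.swap_apply_def, permL] <;> grind
  have e3 := glue_relevel permL (l := 3) (l' := 1) (i := 0) (cs := w₃)
    (T := ⟨stack 4 (D.glued E).σ F.σ, 0⟩) (by simp [permL]) (by simp [permL])
  rw [← e2] at e3
  rw [stack_assoc, e1, glue_loops]
  change glue 1 w₃ 0 _ = _ at e3
  constructor
  · rw [← relevel_relevel]
    change relevel _ (glue 1 w₃ 0 ⟨stack 2 (D.comp E).σ F.σ, 0⟩).σ = _
    rw [e3]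
    rfl
  · change _ + (glue 1 w₃ 0 ⟨stack 2 (D.comp E).σ F.σ, 0⟩).loops = _
    rw [e3, add_comm]
    rfl

theorem Diagram.comp_assoc_right {w₁ w₂ w₃ w₄ : List Letter} (D : Diagram w₁ w₂)
    (E : Diagram w₂ w₃) (F : Diagram w₃ w₄) :
    (D.comp (E.comp F)).σ = relevel (Equiv.swap 1 3 * Equiv.swap 3 5)
      (glue 1 w₂ 0 (glue 3 w₃ 0 ⟨stack 2 D.σ (stack 2 E.σ F.σ), 0⟩)).σ ∧
    (E.glued F).loops + (D.glued (E.comp F)).loops =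
      (glue 1 w₂ 0 (glue 3 w₃ 0 ⟨stack 2 D.σ (stack 2 E.σ F.σ), 0⟩)).loops := by
  have e1 := glue_stack_right (m := 2) (l := 1) (i := 0) (cs := w₃) (T := ⟨stack 2 E.σ F.σ, 0⟩)
    (σ := D.σ) D.lt_two
  have e2 : stack 2 D.σ (E.comp F).σ = relevel (Equiv.swap 3 5) (stack 2 D.σ (E.glued F).σ) := by
    funext ⟨l, j⟩
    have c0 := D.cases (l, j)
    have c1 := E.glued_spec F (0, j)
    have c2 := E.glued_spec F (3, j)
    have c3 := E.glued_spec F (1, j)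
    have c4 := E.glued_spec F (l - 2, j)
    rcases l with _ | _ | _ | _ | _ | _ | l <;>
    simp [stack, relevel, Diagram.comp, Equiv.swap_apply_def] <;> grind
  have e3 := glue_relevel (Equiv.swap 3 5) (l := 1) (l' := 1) (i := 0) (cs := w₂)
    (T := ⟨stack 2 D.σ (E.glued F).σ, 0⟩) (by simp [Equiv.swap_apply_def])
      (by simp [Equiv.swap_apply_def])
  rw [← e2] at e3
  change glue 1 w₂ 0 _ = _ at e3
  change glue 3 _ _ _ = _ at e1
  rw [e1, glue_loops]
  constructor
  · rw [← relevel_relevel]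
    change relevel _ (glue 1 w₂ 0 ⟨stack 2 D.σ (E.comp F).σ, 0⟩).σ = _
    rw [e3]
    rfl
  · change _ + (glue 1 w₂ 0 ⟨stack 2 D.σ (E.comp F).σ, 0⟩).loops = _
    rw [e3, add_comm]
    rfl

theorem Diagram.assoc_aux {w₁ w₂ w₃ w₄ : List Letter} (D : Diagram w₁ w₂)
    (E : Diagram w₂ w₃) (F : Diagram w₃ w₄) :
    (D.comp E).comp F = D.comp (E.comp F) ∧
    (D.glued E).loops + ((D.comp E).glued F).loops =
      (E.glued F).loops + (D.glued (E.comp F)).loops := by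
  obtain ⟨l1, l2⟩ := D.comp_assoc_left E F
  obtain ⟨r1, r2⟩ := D.comp_assoc_right E F
  have hP : IsPlanar (stackDir 2 (dir w₁ w₂) (stackDir 2 (dir w₂ w₃) (dir w₃ w₄)))
      (stack 2 D.σ (stack 2 E.σ F.σ)) :=
    D.planar.stack rfl (E.planar_stack F) dir_of_ge
  have hr1 : Ready (stackDir 2 (dir w₁ w₂) (stackDir 2 (dir w₂ w₃) (dir w₃ w₄))) 1 0 w₂ := by
    refine ⟨rfl, by simp, ?_, ?_⟩ <;> intro j <;> simp [stackDir, dir]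
  have hr2 : Ready (stackDir 2 (dir w₁ w₂) (stackDir 2 (dir w₂ w₃) (dir w₃ w₄))) 3 0 w₃ := by
    refine ⟨rfl, by simp, ?_, ?_⟩ <;> intro j <;> simp [stackDir, dir]
  have hc := glue_comm (T := ⟨stack 2 D.σ (stack 2 E.σ F.σ), 0⟩) hP hr1 hr2 (by simp)
  rw [l2, r2, hc]
  refine ⟨?_, rfl⟩
  apply Diagram.ext
  rw [l1, r1, hc]
  have hQ := IsPlanar.glue (T := ⟨stack 2 D.σ (stack 2 E.σ F.σ), 0⟩) hP hr2
  have hr1' : Ready (fun x => if x.1 = 3 ∨ x.1 = 3 + 1 then none else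
      stackDir 2 (dir w₁ w₂) (stackDir 2 (dir w₂ w₃) (dir w₃ w₄)) x) 1 0 w₂ := by
    refine ⟨rfl, by simp, ?_, ?_⟩ <;> intro j <;> simp [stackDir, dir]
  have hR := hQ.glue hr1'
  have hfix : ∀ x : Pt, x.1 ∉ ({0, 5} : Set ℕ) →
      (glue 1 w₂ 0 (glue 3 w₃ 0 ⟨stack 2 D.σ (stack 2 E.σ F.σ), 0⟩)).σ x = x := by
    intro x hx
    apply hR.fixed
    simp at hx
    unfold stackDir dir
    grind
  refine relevel_congr _ _ (S := {0, 5}) hfix ?_ ?_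
  · intro x hx
    by_contra hc
    have h1 := hfix _ hc
    rw [hR.invol] at h1
    exact hc (h1 ▸ hx)
  · intro a ha
    simp at ha
    rcases ha with rfl | rfl <;> simp [permL, Equiv.swap_apply_def]

/-- Horizontal juxtaposition: `σ` on the first `n l` points of each level `l`, then `τ`. -/
def juxt (n : ℕ → ℕ) (σ τ : Pt → Pt) (x : Pt) : Pt :=
  if x.2 < n x.1 then σ x
  else ((τ (x.1, x.2 - n x.1)).1, (τ (x.1, x.2 - n x.1)).2 + n (τ (x.1, x.2 - n x.1)).1)

/-- Directions of juxtaposed strings. -/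
def juxtDir (n : ℕ → ℕ) (d e : Pt → Option Bool) (x : Pt) : Option Bool :=
  if x.2 < n x.1 then d x else e (x.1, x.2 - n x.1)

theorem before_cross {n : ℕ → ℕ} (x y : Pt) (h1 : x.1 < 2) (h2 : y.1 < 2) (h3 : x.2 < n x.1)
    (h4 : n y.1 ≤ y.2) : before x y ↔ x.1 = 0 := by
  rcases x with ⟨_ | _ | a, b⟩ <;> rcases y with ⟨_ | _ | a', b'⟩ <;> simp [before] at * <;> omega

theorem before_cross' {n : ℕ → ℕ} (x y : Pt) (h1 : x.1 < 2) (h2 : y.1 < 2) (h3 : x.2 < n x.1)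
    (h4 : n y.1 ≤ y.2) : before y x ↔ x.1 = 1 := by
  rcases x with ⟨_ | _ | a, b⟩ <;> rcases y with ⟨_ | _ | a', b'⟩ <;> simp [before] at * <;> omega

theorem IsPlanar.juxt {n : ℕ → ℕ} {d e : Pt → Option Bool} {σ τ : Pt → Pt}
    (h : IsPlanar d σ) (h' : IsPlanar e τ) (hd : ∀ x : Pt, d x ≠ none → x.2 < n x.1)
    (hl : ∀ x : Pt, 2 ≤ x.1 → d x = none ∧ e x = none) :
    IsPlanar (juxtDir n d e) (juxt n σ τ) := by
  have i1 := h.invol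
  have i2 := h'.invol
  have f1 : ∀ x : Pt, n x.1 ≤ x.2 → σ x = x := fun x hx => by
    apply h.fixed
    by_contra hc
    have := hd x hc
    omega
  have lv : ∀ x : Pt, x.2 < n x.1 → (σ x).2 < n (σ x).1 := by grind
  refine ⟨?_, ?_, ?_, ?_⟩
  · intro x
    unfold OrientedKauffman.juxt
    grind
  · intro x
    have := h.fixed x
    have := h'.fixed (x.1, x.2 - n x.1)
    unfold OrientedKauffman.juxt juxtDir
    grind
  · intro x
    have := h.orient x
    have := h'.orient (x.1, x.2 - n x.1)
    unfold OrientedKauffman.juxt juxtDir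
    grind
  · intro x y b1 b2 b3
    have g1 : ∀ x : Pt, 2 ≤ x.1 → σ x = x := fun x hx => h.fixed x (hl x hx).1
    have g2 : ∀ x : Pt, 2 ≤ x.1 → τ x = x := fun x hx => h'.fixed x (hl x hx).2
    have g1' : ∀ x : Pt, x.1 < 2 → (σ x).1 < 2 := by grind
    have g2' : ∀ x : Pt, x.1 < 2 → (τ x).1 < 2 := by grind
    have tr := @before_trans
    have ir := @before_irrefl
    have hx2 : x.1 < 2 := by
      by_contra hc
      have := g1 x
      have := g2 (x.1, x.2 - n x.1)
      unfold OrientedKauffman.juxt at *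
      grind
    have hy2 : y.1 < 2 := by
      by_contra hc
      have := g1 y
      have := g2 (y.1, y.2 - n y.1)
      unfold OrientedKauffman.juxt at *
      grind
    have sh : ∀ x y : Pt, before (x.1, x.2 + n x.1) (y.1, y.2 + n y.1) ↔ before x y := by
      intro x y
      unfold before
      grind
    have cr := @before_cross n
    have cr' := @before_cross' n
    by_cases hx : x.2 < n x.1 <;> by_cases hy : y.2 < n y.1
    · simp only [OrientedKauffman.juxt, if_pos hx, if_pos hy] at *
      exact h.noncross x y b1 b2 b3
    · simp only [OrientedKauffman.juxt, if_pos hx, if_neg hy] at *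
      have q1 := cr' (σ x) y
      have q2 := cr (σ x) ((τ (y.1, y.2 - n y.1)).1,
        (τ (y.1, y.2 - n y.1)).2 + n (τ (y.1, y.2 - n y.1)).1)
      have := g2' (y.1, y.2 - n y.1)
      grind
    · simp only [OrientedKauffman.juxt, if_neg hx, if_pos hy] at *
      have q1 := cr' y x
      have q2 := cr y ((τ (x.1, x.2 - n x.1)).1,
        (τ (x.1, x.2 - n x.1)).2 + n (τ (x.1, x.2 - n x.1)).1)
      have := g2' (x.1, x.2 - n x.1)
      grind
    · simp only [OrientedKauffman.juxt, if_neg hx, if_neg hy] at *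
      have e1 : x = ((x.1, x.2 - n x.1).1, (x.1, x.2 - n x.1).2 + n (x.1, x.2 - n x.1).1) := by
        ext <;> simp; omega
      have e2 : y = ((y.1, y.2 - n y.1).1, (y.1, y.2 - n y.1).2 + n (y.1, y.2 - n y.1).1) := by
        ext <;> simp; omega
      rw [sh] at b3
      refine h'.noncross _ _ ?_ ?_ b3
      · rwa [← sh, ← e1, ← e2]
      · rwa [← sh, ← e2]

/-- Numbers of points on the two lines of a diagram. -/
def lens (u v : List Letter) (l : ℕ) : ℕ := if l = 0 then u.length else if l = 1 then v.length else 0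

theorem juxtDir_dir (u u' v v' : List Letter) :
    juxtDir (lens u u') (dir u u') (dir v v') = dir (u ++ v) (u' ++ v') := by
  funext x
  unfold juxtDir lens dir
  grind

/-- Horizontal juxtaposition of diagrams. -/
def Diagram.tensor {u u' v v' : List Letter} (D : Diagram u u') (E : Diagram v v') :
    Diagram (u ++ v) (u' ++ v') where
  σ := juxt (lens u u') D.σ E.σ
  planar := by
    rw [← juxtDir_dir]
    refine D.planar.juxt E.planar ?_ fun x hx => ⟨dir_of_ge x hx, dir_of_ge x hx⟩
    intro x hx
    unfold dir at hx
    unfold lens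
    grind

theorem glue_append (l : ℕ) (cs cs' : List Letter) (i : ℕ) (T : Tangle) :
    glue l (cs ++ cs') i T = glue l cs' (i + cs.length) (glue l cs i T) := by
  induction cs generalizing i T with
  | nil => rfl
  | cons c cs ih =>
    simp only [List.cons_append, glue]
    rw [ih]
    congr 1
    simp
    omega

theorem glue_juxt_left {n : ℕ → ℕ} {l i : ℕ} {cs : List Letter} {T : Tangle} {τ : Pt → Pt}
    (h1 : i + cs.length ≤ n l) (h2 : i + cs.length ≤ n (l + 1))
    (hT : ∀ x : Pt, x.2 < n x.1 → (T.σ x).2 < n (T.σ x).1) :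
    glue l cs i ⟨juxt n T.σ τ, T.loops⟩ =
      ⟨juxt n (glue l cs i T).σ τ, (glue l cs i T).loops⟩ := by
  induction cs generalizing i T with
  | nil => rfl
  | cons c cs ih =>
    simp only [glue]
    simp at h1 h2
    have e : glueStep l i c ⟨juxt n T.σ τ, T.loops⟩ =
        ⟨juxt n (glueStep l i c T).σ τ, (glueStep l i c T).loops⟩ := by
      unfold glueStep
      congr 1
      · funext x
        have := hT x
        have := hT (l, i)
        have := hT (l + 1, i)
        unfold juxt join
        grind
      · unfold juxt
        grind
    rw [e]
    apply ih
    · omega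
    · omega
    · intro x hx
      have := hT x
      have := hT (l, i)
      have := hT (l + 1, i)
      unfold glueStep join
      grind

theorem glue_juxt_right {n : ℕ → ℕ} {l i k : ℕ} {cs : List Letter} {T : Tangle} {σ : Pt → Pt}
    (h1 : n l = k) (h2 : n (l + 1) = k)
    (hT : ∀ x : Pt, x.2 < n x.1 → (σ x).2 < n (σ x).1) :
    glue l cs (k + i) ⟨juxt n σ T.σ, T.loops⟩ =
      ⟨juxt n σ (glue l cs i T).σ, (glue l cs i T).loops⟩ := by
  let sh : Pt → Pt := fun y => (y.1, y.2 + n y.1)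
  have hs : Function.Injective sh := by
    rintro ⟨a, b⟩ ⟨c, d⟩ h
    simp only [sh, Prod.mk.injEq] at h
    obtain ⟨rfl, h⟩ := h
    simp at h
    rw [h]
  induction cs generalizing i T with
  | nil => rfl
  | cons c cs ih =>
    simp only [glue]
    have e : glueStep l (k + i) c ⟨juxt n σ T.σ, T.loops⟩ =
        ⟨juxt n σ (glueStep l i c T).σ, (glueStep l i c T).loops⟩ := by
      unfold glueStep
      congr 1
      · funext x
        change join (l, k + i) (l + 1, k + i) (juxt n σ T.σ) x =
          juxt n σ (join (l, i) (l + 1, i) T.σ) x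
        have a1 : juxt n σ T.σ (l, k + i) = sh (T.σ (l, i)) := by simp [juxt, sh, h1]
        have a2 : juxt n σ T.σ (l + 1, k + i) = sh (T.σ (l + 1, i)) := by simp [juxt, sh, h2]
        have b1 : (l, k + i) = sh (l, i) := by simp [sh, h1, add_comm]
        have b2 : (l + 1, k + i) = sh (l + 1, i) := by simp [sh, h2, add_comm]
        by_cases hx : x.2 < n x.1
        · have a3 : ∀ ρ, juxt n σ ρ x = σ x := fun ρ => by simp [juxt, hx]
          have c1 : x ≠ (l, k + i) := by grind
          have c2 : x ≠ (l + 1, k + i) := by grind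
          have c3 : σ x ≠ (l, k + i) := by grind
          have c4 : σ x ≠ (l + 1, k + i) := by grind
          rw [join, a3, a3]
          simp [c1, c2, c3, c4]
        · obtain ⟨z, rfl⟩ : ∃ z, x = sh z := ⟨(x.1, x.2 - n x.1), by
            ext <;> simp [sh]; omega⟩
          have a3 : ∀ ρ, juxt n σ ρ (sh z) = sh (ρ z) := fun ρ => by simp [juxt, sh]
          rw [join, a3, a3, a1, a2, b1, b2, join]
          simp only [hs.eq_iff]
          grind
      · have a1 : juxt n σ T.σ (l, k + i) = sh (T.σ (l, i)) := by simp [juxt, sh, h1]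
        have b2 : (l + 1, k + i) = sh (l + 1, i) := by simp [sh, h2, add_comm]
        simp only [a1, b2, hs.eq_iff]
    rw [e]
    exact ih (i := i + 1)

theorem IsPlanar.region {dir : Pt → Option Bool} {σ : Pt → Pt} (h : IsPlanar dir σ) (n : ℕ → ℕ)
    (hn : ∀ x, dir x ≠ none → x.2 < n x.1) (x : Pt) (hx : x.2 < n x.1) :
    (σ x).2 < n (σ x).1 := by
  by_cases hd : dir x = none
  · rwa [h.fixed x hd]
  · apply hn
    rw [h.orient]
    simpa using hd

/-- Numbers of points on the four lines of two stacked diagrams. -/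
def lens4 (w w' w'' : List Letter) (l : ℕ) : ℕ :=
  if l = 0 then w.length else if l = 1 then w'.length else if l = 2 then w'.length
  else if l = 3 then w''.length else 0

theorem stackDir_region (w w' w'' : List Letter) (x : Pt)
    (h : stackDir 2 (dir w w') (dir w' w'') x ≠ none) : x.2 < lens4 w w' w'' x.1 := by
  rcases x with ⟨l, j⟩
  rcases l with _ | _ | _ | _ | l <;> simp [stackDir, dir, lens4] at * <;> exact h

theorem Diagram.tensor_stack {u u' u'' v v' v'' : List Letter} (D : Diagram u u')
    (D' : Diagram u' u'') (E : Diagram v v') (E' : Diagram v' v'') :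
    stack 2 (D.tensor E).σ (D'.tensor E').σ =
      juxt (lens4 u u' u'') (stack 2 D.σ D'.σ) (stack 2 E.σ E'.σ) := by
  funext ⟨l, j⟩
  simp only [Diagram.tensor]
  have c3 := E.lt_two (l, j - lens u u' l)
  have c4 := E'.lt_two (l - 2, j - lens u' u'' (l - 2))
  have c5 : ∀ j, E'.σ (l - 2, j) = (l - 2, j) ∨ l - 2 < 2 := by
    intro j
    have := E'.planar.fixed (l - 2, j)
    have := @dir_of_ge v' v'' (l - 2, j)
    grind
  rcases l with _ | _ | _ | _ | l
  · simp [stack, juxt, lens, lens4] at *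
    grind
  · simp [stack, juxt, lens, lens4] at *
    grind
  · simp [stack, juxt, lens, lens4] at *
    grind
  · simp [stack, juxt, lens, lens4] at *
    grind
  · simp [stack, juxt, lens, lens4] at *

theorem Diagram.tensor_glued {u u' u'' v v' v'' : List Letter} (D : Diagram u u')
    (D' : Diagram u' u'') (E : Diagram v v') (E' : Diagram v' v'') :
    (D.tensor E).glued (D'.tensor E') =
      ⟨juxt (lens4 u u' u'') (D.glued D').σ (E.glued E').σ,
        (D.glued D').loops + (E.glued E').loops⟩ := by
  have reg := (D.planar_stack D').region (lens4 u u' u'') (stackDir_region u u' u'')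
  have reg' := (D.planar_glued D').region (lens4 u u' u'') (by
    intro x hx
    apply stackDir_region u u' u''
    grind)
  have e2 := glue_juxt_left (n := lens4 u u' u'') (l := 1) (i := 0) (cs := u')
    (T := ⟨stack 2 D.σ D'.σ, 0⟩) (τ := stack 2 E.σ E'.σ) (by simp [lens4]) (by simp [lens4]) reg
  have e3 := glue_juxt_right (n := lens4 u u' u'') (l := 1) (i := 0) (cs := v') (k := u'.length)
    (T := ⟨stack 2 E.σ E'.σ, 0⟩) (σ := (D.glued D').σ) (by simp [lens4]) (by simp [lens4]) reg'
  change glue 1 (u' ++ v') 0 ⟨stack 2 (D.tensor E).σ (D'.tensor E').σ, 0⟩ = _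
  rw [D.tensor_stack, glue_append]
  change glue 1 u' 0 ⟨juxt _ (stack 2 D.σ D'.σ) _, 0⟩ = _ at e2
  rw [e2, glue_loops, Nat.zero_add]
  change glue 1 v' u'.length ⟨juxt _ (D.glued D').σ _, 0⟩ = _ at e3
  change Tangle.mk (glue 1 v' u'.length ⟨juxt _ (D.glued D').σ _, 0⟩).σ
    ((glue 1 v' u'.length ⟨juxt _ (D.glued D').σ _, 0⟩).loops + _) = _
  rw [e3, add_comm]
  rfl

theorem Diagram.tensor_comp {u u' u'' v v' v'' : List Letter} (D : Diagram u u')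
    (D' : Diagram u' u'') (E : Diagram v v') (E' : Diagram v' v'') :
    (D.tensor E).comp (D'.tensor E') = (D.comp D').tensor (E.comp E') := by
  apply Diagram.ext
  simp only [Diagram.comp, Diagram.tensor_glued]
  funext ⟨l, j⟩
  simp only [Diagram.tensor]
  have c1 := fun j => E.glued_spec E' (0, j)
  have c2 := fun j => E.glued_spec E' (1, j)
  have c3 := fun j => E.glued_spec E' (2, j)
  have c4 := fun j => E.glued_spec E' (3, j)
  have c5 := fun j => E.glued_spec E' (l, j)
  have d2 := D.glued_spec D' (1, j)
  have d3 := D.glued_spec D' (2, j)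
  have d5 := D.glued_spec D' (l, j)
  rcases l with _ | _ | _ | _ | l
  · simp [relevel, juxt, Equiv.swap_apply_def, lens, lens4] at *
    grind
  · simp [relevel, juxt, Equiv.swap_apply_def, lens, lens4] at *
    grind
  · simp [relevel, juxt, Equiv.swap_apply_def, lens, lens4] at *
    grind
  · simp [relevel, juxt, Equiv.swap_apply_def, lens, lens4] at *
    grind
  · simp [relevel, juxt, Equiv.swap_apply_def, lens, lens4] at *
    grind

theorem Diagram.tensor_id (u v : List Letter) :
    (Diagram.id u).tensor (Diagram.id v) = Diagram.id (u ++ v) := by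
  apply Diagram.ext
  funext x
  simp only [Diagram.tensor, Diagram.id, juxt, idMap, lens]
  grind

theorem Diagram.tensor_assoc {u u' v v' w w' : List Letter} (D : Diagram u u')
    (E : Diagram v v') (F : Diagram w w') :
    ((D.tensor E).tensor F).σ = (D.tensor (E.tensor F)).σ := by
  funext ⟨l, j⟩
  simp only [Diagram.tensor, juxt, lens]
  grind

theorem Diagram.id_nil_tensor {u u' : List Letter} (D : Diagram u u') :
    ((Diagram.id []).tensor D).σ = D.σ := by
  funext x
  simp [Diagram.tensor, juxt, lens]

theorem Diagram.tensor_id_nil {u u' : List Letter} (D : Diagram u u') :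
    (D.tensor (Diagram.id [])).σ = D.σ := by
  funext x
  have c := D.cases x
  simp only [Diagram.tensor, Diagram.id, juxt, idMap, lens]
  grind

/-- Objects of the tensor category `O_{dL,dR}`: words in the letters `X` and `X^*`. -/
structure OCat (dL dR : ℂˣ) where
  word : List Letter

/-- The scalar replacing closed loops: `dR` for each clockwise loop, `dL` for each anticlockwise loop.
A string passes downwards through a gluing point with letter `X` and upwards through one with letter
`X^*`; so a loop is clockwise exactly when its rightmost gluing point carries `X`. -/
noncomputable def weight (dL dR : ℂˣ) (L : Multiset Letter) : ℂ :=
  (L.map fun c => if c = Letter.X then (dR : ℂ) else (dL : ℂ)).prod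

theorem weight_add (dL dR : ℂˣ) (L M : Multiset Letter) :
    weight dL dR (L + M) = weight dL dR L * weight dL dR M := by
  simp [weight]

/-- Composition, extended bilinearly to linear combinations of diagrams. -/
noncomputable def compHom (dL dR : ℂˣ) (u v w : List Letter) :
    (Diagram u v →₀ ℂ) →ₗ[ℂ] (Diagram v w →₀ ℂ) →ₗ[ℂ] (Diagram u w →₀ ℂ) :=
  Finsupp.linearCombination ℂ fun D => Finsupp.linearCombination ℂ fun E =>
    Finsupp.single (D.comp E) (weight dL dR (D.glued E).loops)

/-- Tensor product, extended bilinearly to linear combinations of diagrams. -/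
noncomputable def tensHom (u u' v v' : List Letter) :
    (Diagram u u' →₀ ℂ) →ₗ[ℂ] (Diagram v v' →₀ ℂ) →ₗ[ℂ] (Diagram (u ++ v) (u' ++ v') →₀ ℂ) :=
  Finsupp.linearCombination ℂ fun D => Finsupp.linearCombination ℂ fun E =>
    Finsupp.single (D.tensor E) 1

theorem compHom_single {dL dR : ℂˣ} (u v w : List Letter) (D : Diagram u v) (E : Diagram v w) (a b : ℂ) :
    compHom dL dR u v w (Finsupp.single D a) (Finsupp.single E b) =
      Finsupp.single (D.comp E) (a * b * weight dL dR (D.glued E).loops) := by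
  simp only [compHom, Finsupp.linearCombination_single, LinearMap.smul_apply, Finsupp.smul_single,
    smul_eq_mul, mul_assoc]

theorem tensHom_single (u u' v v' : List Letter) (D : Diagram u u') (E : Diagram v v') (a b : ℂ) :
    tensHom u u' v v' (Finsupp.single D a) (Finsupp.single E b) =
      Finsupp.single (D.tensor E) (a * b) := by
  simp only [tensHom, Finsupp.linearCombination_single, LinearMap.smul_apply, Finsupp.smul_single,
    smul_eq_mul, mul_one]

/-- Morphisms are the formal complex linear combinations of oriented Kauffman diagrams. -/
noncomputable instance {dL dR : ℂˣ} : Category (OCat dL dR) where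
  Hom A B := Diagram A.word B.word →₀ ℂ
  id A := Finsupp.single (Diagram.id A.word) 1
  comp {A B C} f g := compHom dL dR A.word B.word C.word f g
  id_comp {A B} f := by
    induction f using Finsupp.induction_linear with
    | zero => simp
    | add f g hf hg => rw [map_add, hf, hg]
    | single D a => simp [compHom_single, Diagram.id_comp, Diagram.id_glued, weight]
  comp_id {A B} f := by
    induction f using Finsupp.induction_linear with
    | zero => simp
    | add f g hf hg => rw [map_add, LinearMap.add_apply, hf, hg]
    | single D a => simp [compHom_single, Diagram.comp_id, Diagram.glued_id, weight]
  assoc {A B C D} f g h := by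
    induction f using Finsupp.induction_linear with
    | zero => simp
    | add f f' hf hf' => simp only [map_add, LinearMap.add_apply, hf, hf']
    | single E a =>
      induction g using Finsupp.induction_linear with
      | zero => simp
      | add f f' hf hf' => simp only [map_add, LinearMap.add_apply, hf, hf']
      | single F b =>
        induction h using Finsupp.induction_linear with
        | zero => simp
        | add f f' hf hf' => simp only [map_add, hf, hf']
        | single G c =>
          obtain ⟨h1, h2⟩ := E.assoc_aux F G
          have h3 := congrArg (weight dL dR) h2
          rw [weight_add, weight_add] at h3
          simp only [compHom_single, h1]
          congr 1
          linear_combination a * b * c * h3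

noncomputable instance {dL dR : ℂˣ} (A B : OCat dL dR) : AddCommGroup (A ⟶ B) :=
  inferInstanceAs (AddCommGroup (Diagram A.word B.word →₀ ℂ))

noncomputable instance {dL dR : ℂˣ} (A B : OCat dL dR) : Module ℂ (A ⟶ B) :=
  inferInstanceAs (Module ℂ (Diagram A.word B.word →₀ ℂ))

noncomputable instance {dL dR : ℂˣ} : Preadditive (OCat dL dR) where
  add_comp A B C f f' g := by
    change compHom dL dR _ _ _ (f + f') g = compHom dL dR _ _ _ f g + compHom dL dR _ _ _ f' g
    simp
  comp_add A B C f g g' := by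
    change compHom dL dR _ _ _ f (g + g') = compHom dL dR _ _ _ f g + compHom dL dR _ _ _ f g'
    simp

noncomputable instance {dL dR : ℂˣ} : Linear ℂ (OCat dL dR) where
  smul_comp A B C r f g := by
    change compHom dL dR _ _ _ (r • f) g = r • compHom dL dR _ _ _ f g
    simp
  comp_smul A B C f r g := by
    change compHom dL dR _ _ _ f (r • g) = r • compHom dL dR _ _ _ f g
    simp

/-- Tensor product of morphisms. -/
noncomputable def tensMap {dL dR : ℂˣ} {A B C D : OCat dL dR} (f : A ⟶ B) (g : C ⟶ D) :
    (⟨A.word ++ C.word⟩ : OCat dL dR) ⟶ ⟨B.word ++ D.word⟩ :=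
  tensHom A.word B.word C.word D.word f g

theorem single_comp_eqToHom {dL dR : ℂˣ} {A B C : OCat dL dR} (D : Diagram A.word B.word) (a : ℂ) (h : B = C)
    (D' : Diagram A.word C.word) (hD : D.σ = D'.σ) :
    (Finsupp.single D a : A ⟶ B) ≫ eqToHom h = (Finsupp.single D' a : A ⟶ C) := by
  subst h
  rw [eqToHom_refl, Category.comp_id, Diagram.ext hD]

theorem eqToHom_comp_single {dL dR : ℂˣ} {A B C : OCat dL dR} (D : Diagram B.word C.word) (a : ℂ) (h : A = B)
    (D' : Diagram A.word C.word) (hD : D.σ = D'.σ) :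
    eqToHom h ≫ (Finsupp.single D a : B ⟶ C) = (Finsupp.single D' a : A ⟶ C) := by
  subst h
  rw [eqToHom_refl, Category.id_comp, Diagram.ext hD]

theorem tensMap_id {dL dR : ℂˣ} (A B : OCat dL dR) : tensMap (𝟙 A) (𝟙 B) = 𝟙 _ := by
  change tensHom _ _ _ _ (Finsupp.single (Diagram.id A.word) 1) (Finsupp.single (Diagram.id B.word) 1)
    = Finsupp.single (Diagram.id (A.word ++ B.word)) 1
  rw [tensHom_single, Diagram.tensor_id, one_mul]

theorem tensMap_comp {dL dR : ℂˣ} {A B C A' B' C' : OCat dL dR} (f : A ⟶ B) (f' : A' ⟶ B') (g : B ⟶ C)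
    (g' : B' ⟶ C') : tensMap f f' ≫ tensMap g g' = tensMap (f ≫ g) (f' ≫ g') := by
  change compHom dL dR _ _ _ (tensHom _ _ _ _ f f') (tensHom _ _ _ _ g g') =
    tensHom _ _ _ _ (compHom dL dR _ _ _ f g) (compHom dL dR _ _ _ f' g')
  induction f using Finsupp.induction_linear with
  | zero => simp
  | add f g hf hg => simp only [map_add, LinearMap.add_apply, hf, hg]
  | single D a =>
    induction f' using Finsupp.induction_linear with
    | zero => simp
    | add f g hf hg => simp only [map_add, LinearMap.add_apply, hf, hg]
    | single D' a' =>
      induction g using Finsupp.induction_linear with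
      | zero => simp
      | add f g hf hg => simp only [map_add, LinearMap.add_apply, hf, hg]
      | single E b =>
        induction g' using Finsupp.induction_linear with
        | zero => simp
        | add f g hf hg => simp only [map_add, hf, hg]
        | single E' b' =>
          simp only [tensHom_single, compHom_single, Diagram.tensor_comp, Diagram.tensor_glued,
            weight_add]
          congr 1
          ring

theorem tensMap_eqToHom {dL dR : ℂˣ} {A B A' B' : OCat dL dR} (h : A = B) (h' : A' = B') :
    tensMap (eqToHom h) (eqToHom h') = eqToHom (by rw [h, h']) := by
  subst h h'
  simp only [eqToHom_refl, tensMap_id]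

theorem comp_linear {dL dR : ℂˣ} {A B C : OCat dL dR} (f : A ⟶ B) (g : B ⟶ C) :
    f ≫ g = compHom dL dR A.word B.word C.word f g := rfl

/-- A diagram, its type being rewritten along equalities of words. -/
def Diagram.cast {u u' v v' : List Letter} (h : u = u') (h' : v = v') (D : Diagram u v) :
    Diagram u' v' :=
  ⟨D.σ, by subst h h'; exact D.planar⟩

theorem tensMap_assoc {dL dR : ℂˣ} {A B A' B' A'' B'' : OCat dL dR} (f : A ⟶ B) (f' : A' ⟶ B')
    (f'' : A'' ⟶ B'') (h : (⟨(B.word ++ B'.word) ++ B''.word⟩ : OCat dL dR) = ⟨B.word ++ (B'.word ++ B''.word)⟩)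
    (h' : (⟨(A.word ++ A'.word) ++ A''.word⟩ : OCat dL dR) = ⟨A.word ++ (A'.word ++ A''.word)⟩) :
    tensMap (tensMap f f') f'' ≫ eqToHom h = eqToHom h' ≫ tensMap f (tensMap f' f'') := by
  rw [comp_linear, comp_linear]
  unfold tensMap
  induction f using Finsupp.induction_linear with
  | zero => simp
  | add f g hf hg => simp only [map_add, LinearMap.add_apply, hf, hg]
  | single D a =>
    induction f' using Finsupp.induction_linear with
    | zero => simp
    | add f g hf hg => simp only [map_add, LinearMap.add_apply, hf, hg]
    | single E b =>
      induction f'' using Finsupp.induction_linear with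
      | zero => simp
      | add f g hf hg => simp only [map_add, LinearMap.add_apply, hf, hg]
      | single F c =>
        simp only [tensHom_single]
        refine (single_comp_eqToHom (dL := dL) (dR := dR) _ _ h
          (Diagram.cast rfl (List.append_assoc _ _ _) ((D.tensor E).tensor F)) rfl).trans ?_
        refine Eq.trans ?_ (eqToHom_comp_single (dL := dL) (dR := dR) _ _ h'
          (Diagram.cast rfl (List.append_assoc _ _ _) ((D.tensor E).tensor F))
          (D.tensor_assoc E F).symm).symm
        rw [mul_assoc]

theorem tensMap_left {dL dR : ℂˣ} {A B : OCat dL dR} (f : A ⟶ B)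
    (h : (⟨[] ++ B.word⟩ : OCat dL dR) = B) (h' : (⟨[] ++ A.word⟩ : OCat dL dR) = A) :
    tensMap (𝟙 (⟨[]⟩ : OCat dL dR)) f ≫ eqToHom h = eqToHom h' ≫ f := by
  rw [comp_linear, comp_linear]
  unfold tensMap
  change compHom dL dR _ _ _ (tensHom _ _ _ _ (Finsupp.single (Diagram.id []) 1) f) _ = _
  induction f using Finsupp.induction_linear with
  | zero => simp
  | add f g hf hg => simp only [map_add, LinearMap.add_apply, hf, hg]
  | single D a =>
    simp only [tensHom_single]
    refine (single_comp_eqToHom (dL := dL) (dR := dR) _ _ h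
      (Diagram.cast (List.nil_append _).symm rfl D) D.id_nil_tensor).trans ?_
    refine Eq.trans ?_ (eqToHom_comp_single (dL := dL) (dR := dR) _ _ h'
      (Diagram.cast (List.nil_append _).symm rfl D) rfl).symm
    rw [one_mul]

theorem tensMap_right {dL dR : ℂˣ} {A B : OCat dL dR} (f : A ⟶ B)
    (h : (⟨B.word ++ []⟩ : OCat dL dR) = B) (h' : (⟨A.word ++ []⟩ : OCat dL dR) = A) :
    tensMap f (𝟙 (⟨[]⟩ : OCat dL dR)) ≫ eqToHom h = eqToHom h' ≫ f := by
  rw [comp_linear, comp_linear]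
  unfold tensMap
  change compHom dL dR _ _ _ (tensHom _ _ _ _ f (Finsupp.single (Diagram.id []) 1)) _ = _
  induction f using Finsupp.induction_linear with
  | zero => simp
  | add f g hf hg => simp only [map_add, LinearMap.add_apply, hf, hg]
  | single D a =>
    simp only [tensHom_single]
    refine (single_comp_eqToHom (dL := dL) (dR := dR) _ _ h
      (Diagram.cast (List.append_nil _).symm rfl D) D.tensor_id_nil).trans ?_
    refine Eq.trans ?_ (eqToHom_comp_single (dL := dL) (dR := dR) _ _ h'
      (Diagram.cast (List.append_nil _).symm rfl D) rfl).symm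
    rw [mul_one]

noncomputable instance {dL dR : ℂˣ} : MonoidalCategoryStruct (OCat dL dR) where
  tensorObj A B := ⟨A.word ++ B.word⟩
  tensorUnit := ⟨[]⟩
  tensorHom f g := tensMap f g
  whiskerLeft A _ _ f := tensMap (𝟙 A) f
  whiskerRight f B := tensMap f (𝟙 B)
  associator A B C := eqToIso (by simp)
  leftUnitor A := eqToIso (by simp)
  rightUnitor A := eqToIso (by simp)

/-- The strict tensor category `O_{dL,dR}`. -/
noncomputable instance {dL dR : ℂˣ} : MonoidalCategory (OCat dL dR) :=
  MonoidalCategory.ofTensorHom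
    (id_tensorHom_id := fun A B => tensMap_id A B)
    (id_tensorHom := fun _ _ _ _ => rfl)
    (tensorHom_id := fun _ _ => rfl)
    (tensorHom_comp_tensorHom := fun f f' g g' => tensMap_comp f f' g g')
    (associator_naturality := fun f g h => tensMap_assoc f g h
      (congrArg OCat.mk (List.append_assoc _ _ _)) (congrArg OCat.mk (List.append_assoc _ _ _)))
    (leftUnitor_naturality := fun f => tensMap_left f rfl rfl)
    (rightUnitor_naturality := fun f => tensMap_right f
      (congrArg OCat.mk (List.append_nil _)) (congrArg OCat.mk (List.append_nil _)))
    (pentagon := fun A B C D => by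
      simp only [MonoidalCategoryStruct.tensorHom, MonoidalCategoryStruct.associator,
        eqToIso.hom, ← eqToHom_refl _ rfl]
      rw [tensMap_eqToHom, tensMap_eqToHom]
      simp)
    (triangle := fun A B => by
      simp only [MonoidalCategoryStruct.tensorHom, MonoidalCategoryStruct.associator,
        MonoidalCategoryStruct.leftUnitor, MonoidalCategoryStruct.rightUnitor,
        eqToIso.hom, ← eqToHom_refl _ rfl]
      rw [tensMap_eqToHom, tensMap_eqToHom]
      exact eqToHom_trans (C := OCat dL dR) _ _)

/-- The object `X`. -/
def objX (dL dR : ℂˣ) : OCat dL dR := ⟨[.X]⟩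

/-- The object `X^*`. -/
def objXs (dL dR : ℂˣ) : OCat dL dR := ⟨[.Xs]⟩

/-- The string joining the first two points of the upper line. -/
def arcMap (x : Pt) : Pt := if x = (0, 0) then (0, 1) else if x = (0, 1) then (0, 0) else x

/-- The diagram consisting of one arc joining the two points of the upper line. -/
def arc (a b : Letter) (h : a ≠ b) : Diagram [a, b] [] where
  σ := arcMap
  planar := by
    refine ⟨?_, ?_, ?_, ?_⟩
    · intro x
      unfold arcMap
      grind
    · rintro ⟨_ | l, _ | _ | i⟩ <;> simp [arcMap, dir]
    · rintro ⟨_ | l, _ | _ | i⟩ <;> cases a <;> cases b <;> simp [arcMap, dir] at h ⊢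
    · intro x y
      unfold arcMap before
      grind

/-- The basic arc `ε_X : X ⊗ X^* ⟶ I`. -/
noncomputable def epsX (dL dR : ℂˣ) : objX dL dR ⊗ objXs dL dR ⟶ 𝟙_ (OCat dL dR) :=
  Finsupp.single (arc .X .Xs (by decide)) (1 : ℂ)

/-- The basic arc `ε_{X^*} : X^* ⊗ X ⟶ I`. -/
noncomputable def epsXs (dL dR : ℂˣ) : objXs dL dR ⊗ objX dL dR ⟶ 𝟙_ (OCat dL dR) :=
  Finsupp.single (arc .Xs .X (by decide)) (1 : ℂ)

/-- Equivalence of complex linear tensor categories: there is a complex linear (strong) monoidal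
functor that is fully faithful and essentially surjective. -/
def MonoidallyEquivalent (C D : Type*) [Category* C] [Preadditive C] [Linear ℂ C]
    [MonoidalCategory C] [Category* D] [Preadditive D] [Linear ℂ D] [MonoidalCategory D] : Prop :=
  ∃ F : C ⥤ D, Nonempty F.Monoidal ∧ F.Additive ∧ F.Linear ℂ ∧ F.IsEquivalence

/-- The image of a pairing `f : A ⊗ B ⟶ I` under a monoidal functor `F`, viewed as a pairing
`F(A) ⊗ F(B) ⟶ I` by means of the structure isomorphisms of `F`. -/
def pairingImage {C D : Type*} [Category* C] [MonoidalCategory C] [Category* D]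
    [MonoidalCategory D] (F : C ⥤ D) [F.Monoidal] {A B : C} (f : A ⊗ B ⟶ 𝟙_ C) :
    F.obj A ⊗ F.obj B ⟶ 𝟙_ D :=
  Functor.LaxMonoidal.μ F A B ≫ F.map f ≫ Functor.OplaxMonoidal.η F

/-- `F` is strictly monoidal: its structure isomorphisms are identities. -/
def IsStrict {C D : Type*} [Category* C] [MonoidalCategory C] [Category* D]
    [MonoidalCategory D] (F : C ⥤ D) [F.Monoidal] : Prop :=
  (∃ h : 𝟙_ D = F.obj (𝟙_ C), Functor.LaxMonoidal.ε F = eqToHom h) ∧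
    ∀ A B : C, ∃ h : F.obj A ⊗ F.obj B = F.obj (A ⊗ B), Functor.LaxMonoidal.μ F A B = eqToHom h

/-- `F(X) = X`, `F(X^*) = X^*`, `F(ε_X) = z ε_X` and `F(ε_{X^*}) = z ε_{X^*}`. -/
def ScalesArcs {d : ℂˣ} (F : OCat d d ⥤ OCat d d) [F.Monoidal] (z : ℂˣ) : Prop :=
  ∃ (h : F.obj (objX d d) = objX d d) (h' : F.obj (objXs d d) = objXs d d),
    pairingImage F (epsX d d) =
      eqToHom (show F.obj (objX d d) ⊗ F.obj (objXs d d) = objX d d ⊗ objXs d d by rw [h, h']) ≫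
        ((z : ℂ) • epsX d d) ∧
    pairingImage F (epsXs d d) =
      eqToHom (show F.obj (objXs d d) ⊗ F.obj (objX d d) = objXs d d ⊗ objX d d by rw [h, h']) ≫
        ((z : ℂ) • epsXs d d)

/-- `F(X) = X^*`, `F(X^*) = X`, `F(ε_X) = z ε_{X^*}` and `F(ε_{X^*}) = z ε_X`. -/
def SwapsArcs {d : ℂˣ} (F : OCat d d ⥤ OCat d d) [F.Monoidal] (z : ℂˣ) : Prop :=
  ∃ (h : F.obj (objX d d) = objXs d d) (h' : F.obj (objXs d d) = objX d d),
    pairingImage F (epsX d d) =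
      eqToHom (show F.obj (objX d d) ⊗ F.obj (objXs d d) = objXs d d ⊗ objX d d by rw [h, h']) ≫
        ((z : ℂ) • epsXs d d) ∧
    pairingImage F (epsXs d d) =
      eqToHom (show F.obj (objXs d d) ⊗ F.obj (objX d d) = objX d d ⊗ objXs d d by rw [h, h']) ≫
        ((z : ℂ) • epsX d d)

end OrientedKauffman

namespace OrientedKauffman

/-! Existence of equivalences. Every diagram has a rotation number `Diagram.rot`, a normalized total
turning of its strings. It vanishes on identities and is additive under juxtaposition; under
concatenation it is additive up to twice the number of clockwise minus anticlockwise loops removed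
(`Diagram.rot_comp`). Multiplying each diagram `D` by `s ^ (-rot D)` therefore trades the loop
values `(dL, dR)` for `(s² dL, s⁻² dR)`, so only the product `dL * dR` matters. Another multiplier
compatible with all operations is `s` to the number of upper points minus the number of lower
points: it keeps the loop values and scales both upper arcs by `s²`. If both loop values agree, it
may be combined with the reversal of all orientations, which exchanges the letters. All these
functors are strict and are instances of `IsRescaling`.

Constraints on equivalences. Words are graded by their charge, and nonzero morphisms preserve it. An
equivalence `F` multiplies the charge by a fixed integer, which essential surjectivity forces to be
`±1`. Moreover `F(X)` has scalar endomorphisms only, whereas a word with two different neighbouring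
letters has the further endomorphism "cap, then cup"; so `F(X)` is a power of one letter, and its
charge makes it a single letter. The same holds for `F(X^*)` (`exists_obj_eq_letterObj`). Hom spaces
with two boundary points in all have dimension at most one, so `F` multiplies the two upper arcs by
scalars `y` and `z`. The zigzag identities force the inverse scalars on the lower arcs. Applying `F`
to the two circles compares the loop values up to the factors `z⁻¹ y` and `y⁻¹ z`. Their product is
`1`, which shows that `dL * dR` is an invariant; for a self-equivalence of `O_d` one gets `y = z`.

Uniqueness. The arcs generate the category: a diagram without lower points is cut along the string
at its first point (`Diagram.exists_factorization`), and the letters of the lower word are moved up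
by duality. So a strict linear functor is determined by its values on the letters and on the upper
arcs. -/

instance : DecidableRel before := fun x y => by unfold before; infer_instance

/-! ### The charge grading. -/

/-- The contribution of a letter to the charge of a word. -/
def Letter.sign : Letter → ℤ
  | .X => 1
  | .Xs => -1

/-- The number of letters `X` minus the number of letters `X^*`. -/
def charge (w : List Letter) : ℤ := (w.map Letter.sign).sum

@[simp] theorem charge_nil : charge [] = 0 := rfl

@[simp] theorem charge_cons (c : Letter) (w : List Letter) :
    charge (c :: w) = c.sign + charge w := by simp [charge]

@[simp] theorem charge_append (u v : List Letter) : charge (u ++ v) = charge u + charge v := by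
  simp [charge]

theorem sum_range_getElem? {A : Type*} (g : Option A → ℤ) (hg : g none = 0) (w : List A) {n : ℕ}
    (hn : w.length ≤ n) : ∑ j ∈ Finset.range n, g w[j]? = (w.map fun c => g (some c)).sum := by
  induction w generalizing n with
  | nil => simp [hg]
  | cons c w ih =>
    obtain ⟨m, rfl⟩ : ∃ m, n = m + 1 := ⟨n - 1, by simp at hn; omega⟩
    rw [Finset.sum_range_succ']
    simp only [List.getElem?_cons_succ, List.getElem?_cons_zero, List.map_cons, List.sum_cons]
    rw [ih (by simpa using hn), add_comm]

/-- Diagrams preserve the charge. -/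
theorem Diagram.charge_eq {u v : List Letter} (D : Diagram u v) : charge u = charge v := by
  let val : Option Bool → ℤ := fun o => if o = some true then 1 else if o = some false then -1 else 0
  set n := max u.length v.length with hn
  -- Each string pairs one starting point with one end point, so the signed count of all string ends
  -- cancels under the involution `D.σ`.
  have key : ∑ x ∈ Finset.range 2 ×ˢ Finset.range n, val (dir u v x) = 0 := by
    refine Finset.sum_involution (fun x _ => D.σ x) ?_ ?_ ?_ ?_
    · intro x _
      rw [D.planar.orient]
      rcases dir u v x with _ | _ | _ <;> simp [val]
    · intro x _ hx
      apply D.planar.ne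
      intro h
      simp [h, val] at hx
    · intro x hx
      have := D.cases x
      have := le_max_left u.length v.length
      have := le_max_right u.length v.length
      simp only [Finset.mem_product, Finset.mem_range] at hx ⊢
      grind
    · intro x _
      exact D.planar.invol x
  rw [Finset.sum_product, Finset.sum_range_succ, Finset.sum_range_one] at key
  have e1 : ∑ j ∈ Finset.range n, val (dir u v (0, j)) = charge u := by
    have := sum_range_getElem? (fun o => val (o.map fun c => decide (c = .X))) rfl u
      (le_max_left u.length v.length)
    refine this.trans ?_
    rw [charge]
    congr 1
    apply List.map_congr_left
    rintro (_ | _) _ <;> simp [val, Letter.sign]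
  -- On the lower line the letter `X` marks an end point, whence the minus sign.
  have e2 : ∑ j ∈ Finset.range n, val (dir u v (1, j)) = - charge v := by
    have := sum_range_getElem? (fun o => val (o.map fun c => decide (c ≠ .X))) rfl v
      (le_max_right u.length v.length)
    refine this.trans ?_
    rw [charge]
    clear this key e1 hn n D
    induction v with
    | nil => rfl
    | cons c v ih =>
      simp only [List.map_cons, List.sum_cons, ih]
      cases c <;> simp [val, Letter.sign] <;> ring
  omega

/-! ### The rotation number and its behaviour under gluing. -/

/-- The contribution of the point `x` to the turning number: a string starting there counts `1` or
`-1` according to whether it runs along with the boundary order or against it. -/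
def turnAt (d : Pt → Option Bool) (σ : Pt → Pt) (x : Pt) : ℤ :=
  if d x = some true then (if before x (σ x) then 1 else -1) else 0

theorem sum_eq_add_of_eq_off_pair {A : Type*} [DecidableEq A] {S : Finset A} {f g : A → ℤ} {a b : A}
    (ha : a ∈ S) (hb : b ∈ S) (hab : a ≠ b) (h : ∀ x ∈ S, x ≠ a → x ≠ b → f x = g x) :
    ∑ x ∈ S, f x = ∑ x ∈ S, g x + (f a - g a) + (f b - g b) := by
  have hb' : b ∈ S.erase a := Finset.mem_erase.2 ⟨hab.symm, hb⟩
  rw [← Finset.add_sum_erase S f ha, ← Finset.add_sum_erase S g ha,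
    ← Finset.add_sum_erase _ f hb', ← Finset.add_sum_erase _ g hb',
    Finset.sum_congr rfl (g := g)]
  · ring
  · intro x hx
    simp only [Finset.mem_erase] at hx
    exact h x hx.2.2 hx.2.1 hx.1

/-- Put `s = 1` if a string starts at `p` and `s = -1` if one ends there. Two different strings
merging into one change the count by `s`, whatever their position; this is where planarity enters.
If `p` and `q` are the ends of one string, that string counted `s` and disappears, so the change is
`-s = s - 2 s`. -/
theorem IsPlanar.sum_turnAt_join {d : Pt → Option Bool} {σ : Pt → Pt} (h : IsPlanar d σ) {p q : Pt}
    (hpq : before p q) (hp : d p ≠ none) (hd : d q = (d p).map not)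
    (hb : ∀ z, before p z → before z q → d z = none) {S : Finset Pt}
    (hS : ∀ x, d x ≠ none → x ∈ S) :
    ∑ x ∈ S, turnAt (fun x => if x = p ∨ x = q then none else d x) (OrientedKauffman.join p q σ) x =
      ∑ x ∈ S, turnAt d σ x + (if d p = some true then 1 else -1) -
        2 * (if σ p = q then (if d p = some true then 1 else -1) else 0) := by
  have hne : p ≠ q := by rintro rfl; exact before_irrefl _ hpq
  have hq : d q ≠ none := by cases hh : d p <;> simp_all
  have inv := h.invol
  have orp := h.orient p
  have orq := h.orient q
  have hsp : d (σ p) ≠ none := by rw [orp]; simpa using hp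
  have hsq : d (σ q) ≠ none := by rw [orq]; simpa using hq
  have np := h.ne p hp
  have nq := h.ne q hq
  have irr := before_irrefl
  have tr := @before_trans
  have tot := @before_total
  have nc := h.noncross
  by_cases hl : σ p = q
  · have hl' : σ q = p := by rw [← hl, inv]
    rw [sum_eq_add_of_eq_off_pair (hS p hp) (hS q hq) hne (g := turnAt d σ)]
    · have npq : ¬ before q p := fun hh => irr _ (tr hpq hh)
      rcases hh : d p with _ | _ | _
      · exact absurd hh hp
      · simp [turnAt, hh, hd, hl, hl', npq]; ring
      · simp [turnAt, hh, hd, hl, hpq]; ring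
    · intro x _ hxp hxq
      have e : OrientedKauffman.join p q σ x = σ x := by
        unfold OrientedKauffman.join
        grind
      simp [turnAt, e, hxp, hxq]
  · have side : ∀ x y, x ≠ y → (¬ before x y ↔ before y x) := by grind
    have hpq' : σ p ≠ σ q := by grind
    have hqp : σ q ≠ p := by grind
    -- The positions of `σ p` and `σ q` that non-crossing allows. In the first, the two old strings
    -- cancel if read as one oriented curve through `p` and `q`, and the new string counts `s`; in
    -- the second, each old string counts `-s` and so does the new one.
    have sgn : (before (σ q) (σ p) ∧ (before p (σ p) ↔ before q (σ q))) ∨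
        (before (σ p) (σ q) ∧ before (σ p) p ∧ before q (σ q)) := by
      have n1 := nc p q hpq
      have n2 : before (σ q) p → before p q → ¬ before q (σ p) := by
        simpa only [inv] using nc (σ q) p
      have n4 : before (σ p) (σ q) → before (σ q) p → ¬ before p q := by
        simpa only [inv] using nc (σ p) (σ q)
      have t1 := @tot p (σ p)
      have t2 := @tot q (σ q)
      have t3 := @tot p (σ q)
      have t4 := @tot q (σ p)
      have t5 := @tot (σ q) (σ p)
      have b1 := hb (σ p)
      have b2 := hb (σ q)
      clear nc hS hb orp orq hd side inv tot
      grind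
    have jp : ∀ x, x ≠ p → x ≠ q → x ≠ σ p → x ≠ σ q →
        turnAt (fun x => if x = p ∨ x = q then none else d x) (OrientedKauffman.join p q σ) x =
          turnAt d σ x := by
      intro x h1 h2 h3 h4
      have e : OrientedKauffman.join p q σ x = σ x := by
        unfold OrientedKauffman.join
        grind
      simp [turnAt, e, h1, h2]
    have j1 : OrientedKauffman.join p q σ (σ p) = σ q := by
      unfold OrientedKauffman.join
      grind
    have j2 : OrientedKauffman.join p q σ (σ q) = σ p := by
      unfold OrientedKauffman.join
      grind
    rcases hh : d p with _ | _ | _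
    · exact absurd hh hp
    · rw [hh] at orp hd
      rw [hd] at orq
      simp only [Option.map_some, Bool.not_false, Bool.not_true] at orp hd orq
      -- Here the strings are `σ p → p` and `q → σ q`, and the new one is `σ p → σ q`. Only the
      -- starting points `q`, which is lost, and `σ p`, which gets a new partner, change their
      -- contribution.
      rw [sum_eq_add_of_eq_off_pair (a := q) (b := σ p) (hS _ hq) (hS _ hsp) (Ne.symm hl) (g := turnAt d σ)]
      · simp only [turnAt, hl, np, or_self, if_false, if_true, j1, orp, hd, inv, or_true]
        have s1 := side p (σ p) np.symm
        have s2 := side q (σ q) nq.symm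
        have s3 := side (σ p) (σ q) hpq'
        have s4 := side (σ p) p np
        grind
      · intro x _ h1 h2
        by_cases h3 : x = p
        · subst h3; simp [turnAt, hh]
        · by_cases h4 : x = σ q
          · subst h4; simp [turnAt, orq]
          · exact jp x h3 h1 h2 h4
    · rw [hh] at orp hd
      rw [hd] at orq
      simp only [Option.map_some, Bool.not_false, Bool.not_true] at orp hd orq
      -- The mirror case: `p → σ p` and `σ q → q` become `σ q → σ p`.
      rw [sum_eq_add_of_eq_off_pair (a := p) (b := σ q) (hS _ hp) (hS _ hsq) (Ne.symm hqp) (g := turnAt d σ)]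
      · simp only [turnAt, hl, hqp, nq, or_self, if_false, if_true, j2, orq, hh, inv, true_or]
        have s1 := side p (σ p) np.symm
        have s2 := side q (σ q) nq.symm
        have s3 := side (σ p) (σ q) hpq'
        have s4 := side (σ q) q nq
        grind
      · intro x _ h1 h2
        by_cases h3 : x = q
        · subst h3; simp [turnAt, hd]
        · by_cases h4 : x = σ p
          · subst h4; simp [turnAt, orp]
          · exact jp x h1 h3 h4 h2

/-- Level `l` is a lower line, where `X` marks an end of a string. Hence each join along a letter
`c` lowers the count by the sign of `c`, and closing a loop there raises it by twice that sign. The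
set `S` can stay fixed during the induction because points already glued contribute `0`. -/
theorem IsPlanar.sum_turnAt_glue {l : ℕ} {cs : List Letter} {dir : Pt → Option Bool} {T : Tangle}
    {i : ℕ} (h : IsPlanar dir T.σ) (hr : Ready dir l i cs) {S : Finset Pt}
    (hS : ∀ x, dir x ≠ none → x ∈ S) :
    ∑ x ∈ S, turnAt (fun x => if x.1 = l ∨ x.1 = l + 1 then none else dir x)
        (OrientedKauffman.glue l cs i T).σ x -
        2 * ((OrientedKauffman.glue l cs i T).loops.map Letter.sign).sum =
      ∑ x ∈ S, turnAt dir T.σ x - charge cs - 2 * (T.loops.map Letter.sign).sum := by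
  induction cs generalizing dir T i with
  | nil =>
    suffices e : (fun x => if x.1 = l ∨ x.1 = l + 1 then none else dir x) = dir by
      rw [e]; simp [OrientedKauffman.glue]
    funext ⟨a, b⟩
    have h1 := hr.done b
    have h2 := hr.left (b - i)
    have h3 := hr.right (b - i)
    grind
  | cons c cs ih =>
    have hS' : ∀ x, erase dir l i x ≠ none → x ∈ S := by
      intro x hx
      apply hS
      unfold erase at hx
      grind
    have h1 := ih (h.glueStep hr) hr.step hS'
    have e : (fun x => if x.1 = l ∨ x.1 = l + 1 then none else erase dir l i x) =
        fun x => if x.1 = l ∨ x.1 = l + 1 then none else dir x := by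
      funext ⟨a, b⟩
      unfold erase
      grind
    rw [e] at h1
    rw [OrientedKauffman.glue, h1]
    obtain ⟨d1, d2⟩ := hr.dirs
    have h2 := h.sum_turnAt_join (p := (l, i)) (q := (l + 1, i)) (Or.inl (Nat.lt_succ_self l))
      (by simp [d1]) (by simp [d1, d2]) (by
        rintro ⟨a, b⟩ h1 h2
        have := hr.done b
        have := hr.odd
        unfold before at *
        grind) hS
    change ∑ x ∈ S, turnAt (erase dir l i) (OrientedKauffman.glueStep l i c T).σ x = _ at h2
    rw [h2, charge_cons]
    by_cases hl : T.σ (l, i) = (l + 1, i) <;> cases c <;>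
      simp [OrientedKauffman.glueStep, hl, d1, Letter.sign] <;> ring

/-- The number of strings that run along with the boundary order minus the number of strings that
run against it. -/
def Diagram.turning {u v : List Letter} (D : Diagram u v) : ℤ :=
  ∑ j ∈ Finset.range u.length, turnAt (dir u v) D.σ (0, j) +
    ∑ j ∈ Finset.range v.length, turnAt (dir u v) D.σ (1, j)

theorem sum_turnAt_level {u v : List Letter} (σ : Pt → Pt) (l m n : ℕ)
    (hm : (if l = 0 then u.length else v.length) = m) (hn : m ≤ n) :
    ∑ j ∈ Finset.range n, turnAt (dir u v) σ (l, j) =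
      ∑ j ∈ Finset.range m, turnAt (dir u v) σ (l, j) := by
  symm
  apply Finset.sum_subset (Finset.range_mono hn)
  intro j _ hj
  simp only [Finset.mem_range, not_lt] at hj
  simp [turnAt, dir_of_length (w := u) (w' := v) (l, j) (by simpa [hm] using hj)]

theorem Diagram.sum_turnAt {u v : List Letter} (D : Diagram u v) {n : ℕ} (hu : u.length ≤ n)
    (hv : v.length ≤ n) :
    ∑ x ∈ Finset.range 2 ×ˢ Finset.range n, turnAt (dir u v) D.σ x = D.turning := by
  rw [Finset.sum_product, Finset.sum_range_succ, Finset.sum_range_one,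
    sum_turnAt_level D.σ 0 _ n rfl hu, sum_turnAt_level D.σ 1 _ n rfl hv]
  rfl

theorem Diagram.sum_turnAt_stack {u v w : List Letter} (D : Diagram u v) (E : Diagram v w) {n : ℕ}
    (hu : u.length ≤ n) (hv : v.length ≤ n) (hw : w.length ≤ n) :
    ∑ x ∈ Finset.range 4 ×ˢ Finset.range n,
      turnAt (stackDir 2 (dir u v) (dir v w)) (stack 2 D.σ E.σ) x = D.turning + E.turning := by
  have e0 : ∀ l j, l < 2 → turnAt (stackDir 2 (dir u v) (dir v w)) (stack 2 D.σ E.σ) (l, j) =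
      turnAt (dir u v) D.σ (l, j) := by
    intro l j hl
    simp [turnAt, stackDir, stack, hl]
  have e1 : ∀ l j, turnAt (stackDir 2 (dir u v) (dir v w)) (stack 2 D.σ E.σ) (l + 2, j) =
      turnAt (dir v w) E.σ (l, j) := by
    intro l j
    have : ∀ y : Pt, before (l + 2, j) (y.1 + 2, y.2) ↔ before (l, j) y := by
      intro y
      unfold before
      grind
    simp [turnAt, stackDir, stack, this]
  rw [← D.sum_turnAt hu hv, ← E.sum_turnAt hv hw]
  simp only [Finset.sum_product, Finset.sum_range_succ, Finset.sum_range_zero, e0 0 _ (by simp),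
    e0 1 _ (by simp), e1 0, e1 1]
  ring

/-- After gluing, the strings end on the levels `0` and `3` only. Renumbering `3` as `1` keeps the
boundary order, as both levels are odd and lie after level `0`. -/
theorem Diagram.sum_turnAt_glued {u v w : List Letter} (D : Diagram u v) (E : Diagram v w) {n : ℕ}
    (hu : u.length ≤ n) (hw : w.length ≤ n) :
    ∑ x ∈ Finset.range 4 ×ˢ Finset.range n, turnAt (fun x => if x.1 = 1 ∨ x.1 = 1 + 1 then none else
      stackDir 2 (dir u v) (dir v w) x) (D.glued E).σ x = (D.comp E).turning := by
  rw [← (D.comp E).sum_turnAt hu hw]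
  simp only [Finset.sum_product, Finset.sum_range_succ, Finset.sum_range_zero]
  have e : ∀ j, ((D.glued E).σ (0, j)).1 = 0 ∨ ((D.glued E).σ (0, j)).1 = 3 := fun j => by
    have := D.glued_spec E (0, j)
    simpa using this
  have e' : ∀ j, ((D.glued E).σ (3, j)).1 = 0 ∨ ((D.glued E).σ (3, j)).1 = 3 := fun j => by
    have := D.glued_spec E (3, j)
    simpa using this
  have h0 : ∀ j, turnAt (fun x => if x.1 = 1 ∨ x.1 = 1 + 1 then none else
      stackDir 2 (dir u v) (dir v w) x) (D.glued E).σ (0, j) =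
      turnAt (dir u w) (D.comp E).σ (0, j) := by
    intro j
    have := e j
    set y := (D.glued E).σ (0, j) with hy
    have hb : before (0, j) (Equiv.swap 1 3 y.1, y.2) ↔ before (0, j) y := by
      rcases this with h | h <;> simp [h, before, Equiv.swap_apply_def]
    simp [turnAt, stackDir, Diagram.comp, relevel, Equiv.swap_apply_of_ne_of_ne, ← hy, hb]
    simp [dir]
  have h3 : ∀ j, turnAt (fun x => if x.1 = 1 ∨ x.1 = 1 + 1 then none else
      stackDir 2 (dir u v) (dir v w) x) (D.glued E).σ (3, j) =
      turnAt (dir u w) (D.comp E).σ (1, j) := by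
    intro j
    have := e' j
    set y := (D.glued E).σ (3, j) with hy
    have hb : before (1, j) (Equiv.swap 1 3 y.1, y.2) ↔ before (3, j) y := by
      rcases this with h | h <;> simp [h, before, Equiv.swap_apply_def]
    simp [turnAt, stackDir, Diagram.comp, relevel, ← hy, hb]
    simp [dir]
  simp only [h0, h3]
  simp [turnAt]

/-- The rotation number of a diagram: the total turning of its strings. -/
def Diagram.rot {u v : List Letter} (D : Diagram u v) : ℤ := D.turning - charge v

/-- Gluing along `v` costs the turning the charge of `v`. The normalization by the charge of the
lower word absorbs this loss, and only the loops remain, with `1` for a clockwise and `-1` for an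
anticlockwise one. -/
theorem Diagram.rot_comp {u v w : List Letter} (D : Diagram u v) (E : Diagram v w) :
    (D.comp E).rot = D.rot + E.rot + 2 * ((D.glued E).loops.map Letter.sign).sum := by
  set n := u.length + v.length + w.length with hn
  have key := (D.planar_stack E).sum_turnAt_glue (T := ⟨stack 2 D.σ E.σ, 0⟩) (ready_stack u v w)
    (S := Finset.range 4 ×ˢ Finset.range n) (by
      intro x hx
      have h1 := stackDir_region u v w x hx
      simp only [lens4] at h1
      simp only [Finset.mem_product, Finset.mem_range]
      grind)
  change _ - 2 * ((D.glued E).loops.map _).sum = _ at key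
  have e := D.sum_turnAt_glued E (n := n) (by omega) (by omega)
  have e' := D.sum_turnAt_stack E (n := n) (by omega) (by omega) (by omega)
  rw [e'] at key
  change ∑ x ∈ Finset.range 4 ×ˢ Finset.range n, turnAt _ (D.glued E).σ x - _ = _ at key
  rw [e] at key
  simp only [Multiset.map_zero, Multiset.sum_zero] at key
  unfold rot
  linarith

/-- Downward vertical strings run along with the boundary order and upward ones against it, so the
turning is the charge of the word. -/
theorem Diagram.rot_id (w : List Letter) : (Diagram.id w).rot = 0 := by
  have h0 : ∀ j ∈ Finset.range w.length, turnAt (dir w w) (Diagram.id w).σ (0, j) =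
      (fun o => if o = some Letter.X then 1 else 0) w[j]? := by
    intro j hj
    simp only [Finset.mem_range] at hj
    simp [turnAt, dir, Diagram.id, idMap, hj, before]
  have h1 : ∀ j ∈ Finset.range w.length, turnAt (dir w w) (Diagram.id w).σ (1, j) =
      (fun o => if o = some Letter.Xs then -1 else 0) w[j]? := by
    intro j hj
    simp only [Finset.mem_range] at hj
    rcases hw : w[j] <;> simp [turnAt, dir, Diagram.id, idMap, hj, before, hw]
  rw [rot, turning, Finset.sum_congr rfl h0, Finset.sum_congr rfl h1,
    sum_range_getElem? (fun o => if o = some Letter.X then 1 else 0) (by simp) w le_rfl,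
    sum_range_getElem? (fun o => if o = some Letter.Xs then -1 else 0) (by simp) w le_rfl]
  clear h0 h1
  induction w with
  | nil => rfl
  | cons c w ih =>
    cases c <;> simp [Letter.sign] at * <;> linarith

/-- Moving `E` to the right of `D` does not affect the boundary order between points of `E`. -/
theorem Diagram.rot_tensor {u u' v v' : List Letter} (D : Diagram u u') (E : Diagram v v') :
    (D.tensor E).rot = D.rot + E.rot := by
  have h0 : ∀ l, (l = 0 ∨ l = 1) → ∀ j ∈ Finset.range (lens u u' l),
      turnAt (dir (u ++ v) (u' ++ v')) (D.tensor E).σ (l, j) = turnAt (dir u u') D.σ (l, j) := by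
    intro l hl j hj
    simp only [Finset.mem_range] at hj
    rw [← juxtDir_dir]
    simp [turnAt, juxtDir, Diagram.tensor, juxt, hj]
  have h1 : ∀ l, (l = 0 ∨ l = 1) → ∀ j,
      turnAt (dir (u ++ v) (u' ++ v')) (D.tensor E).σ (l, lens u u' l + j) =
        turnAt (dir v v') E.σ (l, j) := by
    intro l hl j
    have : ∀ y : Pt, before (l, lens u u' l + j) (y.1, y.2 + lens u u' y.1) ↔ before (l, j) y := by
      intro y
      unfold before
      grind
    rw [← juxtDir_dir]
    simp [turnAt, juxtDir, Diagram.tensor, juxt, this]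
  unfold rot turning
  rw [List.length_append, List.length_append, Finset.sum_range_add, Finset.sum_range_add,
    charge_append]
  have h00 := Finset.sum_congr rfl (h0 0 (by simp))
  have h01 := Finset.sum_congr rfl (h0 1 (by simp))
  have h10 := h1 0 (by simp)
  have h11 := h1 1 (by simp)
  simp only [lens, if_true, if_neg one_ne_zero] at h00 h01 h10 h11
  simp only [h00, h01, h10, h11]
  ring

/-- The exponent is the loop term of `Diagram.rot_comp`; this match is what makes rescaling by the
rotation number functorial. -/
theorem weight_eq_zpow_mul {dL dR dL' dR' s : ℂˣ} (hR : dR = s ^ (2 : ℤ) * dR')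
    (hL : dL = s ^ (-2 : ℤ) * dL') (L : Multiset Letter) :
    weight dL dR L = ((s ^ (2 * (L.map Letter.sign).sum) : ℂˣ) : ℂ) * weight dL' dR' L := by
  induction L using Multiset.induction_on with
  | empty => simp [weight]
  | cons c L ih =>
    have e : ∀ dL dR : ℂˣ, weight dL dR (c ::ₘ L) =
        (if c = Letter.X then (dR : ℂ) else (dL : ℂ)) * weight dL dR L := fun dL dR => by simp [weight]
    rw [e, e, ih, Multiset.map_cons, Multiset.sum_cons, mul_add, zpow_add, Units.val_mul]
    cases c
    · simp only [Letter.sign, if_true, hR, Units.val_mul, mul_one]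
      ring
    · simp only [Letter.sign, hL, Units.val_mul, reduceCtorEq, if_false, mul_neg, mul_one]
      ring

/-! ### Bilinearity and calculation with single diagrams. -/

section Hom

variable {dL dR : ℂˣ}

instance : MonoidalPreadditive (OCat dL dR) where
  whiskerLeft_zero {A B C} := map_zero (tensHom A.word A.word B.word C.word (𝟙 A : A ⟶ A))
  zero_whiskerRight {A B C} :=
    (LinearMap.congr_fun (map_zero (tensHom B.word C.word A.word A.word)) (𝟙 A : A ⟶ A) :)
  whiskerLeft_add {A B C} := map_add (tensHom A.word A.word B.word C.word (𝟙 A : A ⟶ A))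
  add_whiskerRight {A B C} f g :=
    (LinearMap.congr_fun (map_add (tensHom B.word C.word A.word A.word) f g) (𝟙 A : A ⟶ A) :)

instance : MonoidalLinear ℂ (OCat dL dR) where
  whiskerLeft_smul A {B C} r f :=
    map_smul (tensHom A.word A.word B.word C.word (𝟙 A : A ⟶ A)) r f
  smul_whiskerRight r {B C} f A :=
    (LinearMap.congr_fun (map_smul (tensHom B.word C.word A.word A.word) r f) (𝟙 A : A ⟶ A) :)

theorem smul_tensorHom {A B A' B' : OCat dL dR} (a : ℂ) (f : A ⟶ B) (g : A' ⟶ B') :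
    (a • f) ⊗ₘ g = a • (f ⊗ₘ g) := by
  simp [MonoidalCategory.tensorHom_def]

theorem tensorHom_smul {A B A' B' : OCat dL dR} (a : ℂ) (f : A ⟶ B) (g : A' ⟶ B') :
    f ⊗ₘ (a • g) = a • (f ⊗ₘ g) := by
  simp [MonoidalCategory.tensorHom_def]

/-- The morphism given by a single diagram. -/
noncomputable def Diagram.hom {A B : OCat dL dR} (D : Diagram A.word B.word) : A ⟶ B :=
  Finsupp.single D (1 : ℂ)

theorem single_eq_smul_hom {A B : OCat dL dR} (D : Diagram A.word B.word) (a : ℂ) :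
    (Finsupp.single D a : A ⟶ B) = a • D.hom :=
  (Finsupp.smul_single_one D a).symm

theorem hom_induction {A B : OCat dL dR} {P : (A ⟶ B) → Prop} (f : A ⟶ B) (zero : P 0)
    (add : ∀ f g, P f → P g → P (f + g)) (smul_hom : ∀ (a : ℂ) (D : Diagram A.word B.word), P (a • D.hom)) :
    P f :=
  Finsupp.induction_linear f zero add fun D a => by rw [single_eq_smul_hom]; exact smul_hom a D

theorem Diagram.hom_ne_zero {A B : OCat dL dR} (D : Diagram A.word B.word) :
    (D.hom : A ⟶ B) ≠ 0 := by
  intro h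
  have : Finsupp.single D (1 : ℂ) = 0 := h
  simp at this

theorem Diagram.hom_id (A : OCat dL dR) : (Diagram.id A.word).hom = 𝟙 A := rfl

theorem Diagram.hom_comp_hom {A B C : OCat dL dR} (D : Diagram A.word B.word)
    (E : Diagram B.word C.word) :
    (D.hom : A ⟶ B) ≫ (E.hom : B ⟶ C) =
      weight dL dR (D.glued E).loops • (D.comp E).hom := by
  rw [← single_eq_smul_hom]
  exact (compHom_single _ _ _ D E 1 1).trans (by rw [one_mul, one_mul])

theorem Diagram.hom_tensor_hom {A B A' B' : OCat dL dR} (D : Diagram A.word B.word)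
    (E : Diagram A'.word B'.word) :
    (D.hom : A ⟶ B) ⊗ₘ (E.hom : A' ⟶ B') = (D.tensor E).hom :=
  (tensHom_single _ _ _ _ D E 1 1).trans (by rw [one_mul]; rfl)

theorem Diagram.hom_comp_eqToHom {A B C : OCat dL dR} (D : Diagram A.word B.word) (h : B = C)
    (D' : Diagram A.word C.word) (hD : D.σ = D'.σ) :
    (D.hom : A ⟶ B) ≫ eqToHom h = D'.hom :=
  single_comp_eqToHom D 1 h D' hD

theorem Diagram.eqToHom_comp_hom {A B C : OCat dL dR} (D : Diagram B.word C.word) (h : A = B)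
    (D' : Diagram A.word C.word) (hD : D.σ = D'.σ) :
    eqToHom h ≫ (D.hom : B ⟶ C) = D'.hom :=
  eqToHom_comp_single D 1 h D' hD

theorem weight_ne_zero (dL dR : ℂˣ) (L : Multiset Letter) : weight dL dR L ≠ 0 := by
  apply Multiset.prod_ne_zero
  simp only [Multiset.mem_map, not_exists, not_and]
  intro c _
  split_ifs <;> simp

/-- The structure isomorphisms of the category are transports along equalities of words, so
coherence conditions reduce to composing `eqToHom`s. -/
theorem associator_hom_eq (A B C : OCat dL dR) :
    (α_ A B C).hom = eqToHom (congrArg OCat.mk (List.append_assoc _ _ _)) := rfl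

theorem leftUnitor_hom_eq (A : OCat dL dR) : (λ_ A).hom = eqToHom rfl := rfl

theorem leftUnitor_inv_eq (A : OCat dL dR) : (λ_ A).inv = eqToHom rfl := rfl

theorem rightUnitor_hom_eq (A : OCat dL dR) :
    (ρ_ A).hom = eqToHom (congrArg OCat.mk (List.append_nil _)) := rfl

theorem rightUnitor_inv_eq (A : OCat dL dR) :
    (ρ_ A).inv = eqToHom (congrArg OCat.mk (List.append_nil _).symm) := rfl

/-- Nonzero morphisms preserve the charge. -/
theorem charge_eq_of_ne_zero {A B : OCat dL dR} {f : A ⟶ B} (hf : f ≠ 0) :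
    charge A.word = charge B.word := by
  by_contra h
  exact hf (Finsupp.ext fun D => absurd D.charge_eq h)

end Hom

/-! ### Renaming the letters. -/

/-- A permutation of two letters is the identity or the exchange. The latter reverses every string
and leaves the curves alone, so `τ` is the identity or the reversal of directions. -/
theorem dir_map (φ : Equiv.Perm Letter) : ∃ τ : Option Bool → Option Bool, τ none = none ∧
    (∀ o, τ (o.map not) = (τ o).map not) ∧ (∀ o, τ o = none → o = none) ∧
      (∀ o, τ (τ o) = o) ∧
      ∀ (u v : List Letter) (x : Pt), dir (u.map φ) (v.map φ) x = τ (dir u v x) := by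
  have hφ : φ .Xs ≠ φ .X := fun h => by simpa using φ.injective h
  rcases hX : φ .X with _ | _
  · have hXs : φ .Xs = .Xs := by cases h : φ .Xs <;> simp_all
    refine ⟨id, rfl, fun _ => rfl, fun _ h => h, fun _ => rfl, ?_⟩
    have : ∀ u : List Letter, u.map φ = u := fun u => by
      refine (List.map_congr_left (g := id) ?_).trans (List.map_id _)
      rintro (_ | _) _ <;> simp [hX, hXs]
    simp [this]
  · have hXs : φ .Xs = .X := by cases h : φ .Xs <;> simp_all
    refine ⟨Option.map not, rfl, fun _ => rfl, fun _ h => by simpa using h,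
      by rintro (_ | _ | _) <;> rfl, ?_⟩
    intro u v x
    have e1 : (fun c => decide (φ c = Letter.X)) = fun c => !decide (c = Letter.X) := by
      funext c; cases c <;> simp [hX, hXs]
    have e2 : (fun c => !decide (φ c = Letter.X)) = fun c => decide (c = Letter.X) := by
      funext c; cases c <;> simp [hX, hXs]
    unfold dir
    split_ifs <;> simp [Function.comp_def, e1, e2]

theorem isPlanar_dir_map (φ : Equiv.Perm Letter) {u v : List Letter} {σ : Pt → Pt} :
    IsPlanar (dir (u.map φ) (v.map φ)) σ ↔ IsPlanar (dir u v) σ := by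
  obtain ⟨τ, t0, t1, t2, t3, h⟩ := dir_map φ
  constructor
  · rintro ⟨h1, h2, h3, h4⟩
    refine ⟨h1, fun x hx => h2 x (by rw [h, hx, t0]), fun x => ?_, h4⟩
    have := h3 x
    rw [h, h, ← t1] at this
    rw [← t3 (dir u v (σ x)), this, t3]
  · rintro ⟨h1, h2, h3, h4⟩
    refine ⟨h1, fun x hx => h2 x (t2 _ (by rw [← h, hx])), fun x => ?_, h4⟩
    rw [h, h, ← t1, h3]

/-- Renaming of the letters in the type of a diagram. -/
def Diagram.relabel (φ : Equiv.Perm Letter) {u v : List Letter} (D : Diagram u v) :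
    Diagram (u.map φ) (v.map φ) :=
  ⟨D.σ, (isPlanar_dir_map φ).2 D.planar⟩

theorem Diagram.relabel_bijective (φ : Equiv.Perm Letter) (u v : List Letter) :
    Function.Bijective (Diagram.relabel φ : Diagram u v → _) := by
  constructor
  · intro D E h
    exact Diagram.ext (congrArg (fun D : Diagram _ _ => D.σ) h :)
  · intro D
    exact ⟨⟨D.σ, (isPlanar_dir_map φ).1 D.planar⟩, rfl⟩

/-- Gluing uses the letters only to label the loops that it closes. -/
theorem glue_map (f : Letter → Letter) (l : ℕ) (cs : List Letter) (i : ℕ) (T : Tangle) :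
    glue l (cs.map f) i ⟨T.σ, T.loops.map f⟩ =
      ⟨(glue l cs i T).σ, (glue l cs i T).loops.map f⟩ := by
  induction cs generalizing i T with
  | nil => rfl
  | cons c cs ih =>
    simp only [glue, List.map_cons]
    rw [← ih]
    congr 1
    unfold glueStep
    congr 1
    split_ifs <;> simp

theorem Diagram.glued_relabel (φ : Equiv.Perm Letter) {u v w : List Letter} (D : Diagram u v)
    (E : Diagram v w) : (D.relabel φ).glued (E.relabel φ) =
      ⟨(D.glued E).σ, (D.glued E).loops.map φ⟩ :=
  glue_map φ 1 v 0 ⟨stack 2 D.σ E.σ, 0⟩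

theorem Diagram.comp_relabel (φ : Equiv.Perm Letter) {u v w : List Letter} (D : Diagram u v)
    (E : Diagram v w) : (D.relabel φ).comp (E.relabel φ) = (D.comp E).relabel φ := by
  apply Diagram.ext
  have := congrArg Tangle.σ (D.glued_relabel φ E)
  simp only [Diagram.comp, Diagram.relabel] at this ⊢
  rw [this]

theorem Diagram.tensor_relabel (φ : Equiv.Perm Letter) {u u' v v' : List Letter} (D : Diagram u u')
    (E : Diagram v v') :
    ((D.relabel φ).tensor (E.relabel φ)).σ = ((D.tensor E).relabel φ).σ := by
  simp only [Diagram.tensor, Diagram.relabel]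
  congr 1
  funext l
  simp [lens]

/-! ### Strict monoidal equivalences from rescaling diagrams. -/

/-- Weights `W` of diagrams such that renaming the letters by `φ` and multiplying every diagram by
its weight is compatible with identities, concatenation and juxtaposition. -/
structure IsRescaling (φ : Equiv.Perm Letter) (dL dR dL' dR' : ℂˣ)
    (W : ∀ {u v : List Letter}, Diagram u v → ℂˣ) : Prop where
  map_id : ∀ w, W (Diagram.id w) = 1
  map_comp : ∀ {u v w : List Letter} (D : Diagram u v) (E : Diagram v w),
    (W (D.comp E) : ℂ) * weight dL dR (D.glued E).loops =
      W D * W E * weight dL' dR' ((D.glued E).loops.map φ)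
  map_tensor : ∀ {u u' v v' : List Letter} (D : Diagram u u') (E : Diagram v v'),
    W (D.tensor E) = W D * W E

namespace IsRescaling

variable {φ : Equiv.Perm Letter} {dL dR dL' dR' : ℂˣ} {W : ∀ {u v : List Letter}, Diagram u v → ℂˣ}

/-- The linear map on formal combinations of diagrams belonging to a rescaling. -/
noncomputable def mapHom (φ : Equiv.Perm Letter)
    (W : ∀ {u v : List Letter}, Diagram u v → ℂˣ) (u v : List Letter) :
    (Diagram u v →₀ ℂ) →ₗ[ℂ] (Diagram (u.map φ) (v.map φ) →₀ ℂ) :=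
  Finsupp.linearCombination ℂ fun D => Finsupp.single (D.relabel φ) (W D : ℂ)

theorem mapHom_single {u v : List Letter} (D : Diagram u v) (a : ℂ) :
    mapHom φ W u v (Finsupp.single D a) = Finsupp.single (D.relabel φ) (a * W D) := by
  simp [mapHom]

theorem mapHom_apply {u v : List Letter} (f : Diagram u v →₀ ℂ) (D : Diagram u v) :
    mapHom φ W u v f (D.relabel φ) = f D * W D := by
  induction f using Finsupp.induction_linear with
  | zero => simp
  | add f g hf hg => simp [hf, hg, add_mul]
  | single E a =>
    rw [mapHom_single]
    by_cases h : E = D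
    · simp [h]
    · have h' : E.relabel φ ≠ D.relabel φ := fun h' => h ((Diagram.relabel_bijective φ u v).1 h')
      simp [h, h']

/-- In the bases of diagrams this map is a bijection of basis elements followed by multiplication
with invertible scalars. -/
theorem mapHom_bijective (φ : Equiv.Perm Letter)
    (W : ∀ {u v : List Letter}, Diagram u v → ℂˣ) (u v : List Letter) :
    Function.Bijective (mapHom φ W u v) := by
  constructor
  · intro f g h
    ext D
    have := DFunLike.congr_fun h (D.relabel φ)
    rw [mapHom_apply, mapHom_apply] at this
    exact mul_right_cancel₀ (W D).ne_zero this
  · intro g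
    induction g using Finsupp.induction_linear with
    | zero => exact ⟨0, map_zero _⟩
    | add g g' hg hg' =>
      obtain ⟨f, rfl⟩ := hg
      obtain ⟨f', rfl⟩ := hg'
      exact ⟨f + f', map_add _ _ _⟩
    | single E b =>
      obtain ⟨D, rfl⟩ := (Diagram.relabel_bijective φ u v).2 E
      exact ⟨Finsupp.single D (b * (W D : ℂ)⁻¹), by
        rw [mapHom_single, mul_assoc, inv_mul_cancel₀ (W D).ne_zero, mul_one]⟩

/-- The functor that renames the letters and rescales the diagrams. -/
noncomputable def functor (h : IsRescaling φ dL dR dL' dR' W) : OCat dL dR ⥤ OCat dL' dR' where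
  obj A := ⟨A.word.map φ⟩
  map {A B} f := mapHom φ W A.word B.word f
  map_id A := by
    refine (mapHom_single (φ := φ) (W := W) (Diagram.id A.word) 1).trans ?_
    rw [h.map_id]
    simp only [Units.val_one, mul_one]
    refine congrArg (fun D => Finsupp.single D (1 : ℂ)) (Diagram.ext ?_)
    simp [Diagram.relabel, Diagram.id]
  map_comp {A B C} f g := by
    simp only [comp_linear]
    induction f using Finsupp.induction_linear with
    | zero => simp
    | add f g hf hg => simp only [map_add, LinearMap.add_apply, hf, hg]
    | single D a =>
      induction g using Finsupp.induction_linear with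
      | zero => simp
      | add f g hf hg => simp only [map_add, hf, hg]
      | single E b =>
        rw [compHom_single, mapHom_single, mapHom_single, mapHom_single]
        refine Eq.trans ?_ (compHom_single _ _ _ _ _ _ _).symm
        rw [Diagram.comp_relabel, Diagram.glued_relabel]
        congr 1
        linear_combination a * b * h.map_comp D E

/-- The diagram `D` with letters renamed, between the images of its objects. -/
def diagram (h : IsRescaling φ dL dR dL' dR' W) {A B : OCat dL dR} (D : Diagram A.word B.word) :
    Diagram (h.functor.obj A).word (h.functor.obj B).word :=
  D.relabel φ

theorem map_hom (h : IsRescaling φ dL dR dL' dR' W) {A B : OCat dL dR}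
    (D : Diagram A.word B.word) :
    h.functor.map (D.hom : A ⟶ B) = (W D : ℂ) • (h.diagram D).hom := by
  refine Eq.trans ?_ (single_eq_smul_hom _ _)
  exact (mapHom_single D 1).trans (by rw [one_mul]; rfl)

instance (h : IsRescaling φ dL dR dL' dR' W) : h.functor.Additive where
  map_add {A B f g} := map_add (mapHom φ W A.word B.word) f g

instance (h : IsRescaling φ dL dR dL' dR' W) : h.functor.Linear ℂ where
  map_smul {A B} f r := map_smul (mapHom φ W A.word B.word) r f

instance (h : IsRescaling φ dL dR dL' dR' W) : h.functor.IsEquivalence where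
  faithful := ⟨fun {A B} _ _ e => (mapHom_bijective φ W A.word B.word).1 e⟩
  full := ⟨fun {A B} => (mapHom_bijective φ W A.word B.word).2⟩
  essSurj := ⟨fun B => ⟨⟨B.word.map φ.symm⟩, ⟨eqToIso (by
    simp [functor])⟩⟩⟩

theorem obj_unit (h : IsRescaling φ dL dR dL' dR' W) :
    𝟙_ (OCat dL' dR') = h.functor.obj (𝟙_ (OCat dL dR)) := rfl

theorem obj_tensor (h : IsRescaling φ dL dR dL' dR' W) (A B : OCat dL dR) :
    h.functor.obj A ⊗ h.functor.obj B = h.functor.obj (A ⊗ B) :=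
  congrArg OCat.mk List.map_append.symm

/-- Naturality of the structure isomorphisms, from which both whiskered versions follow. By
bilinearity it suffices to treat diagrams, where it combines multiplicativity of `W` with
`Diagram.tensor_relabel`. -/
theorem tensorHom_map (h : IsRescaling φ dL dR dL' dR' W) {A A' B B' : OCat dL dR} (f : A ⟶ A')
    (g : B ⟶ B') : (h.functor.map f ⊗ₘ h.functor.map g) ≫ eqToHom (h.obj_tensor A' B') =
      eqToHom (h.obj_tensor A B) ≫ h.functor.map (f ⊗ₘ g) := by
  induction f using hom_induction with
  | zero => simp
  | add f g hf hg => simp only [Functor.map_add, MonoidalPreadditive.add_tensor,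
      Preadditive.add_comp, Preadditive.comp_add, hf, hg]
  | smul_hom a D =>
    induction g using hom_induction with
    | zero => simp
    | add f g hf hg => simp only [Functor.map_add, MonoidalPreadditive.tensor_add,
        Preadditive.add_comp, Preadditive.comp_add, hf, hg]
    | smul_hom b E =>
      have e1 := Diagram.hom_comp_eqToHom ((h.diagram D).tensor (h.diagram E)) (h.obj_tensor A' B')
        (Diagram.cast List.map_append rfl ((D.tensor E).relabel φ)) (D.tensor_relabel φ E)
      have e2 := Diagram.eqToHom_comp_hom (h.diagram (A := A ⊗ B) (B := A' ⊗ B') (D.tensor E))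
        (h.obj_tensor A B) (Diagram.cast List.map_append rfl ((D.tensor E).relabel φ)) rfl
      simp only [Functor.map_smul, smul_tensorHom, tensorHom_smul, Diagram.hom_tensor_hom, h.map_hom,
        Linear.smul_comp, Linear.comp_smul]
      rw [e1, e2, h.map_tensor]
      simp only [smul_smul, Units.val_mul]
      congr 1
      ring

/-- The structure isomorphisms of the functor belonging to a rescaling. -/
noncomputable def coreMonoidal (h : IsRescaling φ dL dR dL' dR' W) : h.functor.CoreMonoidal where
  εIso := eqToIso h.obj_unit
  μIso A B := eqToIso (h.obj_tensor A B)
  μIso_hom_natural_left {A B} f C := by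
    simpa using h.tensorHom_map f (𝟙 C)
  μIso_hom_natural_right {A B} C f := by
    simpa using h.tensorHom_map (𝟙 C) f
  associativity A B C := by
    simp only [eqToIso.hom, associator_hom_eq, eqToHom_map, eqToHom_whiskerRight,
      whiskerLeft_eqToHom, eqToHom_trans]
  left_unitality A := by
    simp only [eqToIso.hom, leftUnitor_hom_eq, eqToHom_map, eqToHom_whiskerRight,
      eqToHom_trans]
  right_unitality A := by
    simp only [eqToIso.hom, rightUnitor_hom_eq, eqToHom_map,
      whiskerLeft_eqToHom, eqToHom_trans]

noncomputable instance (h : IsRescaling φ dL dR dL' dR' W) : h.functor.Monoidal :=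
  h.coreMonoidal.toMonoidal

theorem isStrict (h : IsRescaling φ dL dR dL' dR' W) : IsStrict h.functor :=
  ⟨⟨h.obj_unit, rfl⟩, fun A B => ⟨h.obj_tensor A B, rfl⟩⟩

theorem monoidallyEquivalent (h : IsRescaling φ dL dR dL' dR' W) :
    MonoidallyEquivalent (OCat dL dR) (OCat dL' dR') :=
  ⟨h.functor, ⟨inferInstance⟩, inferInstance, inferInstance, inferInstance⟩

end IsRescaling

/-! ### Construction of the equivalences. -/

theorem exists_sq_eq (z : ℂˣ) : ∃ s : ℂˣ, s ^ 2 = z := by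
  obtain ⟨s, hs⟩ := IsAlgClosed.exists_pow_nat_eq (z : ℂ) (n := 2) (by norm_num)
  have h0 : s ≠ 0 := by
    rintro rfl
    exact z.ne_zero (by rw [← hs]; norm_num)
  exact ⟨Units.mk0 s h0, Units.ext (by simpa using hs)⟩

/-- Rescaling by a power of the rotation number. -/
theorem isRescaling_rot {dL dR dL' dR' s : ℂˣ} (hR : dR = s ^ (2 : ℤ) * dR')
    (hL : dL = s ^ (-2 : ℤ) * dL') :
    IsRescaling 1 dL dR dL' dR' fun {u v} (D : Diagram u v) => s ^ (-D.rot) where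
  map_id w := by simp [Diagram.rot_id]
  map_comp D E := by
    rw [weight_eq_zpow_mul hR hL, Diagram.rot_comp, ← mul_assoc, ← Units.val_mul, ← Units.val_mul,
      ← zpow_add, ← zpow_add]
    simp only [Equiv.Perm.coe_one, Multiset.map_id]
    congr 3
    ring
  map_tensor D E := by rw [Diagram.rot_tensor, neg_add, zpow_add]

/-- Rescaling by a power of the difference of the numbers of upper and lower points. -/
theorem isRescaling_length {φ : Equiv.Perm Letter} {dL dR dL' dR' : ℂˣ}
    (hw : ∀ L, weight dL dR L = weight dL' dR' (L.map φ)) (s : ℂˣ) :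
    IsRescaling φ dL dR dL' dR' fun {u v} _ => s ^ ((u.length : ℤ) - v.length) where
  map_id w := by simp
  map_comp D E := by
    rw [← hw, ← Units.val_mul, ← zpow_add]
    congr 3
    ring
  map_tensor D E := by
    rw [← zpow_add]
    congr 1
    push_cast [List.length_append]
    ring

/-- Reversing orientations exchanges clockwise and anticlockwise loops, which is harmless only if
both have the same value. -/
theorem weight_map_perm (d : ℂˣ) (φ : Equiv.Perm Letter) (L : Multiset Letter) :
    weight d d L = weight d d (L.map φ) := by
  simp [weight]

/-- The structure isomorphisms are transports and do not move the curves, so the scalar `W D` alone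
survives. -/
theorem IsRescaling.pairingImage_hom {φ : Equiv.Perm Letter} {dL dR dL' dR' : ℂˣ}
    {W : ∀ {u v : List Letter}, Diagram u v → ℂˣ} (h : IsRescaling φ dL dR dL' dR' W)
    {A B : OCat dL dR} (D : Diagram (A ⊗ B).word (𝟙_ (OCat dL dR)).word)
    (D' : Diagram (h.functor.obj A ⊗ h.functor.obj B).word (𝟙_ (OCat dL' dR')).word)
    (hD : D.σ = D'.σ) :
    pairingImage h.functor (D.hom : A ⊗ B ⟶ 𝟙_ _) = (W D : ℂ) • D'.hom := by
  change eqToHom (h.obj_tensor A B) ≫ h.functor.map D.hom ≫ eqToHom h.obj_unit.symm = _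
  rw [h.map_hom, Linear.smul_comp, Linear.comp_smul]
  congr 1
  rw [Diagram.hom_comp_eqToHom (h.diagram D) h.obj_unit.symm (h.diagram D) rfl]
  exact Diagram.eqToHom_comp_hom _ _ _ hD

theorem exists_scalesArcs (d z : ℂˣ) :
    ∃ (F : OCat d d ⥤ OCat d d) (_ : F.Monoidal), F.Additive ∧ F.Linear ℂ ∧
      F.IsEquivalence ∧ IsStrict F ∧ ScalesArcs F z := by
  -- A basic arc has two upper points and no lower one, so its weight is `s ^ 2`; hence the square
  -- root of the prescribed scalar.
  obtain ⟨s, rfl⟩ := exists_sq_eq z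
  have h := isRescaling_length (weight_map_perm d 1) s
  refine ⟨h.functor, inferInstance, inferInstance, inferInstance, inferInstance, h.isStrict,
    rfl, rfl, ?_, ?_⟩
  · refine (h.pairingImage_hom (A := objX d d) (B := objXs d d) (arc .X .Xs (by decide))
      (arc .X .Xs (by decide)) rfl).trans ?_
    rw [Linear.comp_smul]
    exact congrArg₂ _ rfl (Diagram.eqToHom_comp_hom _ _ _ rfl).symm
  · refine (h.pairingImage_hom (A := objXs d d) (B := objX d d) (arc .Xs .X (by decide))
      (arc .Xs .X (by decide)) rfl).trans ?_
    rw [Linear.comp_smul]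
    exact congrArg₂ _ rfl (Diagram.eqToHom_comp_hom _ _ _ rfl).symm

theorem exists_swapsArcs (d z : ℂˣ) :
    ∃ (F : OCat d d ⥤ OCat d d) (_ : F.Monoidal), F.Additive ∧ F.Linear ℂ ∧
      F.IsEquivalence ∧ IsStrict F ∧ SwapsArcs F z := by
  obtain ⟨s, rfl⟩ := exists_sq_eq z
  have h := isRescaling_length (weight_map_perm d (Equiv.swap .X .Xs)) s
  refine ⟨h.functor, inferInstance, inferInstance, inferInstance, inferInstance, h.isStrict,
    rfl, rfl, ?_, ?_⟩
  · refine (h.pairingImage_hom (A := objX d d) (B := objXs d d) (arc .X .Xs (by decide))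
      (arc .Xs .X (by decide)) rfl).trans ?_
    rw [Linear.comp_smul]
    exact congrArg₂ _ rfl (Diagram.eqToHom_comp_hom _ _ _ rfl).symm
  · refine (h.pairingImage_hom (A := objXs d d) (B := objX d d) (arc .Xs .X (by decide))
      (arc .X .Xs (by decide)) rfl).trans ?_
    rw [Linear.comp_smul]
    exact congrArg₂ _ rfl (Diagram.eqToHom_comp_hom _ _ _ rfl).symm

theorem monoidallyEquivalent_of_mul_eq {dL dR dL' dR' : ℂˣ} (h : dL * dR = dL' * dR') :
    MonoidallyEquivalent (OCat dL dR) (OCat dL' dR') := by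
  -- This choice of `s` corrects the clockwise value; the equality of the products then corrects the
  -- anticlockwise one.
  obtain ⟨s, hs⟩ := exists_sq_eq (dR / dR')
  have hR : dR = s ^ (2 : ℤ) * dR' := by
    rw [zpow_ofNat, hs, div_mul_cancel]
  refine (isRescaling_rot (s := s) hR ?_).monoidallyEquivalent
  rw [zpow_neg, zpow_ofNat, hs, inv_div, div_mul_eq_mul_div, eq_div_iff_mul_eq', h,
    mul_comm]

/-! ### The arcs as duality data. -/

open Functor.LaxMonoidal Functor.OplaxMonoidal

/-- The string joining the first two points of the lower line. -/
def coarcMap (x : Pt) : Pt := if x = (1, 0) then (1, 1) else if x = (1, 1) then (1, 0) else x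

/-- The diagram consisting of one arc joining the two points of the lower line. -/
def coarc (a b : Letter) (h : a ≠ b) : Diagram [] [a, b] where
  σ := coarcMap
  planar := by
    refine ⟨?_, ?_, ?_, ?_⟩
    · intro x
      unfold coarcMap
      grind
    · rintro ⟨_ | _ | l, _ | _ | i⟩ <;> simp [coarcMap, dir]
    · rintro ⟨_ | _ | l, _ | _ | i⟩ <;> cases a <;> cases b <;> simp [coarcMap, dir] at h ⊢
    · intro x y
      unfold coarcMap before
      grind

/-- Two points can only be joined to each other. Hence the Hom spaces concerned are at most
one-dimensional, and identities between such diagrams reduce to counting loops. -/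
theorem Diagram.eq_of_length_add {u v : List Letter} (h : u.length + v.length = 2)
    (D E : Diagram u v) : D = E := by
  have huv : (u.length = 0 ∧ v.length = 2) ∨ (u.length = 1 ∧ v.length = 1) ∨
    (u.length = 2 ∧ v.length = 0) := by omega
  apply Diagram.ext
  funext ⟨l, i⟩
  have d1 := D.cases (l, i)
  have e1 := E.cases (l, i)
  have nD := D.planar.ne (l, i)
  have nE := E.planar.ne (l, i)
  have hd : dir u v (l, i) ≠ none ↔ (l = 0 ∧ i < u.length ∨ l = 1 ∧ i < v.length) := by
    unfold dir
    rcases l with _ | _ | l <;> simp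
  generalize D.σ (l, i) = x at *
  generalize E.σ (l, i) = y at *
  rcases x with ⟨x1, x2⟩
  rcases y with ⟨y1, y2⟩
  grind

theorem Diagram.eq_id_nil (D : Diagram [] []) : D = Diagram.id [] := by
  apply Diagram.ext
  funext x
  have h1 := D.cases x
  have h2 := (Diagram.id []).cases x
  simp at h1 h2
  exact h1.trans h2.symm

/-- The gluing procedure is computable, so the loops are found by evaluation. The curves themselves
need no computation, by `Diagram.eq_of_length_add`. -/
theorem loops_zigzag (a b : Letter) (h : a ≠ b) :
    (((Diagram.id [b]).tensor (coarc a b h)).glued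
      ((arc b a h.symm).tensor (Diagram.id [b]))).loops = 0 := by
  cases a <;> cases b <;> first | exact absurd rfl h | rfl

theorem loops_zigzag' (a b : Letter) (h : a ≠ b) :
    (((coarc a b h).tensor (Diagram.id [a])).glued
      ((Diagram.id [a]).tensor (arc b a h.symm))).loops = 0 := by
  cases a <;> cases b <;> first | exact absurd rfl h | rfl

/-- The second gluing step closes the loop, so the recorded letter is the right one, `b`. -/
theorem loops_circle (a b : Letter) (h : a ≠ b) :
    ((coarc a b h).glued (arc a b h)).loops = {b} := by
  cases a <;> cases b <;> first | exact absurd rfl h | rfl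

/-- The copairing of the images belonging to the copairing `f`, by means of the structure
isomorphisms of `F`. -/
def copairingImage {C D : Type*} [Category* C] [MonoidalCategory C] [Category* D]
    [MonoidalCategory D] (F : C ⥤ D) [F.Monoidal] {A B : C} (f : 𝟙_ C ⟶ A ⊗ B) :
    𝟙_ D ⟶ F.obj A ⊗ F.obj B :=
  ε F ≫ F.map f ≫ δ F A B

/-- Monoidal functors preserve duality. One of the two zigzag identities is enough here, since it
already ties the scalar of the copairing to that of the pairing. -/
theorem zigzag_map {C D : Type*} [Category* C] [MonoidalCategory C] [Category* D]
    [MonoidalCategory D] (F : C ⥤ D) [F.Monoidal] {A B : C} (c : 𝟙_ C ⟶ A ⊗ B) (e : B ⊗ A ⟶ 𝟙_ C)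
    (h : B ◁ c ≫ (α_ B A B).inv ≫ e ▷ B = (ρ_ B).hom ≫ (λ_ B).inv) :
    F.obj B ◁ copairingImage F c ≫ (α_ _ _ _).inv ≫ pairingImage F e ▷ F.obj B =
      (ρ_ _).hom ≫ (λ_ _).inv := by
  -- The image of `h` under `F`, with structure isomorphisms attached at both ends so that all of
  -- them cancel in pairs.
  have h' := congrArg (fun f => F.obj B ◁ ε F ≫ μ F _ _ ≫ F.map f ≫ δ F _ _ ≫ η F ▷ F.obj B) h
  simp only [Functor.map_comp, Functor.Monoidal.map_whiskerLeft, Functor.Monoidal.map_whiskerRight,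
    Functor.Monoidal.map_associator_inv, Functor.Monoidal.map_leftUnitor_inv,
    Functor.Monoidal.map_rightUnitor, Category.assoc, Functor.Monoidal.μ_δ_assoc,
    Functor.Monoidal.whiskerLeft_ε_η_assoc, Functor.Monoidal.whiskerRight_ε_η,
    Category.comp_id] at h'
  simpa only [pairingImage, copairingImage, whiskerLeft_comp, comp_whiskerRight, Category.assoc] using h'

section Letters

variable {dL dR : ℂˣ}

/-- The object given by a single letter. -/
def letterObj (dL dR : ℂˣ) (a : Letter) : OCat dL dR := ⟨[a]⟩

/-- The basic arc on the upper line. -/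
noncomputable def ev (dL dR : ℂˣ) (a b : Letter) (h : a ≠ b) :
    letterObj dL dR a ⊗ letterObj dL dR b ⟶ 𝟙_ (OCat dL dR) :=
  Diagram.hom (A := letterObj dL dR a ⊗ letterObj dL dR b) (B := 𝟙_ _) (arc a b h)

/-- The basic arc on the lower line. -/
noncomputable def coev (dL dR : ℂˣ) (a b : Letter) (h : a ≠ b) :
    𝟙_ (OCat dL dR) ⟶ letterObj dL dR a ⊗ letterObj dL dR b :=
  Diagram.hom (A := 𝟙_ _) (B := letterObj dL dR a ⊗ letterObj dL dR b) (coarc a b h)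

theorem exists_eq_smul_hom {A B : OCat dL dR} (h : A.word.length + B.word.length = 2)
    (D : Diagram A.word B.word) (f : A ⟶ B) : ∃ c : ℂ, f = c • D.hom := by
  induction f using hom_induction with
  | zero => exact ⟨0, (zero_smul _ _).symm⟩
  | add f g hf hg =>
    obtain ⟨c, rfl⟩ := hf
    obtain ⟨c', rfl⟩ := hg
    exact ⟨c + c', (add_smul _ _ _).symm⟩
  | smul_hom a E => exact ⟨a, by rw [Diagram.eq_of_length_add h D E]⟩

theorem Diagram.hom_comp_hom_of_loops {A B C : OCat dL dR} {D : Diagram A.word B.word}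
    {E : Diagram B.word C.word} {F : Diagram A.word C.word} {L : Multiset Letter}
    (hl : (D.glued E).loops = L) (hF : D.comp E = F) :
    (D.hom : A ⟶ B) ≫ (E.hom : B ⟶ C) = weight dL dR L • F.hom := by
  rw [hom_comp_hom, hl, hF]

theorem eqToHom_eq_hom {A B : OCat dL dR} (h : A = B) (D : Diagram A.word B.word)
    (hD : D.σ = idMap B.word.length) : eqToHom h = D.hom := by
  rw [← Category.comp_id (eqToHom h), ← Diagram.hom_id]
  exact Diagram.eqToHom_comp_hom _ _ _ hD.symm

theorem zigzag_left (a b : Letter) (h : a ≠ b) :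
    letterObj dL dR b ◁ coev dL dR a b h ≫ (α_ _ _ _).inv ≫
      ev dL dR b a h.symm ▷ letterObj dL dR b = (ρ_ _).hom ≫ (λ_ _).inv := by
  rw [← id_tensorHom, ← tensorHom_id]
  refine (congrArg₂ _ (Diagram.hom_tensor_hom (A := letterObj dL dR b) (B := letterObj dL dR b)
    (A' := 𝟙_ _) (B' := letterObj dL dR a ⊗ letterObj dL dR b) (Diagram.id [b]) (coarc a b h))
    ((congrArg _ (Diagram.hom_tensor_hom (A' := letterObj dL dR b) (B' := letterObj dL dR b)
    (B := 𝟙_ _) (A := letterObj dL dR b ⊗ letterObj dL dR a) (arc b a h.symm) (Diagram.id [b]))).trans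
    (Diagram.eqToHom_comp_hom
    (A := letterObj dL dR b ⊗ letterObj dL dR a ⊗ letterObj dL dR b)
    (B := (letterObj dL dR b ⊗ letterObj dL dR a) ⊗ letterObj dL dR b)
    (C := 𝟙_ _ ⊗ letterObj dL dR b) ((arc b a h.symm).tensor (Diagram.id [b])) rfl
    ((arc b a h.symm).tensor (Diagram.id [b])) rfl))).trans ?_
  refine (Diagram.hom_comp_hom_of_loops (A := letterObj dL dR b ⊗ 𝟙_ _)
    (B := letterObj dL dR b ⊗ letterObj dL dR a ⊗ letterObj dL dR b)
    (C := 𝟙_ _ ⊗ letterObj dL dR b) (D := (Diagram.id [b]).tensor (coarc a b h))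
    (E := (arc b a h.symm).tensor (Diagram.id [b])) (F := Diagram.id [b]) (loops_zigzag a b h)
    (Diagram.eq_of_length_add rfl _ _)).trans ?_
  rw [rightUnitor_hom_eq, leftUnitor_inv_eq, eqToHom_trans,
    show weight dL dR 0 = 1 by simp [weight], one_smul]
  exact (eqToHom_eq_hom (A := letterObj dL dR b ⊗ 𝟙_ _) (B := 𝟙_ _ ⊗ letterObj dL dR b) rfl (Diagram.id [b]) rfl).symm

theorem zigzag_right (a b : Letter) (h : a ≠ b) :
    coev dL dR a b h ▷ letterObj dL dR a ≫ (α_ _ _ _).hom ≫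
      letterObj dL dR a ◁ ev dL dR b a h.symm = (λ_ _).hom ≫ (ρ_ _).inv := by
  rw [← id_tensorHom, ← tensorHom_id]
  refine (congrArg₂ _ (Diagram.hom_tensor_hom (A' := letterObj dL dR a) (B' := letterObj dL dR a)
    (A := 𝟙_ _) (B := letterObj dL dR a ⊗ letterObj dL dR b) (coarc a b h) (Diagram.id [a]))
    ((congrArg _ (Diagram.hom_tensor_hom (A := letterObj dL dR a) (B := letterObj dL dR a)
    (B' := 𝟙_ _) (A' := letterObj dL dR b ⊗ letterObj dL dR a) (Diagram.id [a])
    (arc b a h.symm))).trans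
    (Diagram.eqToHom_comp_hom
    (A := (letterObj dL dR a ⊗ letterObj dL dR b) ⊗ letterObj dL dR a)
    (B := letterObj dL dR a ⊗ letterObj dL dR b ⊗ letterObj dL dR a)
    (C := letterObj dL dR a ⊗ 𝟙_ _) ((Diagram.id [a]).tensor (arc b a h.symm)) rfl
    ((Diagram.id [a]).tensor (arc b a h.symm)) rfl))).trans ?_
  refine (Diagram.hom_comp_hom_of_loops (C := letterObj dL dR a ⊗ 𝟙_ _)
    (B := (letterObj dL dR a ⊗ letterObj dL dR b) ⊗ letterObj dL dR a)
    (A := 𝟙_ _ ⊗ letterObj dL dR a) (D := (coarc a b h).tensor (Diagram.id [a]))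
    (E := (Diagram.id [a]).tensor (arc b a h.symm)) (F := Diagram.id [a]) (loops_zigzag' a b h)
    (Diagram.eq_of_length_add rfl _ _)).trans ?_
  rw [leftUnitor_hom_eq, rightUnitor_inv_eq, eqToHom_trans,
    show weight dL dR 0 = 1 by simp [weight], one_smul]
  exact (eqToHom_eq_hom (A := 𝟙_ _ ⊗ letterObj dL dR a) (B := letterObj dL dR a ⊗ 𝟙_ _) rfl (Diagram.id [a]) rfl).symm

theorem coev_ev (a b : Letter) (h : a ≠ b) :
    coev dL dR a b h ≫ ev dL dR a b h = weight dL dR {b} • 𝟙 (𝟙_ (OCat dL dR)) :=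
  Diagram.hom_comp_hom_of_loops (A := 𝟙_ (OCat dL dR)) (C := 𝟙_ (OCat dL dR))
    (B := letterObj dL dR a ⊗ letterObj dL dR b) (F := Diagram.id []) (loops_circle a b h)
    (Diagram.eq_id_nil _)

/-- Letters `a ≠ b` are dual to each other. -/
@[reducible]
noncomputable def exactPairing (a b : Letter) (h : a ≠ b) :
    ExactPairing (letterObj dL dR a) (letterObj dL dR b) where
  coevaluation' := coev dL dR a b h
  evaluation' := ev dL dR b a h.symm
  coevaluation_evaluation' := zigzag_left a b h
  evaluation_coevaluation' := zigzag_right a b h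

theorem hom_ne_zero_of_isIso {A B : OCat dL dR} (f : A ⟶ B) [IsIso f] : f ≠ 0 := by
  rintro rfl
  have h : (𝟙 A : A ⟶ A) = 0 := by rw [← IsIso.hom_inv_id (0 : A ⟶ B), Limits.zero_comp]
  exact Diagram.hom_ne_zero (Diagram.id A.word) h

/-- A dual pair formed by two different letters consists of the basic arcs, up to a scalar and
its inverse. -/
theorem exists_smul_ev_of_zigzag {A B : OCat dL dR} {a b : Letter} (h : a ≠ b)
    (hA : A = letterObj dL dR a) (hB : B = letterObj dL dR b) (c : 𝟙_ _ ⟶ A ⊗ B) (e : B ⊗ A ⟶ 𝟙_ _)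
    (hz : B ◁ c ≫ (α_ B A B).inv ≫ e ▷ B = (ρ_ B).hom ≫ (λ_ B).inv) :
    ∃ z : ℂˣ, e = eqToHom (by rw [hA, hB]) ≫ ((z : ℂ) • ev dL dR b a h.symm) ∧
      c = ((z : ℂ)⁻¹ • coev dL dR a b h) ≫ eqToHom (by rw [hA, hB]) := by
  subst hA hB
  obtain ⟨z, rfl⟩ := exists_eq_smul_hom (A := letterObj dL dR b ⊗ letterObj dL dR a) (B := 𝟙_ _)
    rfl (arc b a h.symm) e
  obtain ⟨y, rfl⟩ := exists_eq_smul_hom (B := letterObj dL dR a ⊗ letterObj dL dR b) (A := 𝟙_ _)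
    rfl (coarc a b h) c
  change letterObj dL dR b ◁ (y • coev dL dR a b h) ≫ (α_ _ _ _).inv ≫
    (z • ev dL dR b a h.symm) ▷ letterObj dL dR b = _ at hz
  rw [MonoidalLinear.whiskerLeft_smul, MonoidalLinear.smul_whiskerRight, Linear.comp_smul,
    Linear.smul_comp, Linear.comp_smul, zigzag_left, smul_smul] at hz
  -- The zigzag of the scaled arcs is `z * y` times that of the arcs themselves, which is an
  -- isomorphism and therefore nonzero.
  have hzy : z * y = 1 := by
    by_contra hne
    have h0 : (z * y - 1) • ((ρ_ (letterObj dL dR b)).hom ≫ (λ_ (letterObj dL dR b)).inv) = 0 := by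
      rw [sub_smul, mul_comm z y, hz, one_smul, sub_self]
    exact hom_ne_zero_of_isIso _ ((smul_eq_zero.1 h0).resolve_left (sub_ne_zero.2 hne))
  refine ⟨Units.mk0 z (left_ne_zero_of_mul_eq_one hzy), ?_, ?_⟩
  · rw [eqToHom_refl, Category.id_comp]
    rfl
  · rw [eqToHom_refl, Category.comp_id, Units.val_mk0, ← eq_inv_of_mul_eq_one_right hzy]
    rfl

end Letters

/-! ### Effect of an equivalence on letters, arcs and loop values. -/

theorem copairingImage_comp_pairingImage {C D : Type*} [Category* C] [MonoidalCategory C]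
    [Category* D] [MonoidalCategory D] (F : C ⥤ D) [F.Monoidal] {A B : C} (c : 𝟙_ C ⟶ A ⊗ B)
    (e : A ⊗ B ⟶ 𝟙_ C) :
    copairingImage F c ≫ pairingImage F e = ε F ≫ F.map (c ≫ e) ≫ η F := by
  simp [copairingImage, pairingImage]

section Equivalences

variable {dL dR dL' dR' : ℂˣ}

theorem exists_smul_ev (F : OCat dL dR ⥤ OCat dL' dR') [F.Monoidal] {a b a' b' : Letter}
    (h : a ≠ b) (h' : a' ≠ b') (ha : F.obj (letterObj dL dR a) = letterObj dL' dR' a')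
    (hb : F.obj (letterObj dL dR b) = letterObj dL' dR' b') :
    ∃ z : ℂˣ, pairingImage F (ev dL dR b a h.symm) =
        eqToHom (by rw [ha, hb]) ≫ ((z : ℂ) • ev dL' dR' b' a' h'.symm) ∧
      copairingImage F (coev dL dR a b h) =
        ((z : ℂ)⁻¹ • coev dL' dR' a' b' h') ≫ eqToHom (by rw [ha, hb]) :=
  exists_smul_ev_of_zigzag h' ha hb _ _ (zigzag_map F _ _ (zigzag_left a b h))

/-- Both sides are the image under `F` of one circle, read as a scalar endomorphism of the unit
object. -/
theorem weight_eq_of_smul_ev (F : OCat dL dR ⥤ OCat dL' dR') [F.Monoidal] [F.Linear ℂ]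
    {a b a' b' : Letter} (h : a ≠ b) (h' : a' ≠ b')
    (ha : F.obj (letterObj dL dR a) = letterObj dL' dR' a')
    (hb : F.obj (letterObj dL dR b) = letterObj dL' dR' b') {y z : ℂ}
    (hy : pairingImage F (ev dL dR a b h) = eqToHom (by rw [ha, hb]) ≫ (y • ev dL' dR' a' b' h'))
    (hz : copairingImage F (coev dL dR a b h) =
        (z • coev dL' dR' a' b' h') ≫ eqToHom (by rw [ha, hb])) :
    weight dL dR {b} = z * y * weight dL' dR' {b'} := by
  have key := copairingImage_comp_pairingImage F (coev dL dR a b h) (ev dL dR a b h)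
  rw [hy, hz, coev_ev, F.map_smul, F.map_id] at key
  simp only [Linear.smul_comp, Linear.comp_smul, Category.id_comp, Category.assoc,
    eqToHom_trans_assoc, eqToHom_refl, Functor.Monoidal.ε_η, coev_ev, smul_smul] at key
  have := smul_left_injective ℂ (hom_ne_zero_of_isIso (𝟙 (𝟙_ (OCat dL' dR')))) key
  linear_combination -this

/-- An object with scalar endomorphisms only is a power of one letter. -/
theorem eq_of_forall_eq_smul_id {B : OCat dL dR} (hB : ∀ f : B ⟶ B, ∃ c : ℂ, f = c • 𝟙 B)
    {u v : List Letter} {a b : Letter} (hw : B.word = u ++ ([a, b] ++ v)) : a = b := by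
  by_contra h
  rcases B with ⟨w⟩
  subst hw
  -- Caps off the neighbours `a` and `b` and creates them again. This diagram differs from the
  -- identity, and distinct diagrams are linearly independent.
  let E : Diagram (u ++ ([a, b] ++ v)) (u ++ ([a, b] ++ v)) :=
    (Diagram.id u).tensor (Diagram.tensor (u := [a, b]) (u' := [a, b])
      ((arc a b h).tensor (coarc a b h)) (Diagram.id v))
  obtain ⟨c, hc⟩ := hB (Diagram.hom (A := ⟨u ++ ([a, b] ++ v)⟩) (B := ⟨u ++ ([a, b] ++ v)⟩) E)
  have hE : E ≠ Diagram.id _ := by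
    intro he
    have := congrArg (fun D : Diagram _ _ => D.σ (0, u.length)) he
    simp [E, Diagram.tensor, juxt, lens, arc, arcMap, Diagram.id, idMap] at this
  have h1 := DFunLike.congr_fun (show Finsupp.single E (1 : ℂ) =
    c • Finsupp.single (Diagram.id (u ++ ([a, b] ++ v))) (1 : ℂ) from hc) E
  rw [Finsupp.smul_single, Finsupp.single_eq_same, Finsupp.single_eq_of_ne hE] at h1
  exact one_ne_zero h1

theorem charge_cons_eq_of_constant {a : Letter} {w : List Letter}
    (h : ∀ u v b c, a :: w = u ++ ([b, c] ++ v) → b = c) :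
    charge (a :: w) = a.sign * (w.length + 1) := by
  induction w generalizing a with
  | nil => simp
  | cons b w ih =>
    have hab : a = b := h [] w a b rfl
    rw [charge_cons, ih fun u v b' c' hh => h (a :: u) v b' c' (by rw [hh]; rfl), hab,
      List.length_cons]
    push_cast
    ring

/-- An object of charge `±1` with scalar endomorphisms only is a letter. -/
theorem exists_eq_letterObj {B : OCat dL dR} (hB : ∀ f : B ⟶ B, ∃ c : ℂ, f = c • 𝟙 B)
    (hc : IsUnit (charge B.word)) : ∃ a, B = letterObj dL dR a := by
  rcases B with ⟨_ | ⟨a, w⟩⟩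
  · simp at hc
  · have h := charge_cons_eq_of_constant fun u v b c hw => eq_of_forall_eq_smul_id hB hw
    -- A power of one letter has charge plus or minus its length, so the charge is a unit only for
    -- length one.
    rw [h] at hc
    have h1 := isUnit_of_mul_isUnit_right hc
    rw [Int.isUnit_iff] at h1
    have h2 : w = [] := List.eq_nil_of_length_eq_zero (by omega)
    exact ⟨a, by rw [h2]; rfl⟩

theorem charge_eq_of_isIso {A B : OCat dL dR} (f : A ⟶ B) [IsIso f] :
    charge A.word = charge B.word :=
  charge_eq_of_ne_zero (hom_ne_zero_of_isIso f)

theorem charge_tensor (A B : OCat dL dR) :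
    charge (A ⊗ B).word = charge A.word + charge B.word :=
  charge_append _ _

/-- Faithfulness keeps the image of the arc nonzero, so its source has the charge of the unit
object. -/
theorem charge_obj_add (F : OCat dL dR ⥤ OCat dL' dR') [F.Monoidal] [F.Faithful] [F.Additive]
    {a b : Letter} (h : a ≠ b) :
    charge (F.obj (letterObj dL dR a)).word + charge (F.obj (letterObj dL dR b)).word = 0 := by
  rw [← charge_tensor]
  refine charge_eq_of_ne_zero (B := 𝟙_ _) (f := pairingImage F (ev dL dR a b h)) ?_
  intro h0
  have h1 : F.map (ev dL dR a b h) = 0 := by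
    have := congrArg (fun f => δ F _ _ ≫ f ≫ ε F) h0
    simpa [pairingImage] using this
  exact Diagram.hom_ne_zero _ (F.map_injective (h1.trans (F.map_zero _ _).symm))

/-- The charge is additive along the isomorphisms `μ`, and the two letters go to opposite charges,
so `F` multiplies every charge by the same integer. -/
theorem charge_obj (F : OCat dL dR ⥤ OCat dL' dR') [F.Monoidal] [F.Faithful] [F.Additive]
    (A : OCat dL dR) : charge (F.obj A).word =
      charge A.word * charge (F.obj (letterObj dL dR .X)).word := by
  rcases A with ⟨w⟩
  induction w with
  | nil => exact (charge_eq_of_isIso (ε F)).symm.trans (zero_mul _).symm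
  | cons a w ih =>
    have h1 := charge_eq_of_isIso (μ F (letterObj dL dR a) ⟨w⟩)
    rw [charge_tensor, ih] at h1
    refine h1.symm.trans ?_
    rw [charge_cons, add_mul]
    congr 1
    have := charge_obj_add F (a := .X) (b := .Xs) (by decide)
    cases a <;> simp only [Letter.sign] <;> linarith

/-- Fullness passes the scalar endomorphisms of a letter on to its image, and essential surjectivity
makes the charge of the image a unit; together these leave only single letters. Opposite charges
make the two images different. -/
theorem exists_obj_eq_letterObj (F : OCat dL dR ⥤ OCat dL' dR') [F.Monoidal] [F.Additive]
    [F.Linear ℂ] [F.IsEquivalence] : ∃ a b : Letter, a ≠ b ∧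
      F.obj (letterObj dL dR .X) = letterObj dL' dR' a ∧
      F.obj (letterObj dL dR .Xs) = letterObj dL' dR' b := by
  have scal : ∀ (a : Letter) (f : F.obj (letterObj dL dR a) ⟶ F.obj (letterObj dL dR a)),
      ∃ c : ℂ, f = c • 𝟙 _ := by
    intro a f
    obtain ⟨g, rfl⟩ := F.map_surjective f
    obtain ⟨c, rfl⟩ := exists_eq_smul_hom (A := letterObj dL dR a) (B := letterObj dL dR a) rfl
      (Diagram.id [a]) g
    exact ⟨c, (F.map_smul _ _).trans (congrArg _ (F.map_id _))⟩
  -- Some object is sent to a copy of `X`, so its charge times that of `F(X)` equals `1`.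
  have hX : IsUnit (charge (F.obj (letterObj dL dR .X)).word) := by
    have h := charge_eq_of_isIso (F.objObjPreimageIso (letterObj dL' dR' .X)).hom
    rw [charge_obj] at h
    exact IsUnit.of_mul_eq_one_right _ (h.trans (by simp [letterObj, Letter.sign]))
  have hs := charge_obj_add F (a := .X) (b := .Xs) (by decide)
  have hXs : IsUnit (charge (F.obj (letterObj dL dR .Xs)).word) := by
    rw [← neg_eq_of_add_eq_zero_right hs]
    exact hX.neg
  obtain ⟨a, ha⟩ := exists_eq_letterObj (scal .X) hX
  obtain ⟨b, hb⟩ := exists_eq_letterObj (scal .Xs) hXs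
  refine ⟨a, b, ?_, ha, hb⟩
  rintro rfl
  rw [ha, hb] at hs
  cases a <;> simp [letterObj, Letter.sign] at hs

/-- The arcs form two dual pairs, each with one free scalar. A circle takes its upper arc from one
pair and its lower arc from the other, which explains the mixed factors `z⁻¹ * y` and `y⁻¹ * z`. -/
theorem exists_smul_ev_and_weight (F : OCat dL dR ⥤ OCat dL' dR') [F.Monoidal] [F.Linear ℂ]
    {a b : Letter} (h : a ≠ b) (ha : F.obj (letterObj dL dR .X) = letterObj dL' dR' a)
    (hb : F.obj (letterObj dL dR .Xs) = letterObj dL' dR' b) :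
    ∃ y z : ℂˣ, pairingImage F (ev dL dR .X .Xs (by decide)) =
        eqToHom (by rw [ha, hb]) ≫ ((y : ℂ) • ev dL' dR' a b h) ∧
      pairingImage F (ev dL dR .Xs .X (by decide)) =
        eqToHom (by rw [ha, hb]) ≫ ((z : ℂ) • ev dL' dR' b a h.symm) ∧
      (dL : ℂ) = (z : ℂ)⁻¹ * y * weight dL' dR' {b} ∧
      (dR : ℂ) = (y : ℂ)⁻¹ * z * weight dL' dR' {a} := by
  obtain ⟨z, hz, hz'⟩ := exists_smul_ev F (a := .X) (b := .Xs) (by decide) h ha hb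
  obtain ⟨y, hy, hy'⟩ := exists_smul_ev F (a := .Xs) (b := .X) (by decide) h.symm hb ha
  refine ⟨y, z, hy, hz, ?_, ?_⟩
  · rw [← weight_eq_of_smul_ev F (by decide) h ha hb hy hz']
    simp [weight]
  · rw [← weight_eq_of_smul_ev F (by decide) h.symm hb ha hz hy']
    simp [weight]

theorem mul_eq_of_monoidallyEquivalent (h : MonoidallyEquivalent (OCat dL dR) (OCat dL' dR')) :
    dL * dR = dL' * dR' := by
  obtain ⟨F, ⟨_⟩, _, _, _⟩ := h
  obtain ⟨a, b, hab, ha, hb⟩ := exists_obj_eq_letterObj F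
  obtain ⟨y, z, -, -, h1, h2⟩ := exists_smul_ev_and_weight F hab ha hb
  apply Units.ext
  rw [Units.val_mul, Units.val_mul, h1, h2]
  have hy := y.ne_zero
  have hz := z.ne_zero
  cases a <;> cases b <;> simp [weight] at hab ⊢ <;> field_simp

theorem scalesArcs_or_swapsArcs {d : ℂˣ} (F : OCat d d ⥤ OCat d d) [F.Monoidal] [F.Additive]
    [F.Linear ℂ] [F.IsEquivalence] : ∃ z : ℂˣ, ScalesArcs F z ∨ SwapsArcs F z := by
  obtain ⟨a, b, hab, ha, hb⟩ := exists_obj_eq_letterObj F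
  obtain ⟨y, z, hy, hz, h1, -⟩ := exists_smul_ev_and_weight F hab ha hb
  -- With equal loop values on both sides the factor `z⁻¹ * y` must be `1`.
  have hyz : z = y := by
    have hd := d.ne_zero
    have hz := z.ne_zero
    have e : weight d d {b} = d := by simp [weight]
    rw [e] at h1
    apply Units.ext
    field_simp at h1
    exact h1
  subst hyz
  refine ⟨z, ?_⟩
  cases a <;> cases b <;> first | exact absurd rfl hab | skip
  · exact Or.inl ⟨ha, hb, hy, hz⟩
  · exact Or.inr ⟨ha, hb, hy, hz⟩

end Equivalences

/-! ### Cutting a diagram into arcs. -/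

theorem Diagram.exists_zero_eq {w : List Letter} (D : Diagram w []) {j : ℕ} (hj : j < w.length) :
    ∃ j' < w.length, D.σ (0, j) = (0, j') := by
  have := D.cases (0, j)
  grind

/-- The restriction of a diagram to a segment of the upper line that is a union of strings. -/
theorem Diagram.exists_restrict {p u q : List Letter} (D : Diagram (p ++ (u ++ q)) [])
    (h : ∀ j < u.length, ∃ j' < u.length, D.σ (0, p.length + j) = (0, p.length + j')) :
    ∃ E : Diagram u [], ∀ j < u.length,
      D.σ (0, p.length + j) = (0, p.length + (E.σ (0, j)).2) := by
  choose! f hf hf' using h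
  have inv := D.planar.invol
  have hff : ∀ j < u.length, f (f j) = j := by
    intro j hj
    have h1 := inv (0, p.length + j)
    rw [hf' j hj, hf' _ (hf j hj)] at h1
    simpa using h1
  have hd : ∀ j < u.length, dir u [] (0, j) = dir (p ++ (u ++ q)) [] (0, p.length + j) := by
    intro j hj
    simp only [dir, if_true]
    rw [List.getElem?_append_right (by simp), Nat.add_sub_cancel_left, List.getElem?_append_left hj]
  refine ⟨⟨fun x => if x.1 = 0 ∧ x.2 < u.length then (0, f x.2) else x, ?_⟩, ?_⟩
  · refine ⟨?_, ?_, ?_, ?_⟩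
    · rintro ⟨l, j⟩
      grind
    · rintro ⟨l, j⟩ hx
      unfold dir at hx
      grind
    · rintro ⟨l, j⟩
      by_cases hx : l = 0 ∧ j < u.length
      · obtain ⟨rfl, hj⟩ := hx
        have := D.planar.orient (0, p.length + j)
        rw [hf' j hj] at this
        simp only [hj, and_self, if_true]
        rw [hd _ hj, hd _ (hf j hj), this]
      · have : dir u [] (l, j) = none := by
          unfold dir
          grind
        simp [hx, this]
    · rintro ⟨l, j⟩ ⟨l', j'⟩ h1 h2 h3
      have nc := D.planar.noncross (0, p.length + j) (0, p.length + j')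
      have := hf' j
      have := hf' j'
      simp [before] at *
      grind
  · intro j hj
    simp [hj, hf' j hj]

/-- The arc connects the two strings of `M` that reach the lower line and leaves all others alone.
-/
theorem Diagram.comp_arc {m : List Letter} {a b : Letter} (h : a ≠ b) (M : Diagram m [a, b])
    {i k : ℕ} (hi : M.σ (1, 0) = (0, i)) (hk : M.σ (1, 1) = (0, k)) (j : ℕ) :
    (M.comp (arc a b h)).σ (0, j) =
      if j = i then (0, k) else if j = k then (0, i) else M.σ (0, j) := by
  have inv := M.planar.invol
  have h1 := inv (1, 0)
  have h2 := inv (1, 1)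
  have h3 := inv (0, j)
  have h4 := M.cases (0, j)
  rw [hi] at h1
  rw [hk] at h2
  have hik : i ≠ k := by
    rintro rfl
    rw [h1] at h2
    simp at h2
  simp only [Diagram.comp, relevel, Diagram.glued, glue, glueStep, arc, Equiv.symm_swap,
    Equiv.swap_apply_of_ne_of_ne (show (0 : ℕ) ≠ 1 by simp) (show (0 : ℕ) ≠ 3 by simp)]
  by_cases hji : j = i
  · subst hji
    simp [join, stack, arcMap, h1, hk, Equiv.swap_apply_def]
  · by_cases hjk : j = k
    · subst hjk
      simp [join, stack, arcMap, h2, hi, Equiv.swap_apply_def, hji]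
    · have e0 : M.σ (0, j) ≠ (1, 0) := by grind
      have e1 : M.σ (0, j) ≠ (1, 1) := by grind
      have e2 : (M.σ (0, j)).1 = 0 := by grind
      have e3 : M.σ (0, j) = (0, (M.σ (0, j)).2) := by grind
      generalize (M.σ (0, j)).2 = t at e3
      simp [join, stack, e3, Equiv.swap_apply_def, hji, hjk]

/-- The string starting or ending at the first point of the upper line cuts a diagram without lower
points into two such diagrams. -/
theorem Diagram.exists_factorization {a : Letter} {w : List Letter} (D : Diagram (a :: w) []) :
    ∃ (u v : List Letter) (b : Letter) (h : a ≠ b) (D₁ : Diagram u []) (D₂ : Diagram v []),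
      a :: w = ([a] ++ (u ++ [b])) ++ v ∧
      D.σ = ((Diagram.comp (w' := [a, b]) ((Diagram.id [a]).tensor (D₁.tensor (Diagram.id [b])))
        (arc a b h)).tensor D₂).σ := by
  obtain ⟨k, hk, hk'⟩ := D.exists_zero_eq (j := 0) (by simp)
  have inv := D.planar.invol
  have hk0 : D.σ (0, k) = (0, 0) := by rw [← hk', inv]
  have hne := D.planar.ne (0, 0) (by simp [dir])
  -- The first point is joined to the point `n + 1` of `a :: w`, that is, to the letter number `n`
  -- of `w`: the word splits into `a`, an inner part `u` of length `n`, the partner `b`, and the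
  -- rest `v`.
  obtain ⟨n, rfl⟩ : ∃ n, k = n + 1 := ⟨k - 1, by
    rcases k with _ | k
    · exact absurd hk' hne
    · rfl⟩
  have hn : n < w.length := by simpa using hk
  have hw : a :: w = ([a] ++ (w.take n ++ [w[n]])) ++ w.drop (n + 1) := by
    simp
  have hlen : (w.take n).length = n := by simp; omega
  have hab : a ≠ w[n] := by
    have := D.planar.orient (0, 0)
    rw [hk'] at this
    intro h
    simp [dir, hn, ← h] at this
  generalize w[n] = b at hw hab
  generalize w.take n = u at hw hlen
  generalize w.drop (n + 1) = v at hw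
  obtain rfl : w = u ++ ([b] ++ v) := by simpa using hw
  subst hlen
  -- Non-crossing with the string at the first point keeps the strings of the inner part inside.
  have in1 : ∀ j < u.length, ∃ j' < u.length, D.σ (0, [a].length + j) = (0, [a].length + j') := by
    intro j hj
    obtain ⟨j', h1, h2⟩ := D.exists_zero_eq (j := [a].length + j) (by simp; omega)
    have nc := D.planar.noncross (0, 0) (0, [a].length + j)
    have := inv (0, [a].length + j)
    rw [hk', h2] at nc
    simp [before] at nc
    refine ⟨j' - 1, ?_⟩
    grind
  -- The other points are paired among themselves, so what starts in `v` also ends there.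
  have in2 : ∀ j < v.length, ∃ j' < v.length, D.σ (0, (a :: (u ++ [b])).length + j) =
      (0, (a :: (u ++ [b])).length + j') := by
    intro j hj
    obtain ⟨j', h1, h2⟩ := D.exists_zero_eq (j := (a :: (u ++ [b])).length + j) (by simp; omega)
    have := in1 (j' - 1)
    have := inv (0, (a :: (u ++ [b])).length + j)
    simp at h1
    refine ⟨j' - (u.length + 2), ?_⟩
    grind
  obtain ⟨D₁, hD₁⟩ := Diagram.exists_restrict (p := [a]) (u := u) (q := [b] ++ v) D in1
  obtain ⟨D₂, hD₂⟩ := Diagram.exists_restrict (p := a :: (u ++ [b])) (u := v) (q := [])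
    (Diagram.cast (by simp) rfl D) in2
  refine ⟨u, v, b, hab, D₁, D₂, by simp, ?_⟩
  set M : Diagram ([a] ++ (u ++ [b])) [a, b] :=
    (Diagram.id [a]).tensor (D₁.tensor (Diagram.id [b])) with hM
  have m0 : M.σ (1, 0) = (0, 0) := by
    simp [hM, Diagram.tensor, juxt, lens, Diagram.id, idMap]
  have m1 : M.σ (1, 1) = (0, u.length + 1) := by
    simp [hM, Diagram.tensor, juxt, lens, Diagram.id, idMap]
  have key := M.comp_arc hab m0 m1
  funext ⟨l, j⟩
  rcases l with _ | l
  · have e : ∀ T : Diagram ([a] ++ (u ++ [b])) [], (T.tensor D₂).σ (0, j) =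
        if j < u.length + 2 then T.σ (0, j) else
          ((D₂.σ (0, j - (u.length + 2))).1, (D₂.σ (0, j - (u.length + 2))).2 +
            lens (a :: (u ++ [b])) [] (D₂.σ (0, j - (u.length + 2))).1) := by
      intro T
      simp [Diagram.tensor, juxt, lens, Nat.lt_succ_iff]
    rw [e, key]
    have mj : ∀ i < u.length, M.σ (0, 1 + i) = (0, 1 + (D₁.σ (0, i)).2) := by
      intro i hi
      obtain ⟨i', hi', h⟩ := D₁.exists_zero_eq hi
      simp [hM, Diagram.tensor, juxt, lens, hi, h, add_comm]
    by_cases h1 : j < u.length + 2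
    · rw [if_pos h1]
      by_cases h2 : j = 0
      · rw [if_pos h2, h2, hk']
      · rw [if_neg h2]
        by_cases h3 : j = u.length + 1
        · rw [if_pos h3, h3, hk0]
        · rw [if_neg h3]
          obtain ⟨i, rfl⟩ : ∃ i, j = 1 + i := ⟨j - 1, by omega⟩
          rw [mj i (by omega)]
          exact hD₁ i (by omega)
    · rw [if_neg h1]
      obtain ⟨i, rfl⟩ : ∃ i, j = u.length + 2 + i := ⟨j - (u.length + 2), by omega⟩
      rw [Nat.add_sub_cancel_left]
      by_cases hi : i < v.length
      · have h3 := hD₂ i hi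
        obtain ⟨i', hi', h⟩ := D₂.exists_zero_eq hi
        simp [Diagram.cast, h, lens] at h3 ⊢
        rw [h3, add_comm]
      · have c1 := D.cases (0, u.length + 2 + i)
        have c2 := D₂.cases (0, i)
        simp [hi] at c1 c2
        rw [c2]
        simp [lens]
        grind
  · have c1 := D.cases (l + 1, j)
    have c2 := ((M.comp (arc a b hab)).tensor D₂).cases (l + 1, j)
    simp at c1 c2
    rw [c1]
    exact c2.symm

/-! ### Agreement of strict functors on morphisms. -/

theorem eqToHom_tensor_eqToHom {C : Type*} [Category* C] [MonoidalCategory C] {A B A' B' : C}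
    (h : A = B) (h' : A' = B') :
    eqToHom h ⊗ₘ eqToHom h' = eqToHom (by rw [h, h'] : A ⊗ A' = B ⊗ B') := by
  subst h h'
  simp

section AgreeOn

variable {C D : Type*} [Category* C] [Category* D] {F G : C ⥤ D}

/-- Two functors with the same values on objects take the same value on the morphism `f`. -/
def AgreeOn (hobj : ∀ A, F.obj A = G.obj A) {A B : C} (f : A ⟶ B) : Prop :=
  F.map f = eqToHom (hobj A) ≫ G.map f ≫ eqToHom (hobj B).symm

variable {hobj : ∀ A, F.obj A = G.obj A}

theorem agreeOn_eqToHom {A B : C} (h : A = B) : AgreeOn hobj (eqToHom h) := by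
  subst h
  simp [AgreeOn]

theorem agreeOn_id (A : C) : AgreeOn hobj (𝟙 A) := agreeOn_eqToHom rfl

theorem AgreeOn.comp {A B B' : C} {f : A ⟶ B} {g : B ⟶ B'} (hf : AgreeOn hobj f)
    (hg : AgreeOn hobj g) : AgreeOn hobj (f ≫ g) := by
  unfold AgreeOn at *
  simp [hf, hg]

theorem agreeOn_zero [Preadditive C] [Preadditive D] [F.Additive] [G.Additive] {A B : C} :
    AgreeOn hobj (0 : A ⟶ B) := by
  simp [AgreeOn]

theorem AgreeOn.add [Preadditive C] [Preadditive D] [F.Additive] [G.Additive] {A B : C}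
    {f g : A ⟶ B} (hf : AgreeOn hobj f) (hg : AgreeOn hobj g) : AgreeOn hobj (f + g) := by
  unfold AgreeOn at *
  simp [hf, hg]

theorem AgreeOn.smul {R : Type*} [Semiring R] [Preadditive C] [Preadditive D] [Linear R C]
    [Linear R D] [F.Linear R] [G.Linear R] {A B : C} (r : R) {f : A ⟶ B} (hf : AgreeOn hobj f) :
    AgreeOn hobj (r • f) := by
  unfold AgreeOn at *
  simp [hf]

end AgreeOn

section Strict

variable {C D : Type*} [Category* C] [MonoidalCategory C] [Category* D] [MonoidalCategory D]
  {F G : C ⥤ D} [F.Monoidal] [G.Monoidal]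

theorem IsStrict.obj_tensor (hF : IsStrict F) (A B : C) : F.obj A ⊗ F.obj B = F.obj (A ⊗ B) :=
  (hF.2 A B).1

theorem IsStrict.obj_unit (hF : IsStrict F) : 𝟙_ D = F.obj (𝟙_ C) := hF.1.1

theorem IsStrict.μ_eq (hF : IsStrict F) (A B : C) : μ F A B = eqToHom (hF.obj_tensor A B) :=
  (hF.2 A B).2

theorem IsStrict.ε_eq (hF : IsStrict F) : ε F = eqToHom hF.obj_unit := hF.1.2

theorem IsStrict.δ_eq (hF : IsStrict F) (A B : C) :
    δ F A B = eqToHom (hF.obj_tensor A B).symm := by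
  rw [← cancel_epi (μ F A B), Functor.Monoidal.μ_δ, hF.μ_eq, eqToHom_trans, eqToHom_refl]

theorem IsStrict.η_eq (hF : IsStrict F) : η F = eqToHom hF.obj_unit.symm := by
  rw [← cancel_epi (ε F), Functor.Monoidal.ε_η, hF.ε_eq, eqToHom_trans, eqToHom_refl]

variable {hobj : ∀ A, F.obj A = G.obj A}

theorem AgreeOn.tensor (hF : IsStrict F) (hG : IsStrict G) {A B A' B' : C} {f : A ⟶ B}
    {g : A' ⟶ B'} (hf : AgreeOn hobj f) (hg : AgreeOn hobj g) : AgreeOn hobj (f ⊗ₘ g) := by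
  unfold AgreeOn at *
  rw [Functor.Monoidal.map_tensor, Functor.Monoidal.map_tensor, hf, hg, hF.δ_eq, hG.δ_eq,
    hF.μ_eq, hG.μ_eq, ← tensorHom_comp_tensorHom, ← tensorHom_comp_tensorHom,
    eqToHom_tensor_eqToHom, eqToHom_tensor_eqToHom]
  simp

/-- `H.map f` can be recovered from `pairingImage H f` by the structure isomorphisms, which for
strict functors are transports. -/
theorem agreeOn_of_pairingImage (hF : IsStrict F) (hG : IsStrict G) {A B : C} {f : A ⊗ B ⟶ 𝟙_ C}
    {Y : D} (hY : F.obj A ⊗ F.obj B = Y) (hY' : G.obj A ⊗ G.obj B = Y) {p : Y ⟶ 𝟙_ D}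
    (h : pairingImage F f = eqToHom hY ≫ p) (h' : pairingImage G f = eqToHom hY' ≫ p) :
    AgreeOn hobj f := by
  have key : ∀ (H : C ⥤ D) [H.Monoidal], H.map f = δ H A B ≫ pairingImage H f ≫ ε H := by
    intro H _
    simp [pairingImage]
  unfold AgreeOn
  rw [key F, key G, h, h', hF.δ_eq, hG.δ_eq, hF.ε_eq, hG.ε_eq]
  simp

theorem agreeOn_of_copairingImage (hF : IsStrict F) (hG : IsStrict G) {A B : C}
    {f : 𝟙_ C ⟶ A ⊗ B} {Y : D} (hY : Y = F.obj A ⊗ F.obj B) (hY' : Y = G.obj A ⊗ G.obj B)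
    {p : 𝟙_ D ⟶ Y} (h : copairingImage F f = p ≫ eqToHom hY)
    (h' : copairingImage G f = p ≫ eqToHom hY') : AgreeOn hobj f := by
  have key : ∀ (H : C ⥤ D) [H.Monoidal], H.map f = η H ≫ copairingImage H f ≫ μ H A B := by
    intro H _
    simp [copairingImage]
  unfold AgreeOn
  rw [key F, key G, h, h', hF.η_eq, hG.η_eq, hF.μ_eq, hG.μ_eq]
  simp

end Strict

/-! ### Strict functors are determined by the upper arcs. -/

section Uniqueness

variable {dL dR dL' dR' : ℂˣ} {F G : OCat dL dR ⥤ OCat dL' dR'} [F.Monoidal] [G.Monoidal]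

theorem IsStrict.obj_eq_of_letters (hF : IsStrict F) (hG : IsStrict G)
    (h : ∀ a, F.obj (letterObj dL dR a) = G.obj (letterObj dL dR a)) (A : OCat dL dR) :
    F.obj A = G.obj A := by
  rcases A with ⟨w⟩
  induction w with
  | nil => exact hF.obj_unit.symm.trans hG.obj_unit
  | cons a w ih =>
    refine (hF.obj_tensor (letterObj dL dR a) ⟨w⟩).symm.trans ?_
    rw [h, ih]
    exact hG.obj_tensor (letterObj dL dR a) ⟨w⟩

/-- By `exists_smul_ev` the scalar on the lower arc is the inverse of the one on its dual upper arc,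
so agreement on the latter is inherited. -/
theorem agreeOn_coev (hF : IsStrict F) (hG : IsStrict G) {hobj : ∀ A, F.obj A = G.obj A}
    {a b a' b' : Letter} (h : a ≠ b) (h' : a' ≠ b')
    (ha : F.obj (letterObj dL dR a) = letterObj dL' dR' a')
    (hb : F.obj (letterObj dL dR b) = letterObj dL' dR' b')
    (hev : AgreeOn hobj (ev dL dR b a h.symm)) : AgreeOn hobj (coev dL dR a b h) := by
  have ha' := (hobj _).symm.trans ha
  have hb' := (hobj _).symm.trans hb
  obtain ⟨y, hy, hy'⟩ := exists_smul_ev F h h' ha hb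
  obtain ⟨z, hz, hz'⟩ := exists_smul_ev G h h' ha' hb'
  have hyz : (y : ℂ) = z := by
    have key : pairingImage F (ev dL dR b a h.symm) =
        eqToHom (by rw [hobj, hobj]) ≫ pairingImage G (ev dL dR b a h.symm) := by
      unfold AgreeOn at hev
      unfold pairingImage
      rw [hev, hF.μ_eq, hG.μ_eq, hF.η_eq, hG.η_eq]
      simp
    rw [hy, hz, eqToHom_trans_assoc, cancel_epi] at key
    exact smul_left_injective ℂ (Diagram.hom_ne_zero _) key
  rw [hyz] at hy'
  exact agreeOn_of_copairingImage hF hG _ _ hy' hz'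

variable [F.Additive] [F.Linear ℂ] [G.Additive] [G.Linear ℂ]

/-- Strong induction on the length of the word: `Diagram.exists_factorization` writes a diagram in
terms of one arc and two diagrams on shorter words. -/
theorem agreeOn_of_unit_target (hF : IsStrict F) (hG : IsStrict G) {hobj : ∀ A, F.obj A = G.obj A}
    (hev : ∀ a b h, AgreeOn hobj (ev dL dR a b h)) (n : ℕ) (w : List Letter) (hn : w.length = n)
    (f : (⟨w⟩ : OCat dL dR) ⟶ 𝟙_ _) : AgreeOn hobj f := by
  induction n using Nat.strong_induction_on generalizing w with
  | _ n ih =>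
  induction f using hom_induction with
  | zero => exact agreeOn_zero
  | add f g hf hg => exact hf.add hg
  | smul_hom c D =>
    refine AgreeOn.smul c ?_
    rcases w with _ | ⟨a, w⟩
    · rw [Diagram.eq_id_nil D]
      exact agreeOn_id (𝟙_ (OCat dL dR))
    · obtain ⟨u, v, b, hab, D₁, D₂, hw, hD⟩ := Diagram.exists_factorization D
      have hl := congrArg List.length hw
      simp at hl hn
      have h1 := ih u.length (by omega) u rfl (Diagram.hom (A := ⟨u⟩) (B := 𝟙_ _) D₁)
      have h2 := ih v.length (by omega) v rfl (Diagram.hom (A := ⟨v⟩) (B := 𝟙_ _) D₂)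
      have h3 := (AgreeOn.tensor hF hG (agreeOn_id (letterObj dL dR a))
        (AgreeOn.tensor hF hG h1 (agreeOn_id (letterObj dL dR b)))).comp (hev a b hab)
      set M : Diagram ([a] ++ (u ++ [b])) [a, b] :=
        (Diagram.id [a]).tensor (D₁.tensor (Diagram.id [b])) with hM
      have e1 : 𝟙 (letterObj dL dR a) ⊗ₘ (Diagram.hom (A := ⟨u⟩) (B := 𝟙_ (OCat dL dR)) D₁ ⊗ₘ
          𝟙 (letterObj dL dR b)) = Diagram.hom (A := letterObj dL dR a ⊗ ⟨u⟩ ⊗ letterObj dL dR b)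
          (B := letterObj dL dR a ⊗ 𝟙_ _ ⊗ letterObj dL dR b) M :=
        (congrArg _ (Diagram.hom_tensor_hom (B' := letterObj dL dR b) (A' := letterObj dL dR b) D₁
          (Diagram.id [b]))).trans (Diagram.hom_tensor_hom (A := letterObj dL dR a)
          (B := letterObj dL dR a) (A' := ⟨u⟩ ⊗ letterObj dL dR b)
          (B' := 𝟙_ _ ⊗ letterObj dL dR b) (Diagram.id [a]) (D₁.tensor (Diagram.id [b])))
      rw [e1] at h3
      have h4 := h3.tensor hF hG h2
      have e2 := Diagram.hom_comp_hom (A := letterObj dL dR a ⊗ ⟨u⟩ ⊗ letterObj dL dR b)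
        (B := letterObj dL dR a ⊗ letterObj dL dR b) (C := 𝟙_ _) M (arc a b hab)
      set c := weight dL dR (M.glued (arc a b hab)).loops
      have e3 := (congrArg (· ⊗ₘ Diagram.hom (A := ⟨v⟩) (B := 𝟙_ (OCat dL dR)) D₂) e2).trans
        ((smul_tensorHom _ _ _).trans (congrArg (c • ·) (Diagram.hom_tensor_hom
          (A := letterObj dL dR a ⊗ ⟨u⟩ ⊗ letterObj dL dR b) (B := 𝟙_ _) (A' := ⟨v⟩) (B' := 𝟙_ _)
          (M.comp (arc a b hab)) D₂)))
      have h5 : AgreeOn hobj (c • Diagram.hom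
          (A := (letterObj dL dR a ⊗ ⟨u⟩ ⊗ letterObj dL dR b) ⊗ ⟨v⟩) (B := 𝟙_ (OCat dL dR))
          ((M.comp (arc a b hab)).tensor D₂)) := e3 ▸ h4
      -- Loop values are nonzero, so the weight `c` of the concatenation can be divided out without
      -- determining which loops occur.
      have h6 := h5.smul c⁻¹
      rw [inv_smul_smul₀ (weight_ne_zero _ _ _)] at h6
      have h7 := (agreeOn_eqToHom (hobj := hobj) (congrArg OCat.mk hw)).comp h6
      exact (congrArg (fun f => AgreeOn hobj f) (Diagram.eqToHom_comp_hom (A := ⟨a :: w⟩)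
        (B := (letterObj dL dR a ⊗ ⟨u⟩ ⊗ letterObj dL dR b) ⊗ ⟨v⟩) (C := 𝟙_ (OCat dL dR))
        ((M.comp (arc a b hab)).tensor D₂) _ D hD.symm)).mp h7

/-- Duality moves the first letter of the target to the source, which reduces everything to
morphisms into the unit object. -/
theorem agreeOn_of_ev_of_coev (hF : IsStrict F) (hG : IsStrict G) {hobj : ∀ A, F.obj A = G.obj A}
    (hev : ∀ a b h, AgreeOn hobj (ev dL dR a b h))
    (hcoev : ∀ a b h, AgreeOn hobj (coev dL dR a b h)) {A B : OCat dL dR} (f : A ⟶ B) :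
    AgreeOn hobj f := by
  rcases B with ⟨w⟩
  induction w generalizing A with
  | nil => exact agreeOn_of_unit_target hF hG hev _ A.word rfl f
  | cons b w ih =>
    obtain ⟨a, h⟩ : ∃ a, b ≠ a := by cases b <;> [exact ⟨.Xs, by decide⟩; exact ⟨.X, by decide⟩]
    let := exactPairing (dL := dL) (dR := dR) b a h
    -- `g` is the mate of `f` under the adjunction between tensoring with `a` and with `b` on the
    -- left; its target is shorter by one letter.
    obtain ⟨g, hg⟩ : ∃ g : letterObj dL dR a ⊗ A ⟶ ⟨w⟩,
        f = (λ_ A).inv ≫ coev dL dR b a h ▷ A ≫ (α_ _ _ _).hom ≫ letterObj dL dR b ◁ g :=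
      ⟨(tensorLeftHomEquiv A (letterObj dL dR b) (letterObj dL dR a) ⟨w⟩).symm f,
        ((tensorLeftHomEquiv A (letterObj dL dR b) (letterObj dL dR a) ⟨w⟩).apply_symm_apply f).symm⟩
    rw [hg, ← tensorHom_id, ← id_tensorHom, leftUnitor_inv_eq, associator_hom_eq]
    exact (agreeOn_eqToHom _).comp (((hcoev b a h).tensor hF hG (agreeOn_id A)).comp
      ((agreeOn_eqToHom _).comp ((agreeOn_id _).tensor hF hG (ih g))))

theorem eq_of_agreeOn_ev (hF : IsStrict F) (hG : IsStrict G) {a b : Letter} (hab : a ≠ b)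
    (haF : F.obj (objX dL dR) = letterObj dL' dR' a)
    (hbF : F.obj (objXs dL dR) = letterObj dL' dR' b)
    (haG : G.obj (objX dL dR) = letterObj dL' dR' a)
    (hbG : G.obj (objXs dL dR) = letterObj dL' dR' b)
    {p : letterObj dL' dR' a ⊗ letterObj dL' dR' b ⟶ 𝟙_ _}
    {q : letterObj dL' dR' b ⊗ letterObj dL' dR' a ⟶ 𝟙_ _}
    (hpF : pairingImage F (epsX dL dR) = eqToHom (by rw [haF, hbF]) ≫ p)
    (hpG : pairingImage G (epsX dL dR) = eqToHom (by rw [haG, hbG]) ≫ p)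
    (hqF : pairingImage F (epsXs dL dR) = eqToHom (by rw [haF, hbF]) ≫ q)
    (hqG : pairingImage G (epsXs dL dR) = eqToHom (by rw [haG, hbG]) ≫ q) : F = G := by
  have hobj : ∀ A, F.obj A = G.obj A := hF.obj_eq_of_letters hG fun c => by
    cases c
    · exact haF.trans haG.symm
    · exact hbF.trans hbG.symm
  have e1 : AgreeOn hobj (ev dL dR .X .Xs (by decide)) :=
    agreeOn_of_pairingImage hF hG _ _ hpF hpG
  have e2 : AgreeOn hobj (ev dL dR .Xs .X (by decide)) :=
    agreeOn_of_pairingImage hF hG _ _ hqF hqG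
  refine CategoryTheory.Functor.ext hobj fun A B f => agreeOn_of_ev_of_coev hF hG ?_ ?_ f
  · rintro (_ | _) (_ | _) h
    exacts [absurd rfl h, e1, e2, absurd rfl h]
  · rintro (_ | _) (_ | _) h
    -- The lower arc with letters `X`, `X^*` is dual to the upper arc with letters `X^*`, `X`, so
    -- `e1` and `e2` are used crosswise.
    exacts [absurd rfl h, agreeOn_coev hF hG h hab haF hbF e2,
      agreeOn_coev hF hG h hab.symm hbF haF e1, absurd rfl h]

end Uniqueness

theorem eq_of_scalesArcs_or_swapsArcs {d z : ℂˣ} (F G : OCat d d ⥤ OCat d d) [F.Monoidal]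
    [F.Additive] [F.Linear ℂ] [G.Monoidal] [G.Additive] [G.Linear ℂ] (hF : IsStrict F)
    (hG : IsStrict G)
    (h : ScalesArcs F z ∧ ScalesArcs G z ∨ SwapsArcs F z ∧ SwapsArcs G z) : F = G := by
  obtain ⟨⟨a, b, p, q⟩, ⟨a', b', p', q'⟩⟩ | ⟨⟨a, b, p, q⟩, ⟨a', b', p', q'⟩⟩ := h
  · exact eq_of_agreeOn_ev hF hG (a := .X) (b := .Xs) (by decide) a b a' b' p p' q q'
  · exact eq_of_agreeOn_ev hF hG (a := .Xs) (b := .X) (by decide) a b a' b' p p' q q'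

end OrientedKauffman

open OrientedKauffman in
theorem proposition2p3 :
    (∀ dL dR dL' dR' : ℂˣ,
      MonoidallyEquivalent (OCat dL dR) (OCat dL' dR') ↔ dL * dR = dL' * dR') ∧
    (∀ dL dR d : ℂˣ, d ^ 2 = dL * dR → MonoidallyEquivalent (OCat dL dR) (OCat d d)) ∧
    (∀ d d' : ℂˣ, MonoidallyEquivalent (OCat d d) (OCat d' d') ↔ d = d' ∨ d = -d') ∧
    (∀ d : ℂˣ,
      (∀ (F : OCat d d ⥤ OCat d d) [F.Monoidal] [F.Additive] [F.Linear ℂ] [F.IsEquivalence],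
        ∃ z : ℂˣ, ScalesArcs F z ∨ SwapsArcs F z) ∧
      (∀ z : ℂˣ,
        (∃ (F : OCat d d ⥤ OCat d d) (_ : F.Monoidal), F.Additive ∧ F.Linear ℂ ∧
          F.IsEquivalence ∧ IsStrict F ∧ ScalesArcs F z) ∧
        (∃ (F : OCat d d ⥤ OCat d d) (_ : F.Monoidal), F.Additive ∧ F.Linear ℂ ∧
          F.IsEquivalence ∧ IsStrict F ∧ SwapsArcs F z) ∧
        (∀ (F G : OCat d d ⥤ OCat d d) [F.Monoidal] [F.Additive] [F.Linear ℂ]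
          [G.Monoidal] [G.Additive] [G.Linear ℂ], IsStrict F → IsStrict G →
          (ScalesArcs F z ∧ ScalesArcs G z ∨ SwapsArcs F z ∧ SwapsArcs G z) → F = G))) := by
  have h1 : ∀ dL dR dL' dR' : ℂˣ,
      MonoidallyEquivalent (OCat dL dR) (OCat dL' dR') ↔ dL * dR = dL' * dR' :=
    fun _ _ _ _ => ⟨mul_eq_of_monoidallyEquivalent, monoidallyEquivalent_of_mul_eq⟩
  refine ⟨h1, fun dL dR d h => (h1 _ _ _ _).2 (h.symm.trans (pow_two d)), fun d d' => ?_,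
    fun d => ⟨fun F => scalesArcs_or_swapsArcs F, fun z => ⟨exists_scalesArcs d z,
      exists_swapsArcs d z, fun F G => eq_of_scalesArcs_or_swapsArcs F G⟩⟩⟩
  -- For equal loop values the criterion becomes `d * d = d' * d'`, which is solved in the field of
  -- complex numbers.
  rw [h1, Units.ext_iff, Units.ext_iff, Units.ext_iff, Units.val_mul, Units.val_mul, Units.val_neg,
    mul_self_eq_mul_self_iff]
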